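/- Let $p$ be a prime, $k$ a finite field with an embedding $k\hookrightarrow\overline{\mathbf F}_p$, $F$ a number field, $x$ a finite place of $F$, with completion $F_x$, ring of integers $\mathcal O_x$, uniformizer $\varpi$ and residue field $k_x$ of order $q\equiv 1 \pmod p$. Let $n=n_1+n_2<p$, $G=\mathrm{GL}_n$, let $B\subset G$ be the upper triangular Borel subgroup, $P\subset G$ the block upper triangular parabolic subgroup with diagonal blocks of sizes $n_1,n_2$, $\mathfrak p\subset G(\mathcal O_x)$ the preimage of $P(k_x)$, and $K^1=\ker(G(\mathcal O_x)\to G(k_x))$. Let $\bar\rho:\mathrm{Gal}(\overline F_x/F_x)\to \mathrm{GL}_n(k)$ be continuous, unramified and semisimple, let $\mathrm{Frob}_x$ be a geometric Frobenius element, and let $a_1,\dots,a_n\in\overline{\mathbf F}_p^\times$ be the eigenvalues of $\bar\rho(\mathrm{Frob}_x)$ with multiplicity. Let $\alpha\in\overline{\mathbf F}_p$ occur at least $n_2$ times among $a_1,\dots,a_n$. Let $\pi$ be an irreducible admissible representation of $G(F_x)$ over $\overline{\mathbf F}_p$ associated to $\bar\rho$: it is a subquotient of a principal series $\mathrm{Ind}_{B}^{G}(\chi_1\otimes\cdots\otimes\chi_n)$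 (locally constant $f$ with $f(bg)=\prod_i\chi_i(b_{ii})f(g)$, under right translation; as $q=1$ in $\overline{\mathbf F}_p$, taking $q^{1/2}=1$, this is also the normalized induction) with $\chi_i$ unramified and $\{\chi_1(\varpi),\dots,\chi_n(\varpi)\}=\{a_1,\dots,a_n\}$ as multisets. For $1\le j\le n_2$ let $V^{j,2}$ be the operator of the double coset $\mathfrak p g\mathfrak p=\bigsqcup_i g_i\mathfrak p$, $g=\mathrm{diag}(1^{n_1},\varpi^{j},1^{n_2-j})$ (exponents denote repetition), on the continuous cohomology $H^1(\mathfrak p,\pi)$, given on cocycles by $(V^{j,2}f)(y)=\sum_i g_{\sigma(i)}f(g_{\sigma(i)}^{-1}yg_i)$, where $\sigma=\sigma_y$ is the permutation with $g_{\sigma(i)}^{-1}yg_i\in\mathfrak p$. Let $P_j(X)=\prod_{S}(X-e_j(a_s: s\in S))$, the product over $n_2$-element subsets $S\subset\{1,\dots,n\}$, with $e_j$ the $j$-th elementary symmetric polynomial, and write $P_j=Q_jR_j$ with $R_j$ the largest power of $X-\binom{n_2}{j}\alpha^j$ dividing $P_j$. Then inflation $H^1(P(k_x),\pi^{K^1})\to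 H^1(\mathfrak p,\pi)$ is bijective; identifying the two spaces, the limit $e_\alpha=\lim_{m\to\infty}\bigl(\prod_{j=1}^{n_2}Q_j(V^{j,2})\bigr)^{m!}$ exists pointwise (the sequence is eventually constant on each class) as a linear operator on $H^1(P(k_x),\pi^{K^1})$; and the map $$H^1(G(k_x),\pi^{K^1})\longrightarrow e_\alpha H^1(P(k_x),\pi^{K^1}),\qquad c\mapsto e_\alpha(\mathrm{res}\,c),$$ is injective. -/

import Mathlib

open scoped Valued WithZero Polynomial
open Matrix

noncomputable section

namespace ModPLocal

/-! ### Continuous first cohomology of a topological group with discrete coefficients -/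

section Cohomology

variable {R Γ Γ' V V' : Type*} [CommRing R]
  [Group Γ] [TopologicalSpace Γ] [Group Γ'] [TopologicalSpace Γ']
  [AddCommGroup V] [Module R V] [AddCommGroup V'] [Module R V']

/-- Continuous `1`-cocycles of `Γ` with values in `V` (with the discrete topology on `V`):
locally constant `f` with `f (g h) = f g + g f h`. -/
def contCocycles (ρ : Representation R Γ V) : Submodule R (Γ → V) where
  carrier := {f | IsLocallyConstant f ∧ ∀ g h, f (g * h) = f g + ρ g (f h)}
  add_mem' := by
    rintro a b ⟨ha, ha'⟩ ⟨hb, hb'⟩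
    refine ⟨ha.add hb, fun g h => ?_⟩
    simp only [Pi.add_apply, ha', hb', map_add]
    abel
  zero_mem' := ⟨IsLocallyConstant.const 0, fun g h => by simp⟩
  smul_mem' := by
    rintro c a ⟨ha, ha'⟩
    refine ⟨ha.comp (fun v => c • v), fun g h => ?_⟩
    simp only [Pi.smul_apply, ha', map_smul, smul_add]

/-- The continuous cocycles of the form `g ↦ g v - v`. -/
def contCoboundaries (ρ : Representation R Γ V) : Submodule R (contCocycles ρ) where
  carrier := {f | ∃ v : V, ∀ g, (f : Γ → V) g = ρ g v - v}
  add_mem' := by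
    rintro a b ⟨v, hv⟩ ⟨w, hw⟩
    refine ⟨v + w, fun g => ?_⟩
    simp only [Submodule.coe_add, Pi.add_apply, hv, hw, map_add]
    abel
  zero_mem' := ⟨0, fun g => by simp⟩
  smul_mem' := by
    rintro c a ⟨v, hv⟩
    refine ⟨c • v, fun g => ?_⟩
    simp only [Submodule.coe_smul, Pi.smul_apply, hv, map_smul, smul_sub]

/-- The continuous cohomology group `H¹(Γ, V)`, where `V` carries the discrete topology. If `Γ` is
discrete, this is the usual first group cohomology. -/
abbrev H1 (ρ : Representation R Γ V) : Type _ := contCocycles ρ ⧸ contCoboundaries ρ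

/-- Pull-back of cocycles along a continuous homomorphism `φ : Γ' → Γ` and a linear map
`T : V → V'` compatible with the actions. -/
def cocyclesMap (ρ : Representation R Γ V) (ρ' : Representation R Γ' V') (φ : Γ' →* Γ)
    (hφ : Continuous φ) (T : V →ₗ[R] V') (hT : ∀ g v, T (ρ (φ g) v) = ρ' g (T v)) :
    contCocycles ρ →ₗ[R] contCocycles ρ' where
  toFun f := ⟨fun g => T ((f : Γ → V) (φ g)),
    (f.2.1.comp_continuous hφ).comp T, fun g h => by
      simp only [map_mul, f.2.2, map_add, hT]⟩
  map_add' f g := by ext x; simp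
  map_smul' c f := by ext x; simp

/-- The map `H¹(Γ, V) → H¹(Γ', V')`, `[f] ↦ [T ∘ f ∘ φ]` (restriction, inflation). -/
def H1map (ρ : Representation R Γ V) (ρ' : Representation R Γ' V') (φ : Γ' →* Γ)
    (hφ : Continuous φ) (T : V →ₗ[R] V') (hT : ∀ g v, T (ρ (φ g) v) = ρ' g (T v)) :
    H1 ρ →ₗ[R] H1 ρ' :=
  Submodule.mapQ _ _ (cocyclesMap ρ ρ' φ hφ T hT) <| by
    rintro f ⟨v, hv⟩
    exact ⟨T v, fun g => by
      change T ((f : Γ → V) (φ g)) = _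
      rw [hv, map_sub, hT]⟩

end Cohomology

/-! ### Smooth representations and Hecke operators on `H¹` -/

section Smooth

variable {R G V W : Type*} [Field R] [Group G]
  [AddCommGroup V] [Module R V] [AddCommGroup W] [Module R W]

/-- Every vector has an open stabiliser. -/
def IsSmooth [TopologicalSpace G] (π : Representation R G V) : Prop :=
  ∀ v, IsOpen {g : G | π g v = v}

/-- Smooth, with finite-dimensional invariants under every open subgroup. -/
structure IsAdmissible [TopologicalSpace G] (π : Representation R G V) : Prop where
  smooth : IsSmooth π
  finite : ∀ U : Subgroup G, IsOpen (U : Set G) →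
    Module.Finite R (Representation.invariants (π.comp U.subtype))

/-- `π` is a subquotient of `σ`: the image of an equivariant surjection from a
subrepresentation `M` of `σ`. -/
def IsSubquotient (π : Representation R G V) (σ : Representation R G W) : Prop :=
  ∃ (M : Submodule R W) (hM : ∀ g, ∀ m ∈ M, σ g m ∈ M) (φ : M →ₗ[R] V),
    Function.Surjective φ ∧ ∀ (g : G) (m : M), φ ⟨σ g m, hM g m m.2⟩ = π g (φ m)

end Smooth

section Cosets

variable {G : Type*} [Group G]

/-- The set of left cosets `c ∈ G ⧸ H` contained in the double coset `H g H`. -/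
def doubleCosetCosets (H : Subgroup G) (g : G) : Set (G ⧸ H) :=
  MulAction.orbit H (g : G ⧸ H)

/-- For `x ∈ H` and a left coset `c = r H` with `x r H = r' H` (`r`, `r'` the chosen
representatives), the element `r'⁻¹ x r` of `H`. -/
def cosetCocycle (H : Subgroup G) (x : H) (c : G ⧸ H) : H :=
  ⟨(x • c).out⁻¹ * ((x : G) * c.out), by
    rw [← QuotientGroup.eq, QuotientGroup.out_eq']
    conv_lhs => rw [← QuotientGroup.out_eq' c]
    rfl⟩

theorem cosetCocycle_mul (H : Subgroup G) (x y : H) (c : G ⧸ H) :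
    cosetCocycle H (x * y) c = cosetCocycle H x (y • c) * cosetCocycle H y c := by
  apply Subtype.ext
  simp only [cosetCocycle, Subgroup.coe_mul, mul_smul]
  group

theorem out_mul_cosetCocycle (H : Subgroup G) (x : H) (c : G ⧸ H) :
    (x • c).out * (cosetCocycle H x c : G) = (x : G) * c.out := by
  simp [cosetCocycle]

theorem mem_doubleCosetCosets_smul (H : Subgroup G) (g : G) (x : H) (c : G ⧸ H) :
    c ∈ doubleCosetCosets H g ↔ x • c ∈ doubleCosetCosets H g :=
  ⟨fun h => (MulAction.mem_orbit_of_mem_orbit x h), fun h => by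
    have := MulAction.mem_orbit_of_mem_orbit x⁻¹ h
    rwa [inv_smul_smul] at this⟩

theorem isLocallyConstant_smul_coset [TopologicalSpace G] [IsTopologicalGroup G]
    (H : Subgroup G) (hH : IsOpen (H : Set G)) (c : G ⧸ H) :
    IsLocallyConstant (fun x : H => x • c) := by
  rw [IsLocallyConstant.iff_isOpen_fiber]
  intro d
  have : (fun x : H => x • c) ⁻¹' {d} = (fun x : H => d.out⁻¹ * ((x : G) * c.out)) ⁻¹' H := by
    ext x
    simp only [Set.mem_preimage, Set.mem_singleton_iff, SetLike.mem_coe]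
    rw [← QuotientGroup.eq, QuotientGroup.out_eq', eq_comm]
    conv_lhs => rw [← QuotientGroup.out_eq' c]
    rfl
  rw [this]
  exact hH.preimage (by fun_prop)

theorem continuous_cosetCocycle [TopologicalSpace G] [IsTopologicalGroup G]
    (H : Subgroup G) (hH : IsOpen (H : Set G)) (c : G ⧸ H) :
    Continuous (fun x : H => cosetCocycle H x c) := by
  refine Continuous.subtype_mk ?_ _
  have h : Continuous (fun x : H => (x • c).out) :=
    ((isLocallyConstant_smul_coset H hH c).comp Quotient.out).continuous
  exact h.inv.mul (by fun_prop)

end Cosets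

section Hecke

variable {R G V : Type*} [Field R] [Group G] [TopologicalSpace G] [IsTopologicalGroup G]
  [AddCommGroup V] [Module R V]

/-- The double coset operator on continuous cocycles of `H` with values in `V`: if
`H g H = ⨆ r_c H` and `x r_c H = r_{xc} H`, then
`(T f) x = ∑ c, r_{xc} f (r_{xc}⁻¹ x r_c)`. -/
def heckeCocycles (π : Representation R G V) (H : Subgroup G) (hH : IsOpen (H : Set G)) (g : G)
    (hfin : (doubleCosetCosets H g).Finite) :
    contCocycles (π.comp H.subtype) →ₗ[R] contCocycles (π.comp H.subtype) where
  toFun f := ⟨fun x => ∑ c ∈ hfin.toFinset,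
      π (x • c).out ((f : H → V) (cosetCocycle H x c)), by
    constructor
    · have h : ∀ s : Finset (G ⧸ H), IsLocallyConstant (fun x : H => ∑ c ∈ s,
          π (x • c).out ((f : H → V) (cosetCocycle H x c))) := by
        intro s
        induction s using Finset.cons_induction with
        | empty => exact IsLocallyConstant.const 0
        | cons c s hc ih =>
          simp only [Finset.sum_cons]
          exact ((isLocallyConstant_smul_coset H hH c).comp₂
            (f.2.1.comp_continuous (continuous_cosetCocycle H hH c))
            (fun d v => π d.out v)).add ih
      exact h _
    · intro x y
      have hy : ∑ c ∈ hfin.toFinset, π (x • c).out ((f : H → V) (cosetCocycle H x c)) =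
          ∑ c ∈ hfin.toFinset,
            π (x • y • c).out ((f : H → V) (cosetCocycle H x (y • c))) := by
        refine (Finset.sum_equiv (MulAction.toPerm y) (fun c => ?_) (fun c _ => rfl)).symm
        simpa using mem_doubleCosetCosets_smul H g y c
      change ∑ c ∈ hfin.toFinset, π ((x * y) • c).out ((f : H → V) (cosetCocycle H (x * y) c)) =
        ∑ c ∈ hfin.toFinset, π (x • c).out ((f : H → V) (cosetCocycle H x c)) +
          π x (∑ c ∈ hfin.toFinset, π (y • c).out ((f : H → V) (cosetCocycle H y c)))
      rw [hy, map_sum, ← Finset.sum_add_distrib]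
      refine Finset.sum_congr rfl fun c _ => ?_
      rw [cosetCocycle_mul, f.2.2, map_add, mul_smul]
      congr 1
      simp only [MonoidHom.comp_apply, Subgroup.subtype_apply]
      rw [← Module.End.mul_apply, ← Module.End.mul_apply, ← map_mul, ← map_mul,
        out_mul_cosetCocycle]⟩
  map_add' f f' := by
    ext x
    simp [Finset.sum_add_distrib]
  map_smul' a f := by
    ext x
    simp [Finset.smul_sum]

/-- The operator of the double coset `H g H` on `H¹(H, V)`, for an open subgroup `H`. (The value
is `0` by convention if `H g H / H` is infinite, which does not happen for `H` compact.) -/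
def heckeH1 (π : Representation R G V) (H : Subgroup G) (hH : IsOpen (H : Set G)) (g : G) :
    Module.End R (H1 (π.comp H.subtype)) :=
  open Classical in
  if hfin : (doubleCosetCosets H g).Finite then
    Submodule.mapQ _ _ (heckeCocycles π H hH g hfin) <| by
      rintro f ⟨v, hv⟩
      refine ⟨∑ c ∈ hfin.toFinset, π c.out v, fun x => ?_⟩
      have hx : ∑ c ∈ hfin.toFinset, π c.out v = ∑ c ∈ hfin.toFinset, π (x • c).out v := by
        refine (Finset.sum_equiv (MulAction.toPerm x) (fun c => ?_) (fun c _ => rfl)).symm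
        simpa using mem_doubleCosetCosets_smul H g x c
      change ∑ c ∈ hfin.toFinset, π (x • c).out ((f : H → V) (cosetCocycle H x c)) = _
      conv_rhs => rw [map_sum, hx]
      rw [← Finset.sum_sub_distrib]
      refine Finset.sum_congr rfl fun c _ => ?_
      rw [hv, map_sub]
      congr 1
      simp only [MonoidHom.comp_apply, Subgroup.subtype_apply]
      rw [← Module.End.mul_apply, ← Module.End.mul_apply, ← map_mul, ← map_mul,
        out_mul_cosetCocycle]
  else 0

end Hecke

/-! ### The subgroups of `GL_n` -/

section Groups

/-- The standard (block upper triangular) parabolic subgroup of `GL_n` with two diagonal blocks of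
sizes `n₁` and `n - n₁`. -/
def blockParabolic (n n₁ : ℕ) (k : Type*) [Field k] : Subgroup (GL (Fin n) k) where
  carrier := {g | (g : Matrix (Fin n) (Fin n) k).BlockTriangular
    (fun i => if (i : ℕ) < n₁ then 0 else 1 : Fin n → ℕ)}
  mul_mem' ha hb := by
    simpa using Matrix.BlockTriangular.mul ha hb
  one_mem' := by simpa using Matrix.blockTriangular_one
  inv_mem' {a} ha := by
    have := a.invertible
    simpa using Matrix.blockTriangular_inv_of_blockTriangular ha

variable (K : Type*) [Field K] [Valued K ℤᵐ⁰] (n n₁ : ℕ)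

/-- The inclusion `GL_n(𝒪) → GL_n(K)`. -/
def integralGL : GL (Fin n) 𝒪[K] →* GL (Fin n) K :=
  Matrix.GeneralLinearGroup.map (algebraMap 𝒪[K] K)

/-- The reduction map `GL_n(𝒪) → GL_n(k)`, `k` the residue field. Its kernel is the
full congruence subgroup. -/
def reductionGL : GL (Fin n) 𝒪[K] →* GL (Fin n) 𝓀[K] :=
  Matrix.GeneralLinearGroup.map (IsLocalRing.residue 𝒪[K])

/-- The standard parahoric subgroup of `GL_n(𝒪)`, viewed in `GL_n(K)`: the matrices whose
reduction lies in the parabolic `P(k)` with blocks of sizes `n₁` and `n - n₁`. -/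
abbrev parahoric : Subgroup (GL (Fin n) K) :=
  ((blockParabolic n n₁ 𝓀[K]).comap (reductionGL K n)).map (integralGL K n)

theorem integralGL_injective : Function.Injective (integralGL K n) := by
  intro a b h
  ext i j
  have := congrArg (fun g : GL (Fin n) K => (g : Matrix _ _ K) i j) h
  simpa [integralGL] using this

theorem reductionGL_surjective : Function.Surjective (reductionGL K n) := by
  intro g
  choose a ha using fun i j => IsLocalRing.residue_surjective (R := 𝒪[K])
    ((g : Matrix (Fin n) (Fin n) 𝓀[K]) i j)
  have hmap : (IsLocalRing.residue 𝒪[K]).mapMatrix (Matrix.of a) = (g : Matrix (Fin n) (Fin n) 𝓀[K]) := by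
    ext i j
    simp [ha]
  have hu : IsUnit (Matrix.of a) := by
    rw [Matrix.isUnit_iff_isUnit_det]
    apply (isUnit_map_iff (IsLocalRing.residue 𝒪[K]) _).1
    rw [RingHom.map_det, hmap, ← Matrix.isUnit_iff_isUnit_det]
    exact g.isUnit
  refine ⟨hu.unit, ?_⟩
  apply Units.ext
  simpa [reductionGL] using hmap

/-- Reduction `𝔭 → P(k)` on the parahoric subgroup. -/
def parahoricReduction : parahoric K n n₁ →* blockParabolic n n₁ 𝓀[K] :=
  ((reductionGL K n).subgroupComap (blockParabolic n n₁ 𝓀[K])).comp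
    (Subgroup.equivMapOfInjective _ (integralGL K n) (integralGL_injective K n)).symm.toMonoidHom

theorem exists_parahoric_lift (g : parahoric K n n₁) : ∃ a : GL (Fin n) 𝒪[K],
    integralGL K n a = g ∧ reductionGL K n a = parahoricReduction K n n₁ g := by
  obtain ⟨a, rfl⟩ := (Subgroup.equivMapOfInjective _ (integralGL K n)
    (integralGL_injective K n)).surjective g
  refine ⟨a, rfl, ?_⟩
  simp only [parahoricReduction, MonoidHom.comp_apply, MulEquiv.coe_toMonoidHom,
    MulEquiv.symm_apply_apply]
  rfl

theorem exists_integralGL_eq (g : GL (Fin n) K)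
    (h : ∀ i j, Valued.v ((g : Matrix (Fin n) (Fin n) K) i j) ≤ 1)
    (h' : ∀ i j, Valued.v (((g⁻¹ : GL (Fin n) K) : Matrix (Fin n) (Fin n) K) i j) ≤ 1) :
    ∃ a, integralGL K n a = g := by
  have hinj : Function.Injective ((algebraMap 𝒪[K] K).mapMatrix (m := Fin n)) := by
    intro a b hab
    ext i j
    exact congrFun (congrFun hab i) j
  let A : Matrix (Fin n) (Fin n) 𝒪[K] := Matrix.of fun i j => ⟨_, h i j⟩
  let B : Matrix (Fin n) (Fin n) 𝒪[K] := Matrix.of fun i j => ⟨_, h' i j⟩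
  have hA : (algebraMap 𝒪[K] K).mapMatrix A = g := rfl
  have hB : (algebraMap 𝒪[K] K).mapMatrix B = (g⁻¹ : GL (Fin n) K) := rfl
  refine ⟨⟨A, B, hinj ?_, hinj ?_⟩, ?_⟩
  · rw [map_mul, map_one, hA, hB, Units.mul_inv]
  · rw [map_mul, map_one, hA, hB, Units.inv_mul]
  · exact Units.ext hA

theorem reductionGL_eq_one (a : GL (Fin n) 𝒪[K])
    (h : ∀ i j, Valued.v ((integralGL K n a : Matrix (Fin n) (Fin n) K) i j -
      (1 : Matrix (Fin n) (Fin n) K) i j) < 1) : reductionGL K n a = 1 := by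
  ext i j
  have h1 : (a : Matrix (Fin n) (Fin n) 𝒪[K]) i j - (1 : Matrix (Fin n) (Fin n) 𝒪[K]) i j ∈
      IsLocalRing.maximalIdeal 𝒪[K] := by
    rw [IsLocalRing.mem_maximalIdeal, mem_nonunits_iff,
      (Valuation.integer.integers (Valued.v (R := K))).isUnit_iff_valuation_eq_one]
    have := h i j
    have h2 : (1 : Matrix (Fin n) (Fin n) K) i j =
        algebraMap 𝒪[K] K ((1 : Matrix (Fin n) (Fin n) 𝒪[K]) i j) := by
      rw [Matrix.one_apply, Matrix.one_apply]
      split_ifs <;> simp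
    rw [h2] at this
    exact (lt_of_eq_of_lt (by rw [map_sub]; rfl) this).ne
  rw [← IsLocalRing.residue_eq_zero_iff, map_sub, sub_eq_zero] at h1
  change IsLocalRing.residue 𝒪[K] ((a : Matrix (Fin n) (Fin n) 𝒪[K]) i j) =
    (1 : Matrix (Fin n) (Fin n) 𝓀[K]) i j
  rw [h1, Matrix.one_apply, Matrix.one_apply]
  split_ifs <;> simp

theorem isOpen_residualBall :
    IsOpen {g : GL (Fin n) K | ∀ i j, Valued.v ((g : Matrix (Fin n) (Fin n) K) i j -
      (1 : Matrix (Fin n) (Fin n) K) i j) < 1} := by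
  have h1 : IsOpen {a : K | Valued.v a < 1} := by
    simpa [Valuation.restrict_lt_one_iff] using Valued.isOpen_ball (R := K) 1
  simp only [Set.ofPred_forall]
  refine isOpen_iInter_of_finite fun i => isOpen_iInter_of_finite fun j => ?_
  refine h1.preimage (f := fun g : GL (Fin n) K => (g : Matrix (Fin n) (Fin n) K) i j -
      (1 : Matrix (Fin n) (Fin n) K) i j) ?_
  exact (Units.continuous_val.matrix_elem i j).sub continuous_const

theorem parahoric_isOpen : IsOpen (parahoric K n n₁ : Set (GL (Fin n) K)) := by
  set U := {g : GL (Fin n) K | ∀ i j, Valued.v ((g : Matrix (Fin n) (Fin n) K) i j -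
      (1 : Matrix (Fin n) (Fin n) K) i j) < 1} with hU
  have hle : ∀ g ∈ U, ∀ i j, Valued.v ((g : Matrix (Fin n) (Fin n) K) i j) ≤ 1 := by
    intro g hg i j
    have h1 : Valued.v ((1 : Matrix (Fin n) (Fin n) K) i j) ≤ 1 := by
      rw [Matrix.one_apply]
      split_ifs <;> simp
    simpa using (Valued.v.map_add _ _).trans (max_le (hg i j).le h1)
  have hU1 : IsOpen U := isOpen_residualBall K n
  apply Subgroup.isOpen_of_mem_nhds (g := 1)
  have h1 : (1 : GL (Fin n) K) ∈ U ∩ U⁻¹ := by simp [hU]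
  refine Filter.mem_of_superset ((hU1.inter hU1.inv).mem_nhds h1) ?_
  rintro g ⟨hg, hg'⟩
  obtain ⟨a, rfl⟩ := exists_integralGL_eq K n g (hle _ hg) (hle _ hg')
  refine ⟨a, ?_, rfl⟩
  simp [reductionGL_eq_one K n a hg, one_mem]

/-- The finite group `GL_n(k)` carries the discrete topology. -/
instance residualTopology : TopologicalSpace (GL (Fin n) 𝓀[K]) := ⊥

instance : DiscreteTopology (GL (Fin n) 𝓀[K]) := ⟨rfl⟩

theorem continuous_parahoricReduction : Continuous (parahoricReduction K n n₁) := by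
  have hker : ∀ g : parahoric K n n₁, (∀ i j, Valued.v (((g : GL (Fin n) K) :
      Matrix (Fin n) (Fin n) K) i j - (1 : Matrix (Fin n) (Fin n) K) i j) < 1) →
      parahoricReduction K n n₁ g = 1 := by
    intro g hg
    obtain ⟨a, ha, ha'⟩ := exists_parahoric_lift K n n₁ g
    apply Subtype.ext
    rw [← ha', reductionGL_eq_one K n a (by rw [ha]; exact hg)]
    rfl
  refine continuous_of_continuousAt_one _ ?_
  rw [ContinuousAt, map_one, nhds_discrete (blockParabolic n n₁ 𝓀[K]), Filter.tendsto_pure]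
  have hmem : {g : parahoric K n n₁ | ∀ i j, Valued.v (((g : GL (Fin n) K) :
      Matrix (Fin n) (Fin n) K) i j - (1 : Matrix (Fin n) (Fin n) K) i j) < 1} ∈ nhds 1 := by
    refine ((isOpen_residualBall K n).preimage continuous_subtype_val).mem_nhds ?_
    simp
  filter_upwards [hmem] with g hg using hker g hg

end Groups

/-! ### The representation on invariants under the full congruence subgroup -/

section Residual

variable {K : Type*} [Field K] [Valued K ℤᵐ⁰] {n : ℕ}
  {R V : Type*} [Field R] [AddCommGroup V] [Module R V]

/-- The subspace of vectors fixed by the full congruence subgroup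
`ker (GL_n(𝒪) → GL_n(k))`. -/
abbrev congruenceInvariants (π : Representation R (GL (Fin n) K) V) : Submodule R V :=
  Representation.invariants ((π.comp (integralGL K n)).comp (reductionGL K n).ker.subtype)

/-- The action of `GL_n(k)` on the invariants of the full congruence subgroup, induced by the
action of `GL_n(𝒪)`. -/
def residualRep (π : Representation R (GL (Fin n) K) V) :
    Representation R (GL (Fin n) 𝓀[K]) (congruenceInvariants π) :=
  (Representation.quotientToInvariants (π.comp (integralGL K n)) (reductionGL K n).ker).comp
    (QuotientGroup.quotientKerEquivOfSurjective (reductionGL K n)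
      (reductionGL_surjective K n)).symm.toMonoidHom

theorem residualRep_reductionGL (π : Representation R (GL (Fin n) K) V) (a : GL (Fin n) 𝒪[K])
    (v : congruenceInvariants π) :
    (residualRep π (reductionGL K n a) v : V) = π (integralGL K n a) v := by
  have : (QuotientGroup.quotientKerEquivOfSurjective (reductionGL K n)
      (reductionGL_surjective K n)).symm (reductionGL K n a) = (a : _ ⧸ (reductionGL K n).ker) := by
    rw [MulEquiv.symm_apply_eq]
    rfl
  simp only [residualRep, MonoidHom.comp_apply, MulEquiv.coe_toMonoidHom, this]
  rfl

variable (n₁ : ℕ)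

/-- The action of `P(k)` on the invariants of the full congruence subgroup. -/
abbrev residualParabolicRep (π : Representation R (GL (Fin n) K) V) :
    Representation R (blockParabolic n n₁ 𝓀[K]) (congruenceInvariants π) :=
  (residualRep π).comp (blockParabolic n n₁ 𝓀[K]).subtype

/-- The restriction of a representation of `GL_n(K)` to the parahoric subgroup. -/
abbrev parahoricRep (π : Representation R (GL (Fin n) K) V) :
    Representation R (parahoric K n n₁) V :=
  π.comp (parahoric K n n₁).subtype

/-- Restriction `H¹(GL_n(k), π^{K¹}) → H¹(P(k), π^{K¹})`. -/
def restrictionH1 (π : Representation R (GL (Fin n) K) V) :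
    H1 (residualRep π) →ₗ[R] H1 (residualParabolicRep n₁ π) :=
  H1map _ _ (blockParabolic n n₁ 𝓀[K]).subtype continuous_subtype_val LinearMap.id
    fun _ _ => rfl

/-- Inflation `H¹(P(k), π^{K¹}) → H¹(𝔭, π)`. -/
def inflationH1 (π : Representation R (GL (Fin n) K) V) :
    H1 (residualParabolicRep n₁ π) →ₗ[R] H1 (parahoricRep n₁ π) :=
  H1map _ _ (parahoricReduction K n n₁) (continuous_parahoricReduction K n n₁)
    (congruenceInvariants π).subtype fun g v => by
      obtain ⟨a, ha, ha'⟩ := exists_parahoric_lift K n n₁ g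
      simp only [MonoidHom.comp_apply, Subgroup.subtype_apply, Submodule.subtype_apply]
      rw [← ha, ← ha', residualRep_reductionGL]

end Residual

/-! ### Unramified principal series -/

section PrincipalSeries

variable {K : Type*} [Field K] [Valued K ℤᵐ⁰] {n : ℕ} {C : Type*} [Field C]

/-- A character of `Kˣ` is unramified if it is trivial on the units of `𝒪`. -/
def IsUnramifiedChar (χ : Kˣ →* Cˣ) : Prop :=
  ∀ u : Kˣ, Valued.v (u : K) = 1 → χ u = 1

/-- The space of the principal series `I(χ)`: locally constant functions `f` on `GL_n(K)` with
`f (b g) = χ₁(b₁₁) ⋯ χₙ(bₙₙ) f g` for all upper triangular `b`. No modulus character appears: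
this is used only when the cardinality `q` of the residue field is `1` in `C`, so that
`|δ_B|^{1/2}`, formed with the square root `1` of `q = 1`, is trivial and normalized and
unnormalized induction agree. -/
def principalSeriesSpace (χ : Fin n → Kˣ →* Cˣ) : Submodule C (GL (Fin n) K → C) where
  carrier := {f | IsLocallyConstant f ∧ ∀ (b g : GL (Fin n) K) (d : Fin n → Kˣ),
    (b : Matrix (Fin n) (Fin n) K).BlockTriangular id →
    (∀ i, (b : Matrix (Fin n) (Fin n) K) i i = d i) →
    f (b * g) = (∏ i, χ i (d i) : Cˣ) * f g}
  add_mem' := by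
    rintro f f' ⟨hf, hf'⟩ ⟨h, h'⟩
    refine ⟨hf.add h, fun b g d hb hd => ?_⟩
    simp only [Pi.add_apply, hf' b g d hb hd, h' b g d hb hd, mul_add]
  zero_mem' := ⟨IsLocallyConstant.const 0, fun b g d _ _ => by simp⟩
  smul_mem' := by
    rintro c f ⟨hf, hf'⟩
    refine ⟨hf.comp (fun v => c • v), fun b g d hb hd => ?_⟩
    simp only [Pi.smul_apply, hf' b g d hb hd, smul_eq_mul]
    ring

/-- The principal series `I(χ)`, on which `GL_n(K)` acts by right translation. -/
def principalSeries (χ : Fin n → Kˣ →* Cˣ) :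
    Representation C (GL (Fin n) K) (principalSeriesSpace χ) where
  toFun g :=
    { toFun f := ⟨fun h => (f : GL (Fin n) K → C) (h * g),
        f.2.1.comp_continuous (continuous_mul_const g), fun b h d hb hd => by
          simpa only [mul_assoc] using f.2.2 b (h * g) d hb hd⟩
      map_add' _ _ := rfl
      map_smul' _ _ := rfl }
  map_one' := by
    ext f h
    simp
  map_mul' g g' := by
    ext f h
    simp [mul_assoc]

/-- `π` is a subquotient of a principal series `I(χ)` with `χ₁, …, χₙ` unramified and
`{χ₁(ϖ), …, χₙ(ϖ)} = s` as multisets. -/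
def IsAssociated {V : Type*} [AddCommGroup V] [Module C V]
    (π : Representation C (GL (Fin n) K) V) (ϖ : Kˣ) (s : Multiset C) : Prop :=
  ∃ χ : Fin n → Kˣ →* Cˣ, (∀ i, IsUnramifiedChar (χ i)) ∧
    Finset.univ.val.map (fun i => (χ i ϖ : C)) = s ∧ IsSubquotient π (principalSeries χ)

end PrincipalSeries

/-! ### Galois side -/

section Galois

variable (K : Type*) [Field K] [Valued K ℤᵐ⁰]

/-- The absolute Galois group of `K`. -/
abbrev AbsGal : Type _ := AlgebraicClosure K ≃ₐ[K] AlgebraicClosure K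

/-- The integral closure of `𝒪` in the algebraic closure of `K`. -/
abbrev algInt : Subalgebra 𝒪[K] (AlgebraicClosure K) := integralClosure 𝒪[K] (AlgebraicClosure K)

variable {K}

/-- The action of a Galois element on the algebraic integers. -/
def galInt (σ : AbsGal K) : algInt K →ₐ[𝒪[K]] algInt K :=
  ((σ : AlgebraicClosure K →ₐ[K] AlgebraicClosure K).restrictScalars 𝒪[K]).mapIntegralClosure

/-- `σ` lies in the inertia group: it acts trivially on the residue field of `K̄`. -/
def IsInertial (σ : AbsGal K) : Prop :=
  ∀ Q : Ideal (algInt K), Q.IsMaximal → ∀ b, galInt σ b - b ∈ Q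

/-- `φ` is a geometric Frobenius element: its inverse acts as the `q`-power map on the residue
field of `K̄`. -/
def IsGeometricFrobenius (φ : AbsGal K) : Prop :=
  ∀ Q : Ideal (algInt K), Q.IsMaximal → (galInt φ⁻¹).IsArithFrobAt Q

/-- The linear representation on `k^n` attached to a homomorphism to `GL_n(k)`. -/
def standardRep {Γ k : Type*} [Group Γ] [Field k] {n : ℕ} (ρ : Γ →* GL (Fin n) k) :
    Representation k Γ (Fin n → k) :=
  (Matrix.toLinAlgEquiv' : Matrix (Fin n) (Fin n) k ≃ₐ[k] _).toAlgHom.toMonoidHom.comp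
    ((Units.coeHom _).comp ρ)

/-- The eigenvalues in `C`, with multiplicity, of a matrix with entries in `k`. -/
def eigenvaluesIn {k : Type*} [Field k] (C : Type*) [Field C] [Algebra k C] {n : ℕ}
    (g : GL (Fin n) k) : Multiset C :=
  ((g : Matrix (Fin n) (Fin n) k).charpoly.map (algebraMap k C)).roots

end Galois

/-! ### The projector `e_α` -/

section Projector

variable {C : Type*} [Field C]

/-- The polynomial `P_j`, whose roots with multiplicity are the `j`-th elementary symmetric
functions of the `n₂`-element submultisets `S` of `s`. -/
def symmPoly (s : Multiset C) (n₂ j : ℕ) : C[X] :=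
  ((s.powersetCard n₂).map fun S => Polynomial.X - Polynomial.C (S.esymm j)).prod

/-- The factor `Q_j` of `P_j = Q_j R_j`, where `R_j` is the largest power of
`X - binom(n₂, j) α^j` dividing `P_j`. -/
def symmPolyCoprime (s : Multiset C) (n₂ : ℕ) (α : C) (j : ℕ) : C[X] :=
  symmPoly s n₂ j /ₘ (Polynomial.X - Polynomial.C ((n₂.choose j : C) * α ^ j)) ^
    (symmPoly s n₂ j).rootMultiplicity ((n₂.choose j : C) * α ^ j)

variable {K : Type*} [Field K] [Valued K ℤᵐ⁰] {n : ℕ}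
  {V : Type*} [AddCommGroup V] [Module C V]

/-- The diagonal matrix with entries `1` (`n₁` times), `ϖ` (`j` times), and then `1`. -/
def heckeDiag (n n₁ j : ℕ) (ϖ : Kˣ) : GL (Fin n) K :=
  Units.map (Matrix.diagonalRingHom (Fin n) K).toMonoidHom
    (MulEquiv.piUnits.symm fun i => if n₁ ≤ (i : ℕ) ∧ (i : ℕ) < n₁ + j then ϖ else 1)

/-- The Hecke operator `V^{j,2}` on `H¹(𝔭, π)`. -/
def opV (π : Representation C (GL (Fin n) K) V) (n₁ : ℕ) (ϖ : Kˣ) (j : ℕ) :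
    Module.End C (H1 (parahoricRep n₁ π)) :=
  heckeH1 π (parahoric K n n₁) (parahoric_isOpen K n n₁) (heckeDiag n n₁ j ϖ)

/-- The operator `∏_{j = 1}^{n₂} Q_j(V^{j,2})` on `H¹(𝔭, π)`. -/
def opQ (π : Representation C (GL (Fin n) K) V) (n₁ n₂ : ℕ) (ϖ : Kˣ) (s : Multiset C) (α : C) :
    Module.End C (H1 (parahoricRep n₁ π)) :=
  (List.ofFn fun j : Fin n₂ =>
    Polynomial.aeval (opV π n₁ ϖ (j + 1)) (symmPolyCoprime s n₂ α (j + 1))).prod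

/-- `e` is the operator `e_α = lim_{m → ∞} (∏_j Q_j(V^{j,2}))^{m!}` on `H¹(P(k), π^{K¹})`, where
`H¹(P(k), π^{K¹})` is identified with `H¹(𝔭, π)` by inflation. The limit is pointwise, for the
discrete topology. -/
def IsProjectorE (π : Representation C (GL (Fin n) K) V) (n₁ n₂ : ℕ) (ϖ : Kˣ) (s : Multiset C)
    (α : C) (e : Module.End C (H1 (residualParabolicRep n₁ π))) : Prop :=
  ∀ c, ∀ᶠ m : ℕ in Filter.atTop,
    (opQ π n₁ n₂ ϖ s α ^ m.factorial) (inflationH1 n₁ π c) = inflationH1 n₁ π (e c)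

end Projector

end ModPLocal

end

open ModPLocal

set_option linter.unusedSectionVars false

noncomputable section

namespace ModPLocal

/-! ### Sums over a finite set with a permutation of order dividing p -/

section FixedPoints

variable {p : ℕ} [Fact p.Prime] {C W : Type*} [Field C] [CharP C p] [AddCommGroup W] [Module C W]

/-! Let U be the group of integral matrices with upper triangular unipotent reduction and T the
group of diagonal matrices with unit entries. As q ≡ 1 mod p, the residue characteristic ℓ differs
from p and U is pro-ℓ. Averaging over U therefore gives a natural projection e from a smooth
representation onto its U-fixed vectors, and H¹ of U and of K¹ vanishes. The vanishing for K¹ makes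
inflation bijective. The limit e_α exists because H¹(P(k_x), π^{K¹}) is finite-dimensional over an
algebraic extension of a finite field, so an operator on it has only finitely many powers
(`finite_range_pow`).

The engine of the injectivity is a fixed-point principle. At each congruence level there is s in T
whose p-th power is trivial at that level and whose diagonal entries are pairwise distinct in the
residue field. Conjugation by s permutes the cosets of the level subgroup in U, has p-th power one,
and fixes only the cosets of elements of T. Hence the U-average of a function that is invariant
under this conjugation and constant on T ∩ U is its value at 1 (`IwahoriDatum.sum_eq`). It follows
that g ↦ e g is multiplicative on π^U for g normalising T (`proj_mul`), so both the diagonal torus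
and the Weyl group act there. A U-fixed function f in an unramified principal series is determined
by its values at permutation matrices w, and the torus acts on f(w) through the w-translate of χ. So
the torus weights on π^U lie in one orbit of the symmetric group (`torusAction_eq_zero`).

For y in T, the rule c ↦ Φ_y(c) = e(c(y)) maps H¹(𝔭, π) to π^U. It carries V^{j,2} to the sum of the
diagonal matrices with entries ϖ at S and 1 elsewhere, over the j-element subsets S of the last
block (`torusEval_hecke`, `doubleCosetCosets_eq`). If c comes from G(k_x), the cocycle relation also
gives Φ_y(c) = w Φ_{y'}(c) with y' = w⁻¹ y w (`exists_weylAction_eq`).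

Suppose now that e_α(res c) = 0. Some power Q of the torus element corresponding to ∏ Q_j then kills
every Φ_y(c). It is nonzero at a weight with α throughout the last block, since there each Hecke
element takes the value that was removed from the roots of P_j. Multiply Q by an element isolating
this weight and sum over all permutations. The sum acts on π^U as a scalar, nonzero because
stabiliser orders divide n! and n < p, and yet it kills Φ_y(c) by the Weyl symmetry
(`eq_zero_of_weights`). So all Φ_y(c) vanish, and c is trivial on the torus T(k_x). The index of
T(k_x) in G(k_x) is n! modulo p (`index_diagTorus_ne_zero`), hence invertible, and c = 0. -/

theorem sum_eq_zero_of_perm (hW : ∀ w : W, p • w = 0) {X : Type*} [Finite X] (σ : Equiv.Perm X) (hσ : σ ^ p = 1)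
    (f : X → W) (hf : ∀ x, f (σ x) = f x) (h0 : ∀ x, σ x = x → f x = 0) :
    ∑ᶠ x, f x = 0 := by
  classical
  have := Fintype.ofFinite X
  rw [finsum_eq_sum_of_fintype, ← Finset.sum_fiberwise_of_maps_to (t := Finset.univ.image f)
    (g := f) (fun x _ => Finset.mem_image_of_mem f (Finset.mem_univ x))]
  refine Finset.sum_eq_zero fun w _ => ?_
  rw [Finset.sum_congr rfl (g := fun _ => w) (fun x hx => (Finset.mem_filter.1 hx).2),
    Finset.sum_const]
  by_cases hw : w = 0
  · rw [hw, smul_zero]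
  -- The fibre of `f` over a nonzero `w` is stable under `σ` and contains no fixed point, so its
  -- cardinality is divisible by p.
  have hdvd : p ∣ (Finset.univ.filter fun x => f x = w).card := by
    let τ : Function.End {x // f x = w} := fun x => ⟨σ x, by rw [hf, x.2]⟩
    have hp : ∀ m : ℕ, ∀ x, ((τ ^ m) x : X) = (σ ^ m) x := by
      intro m
      induction m with
      | zero => intro x; rfl
      | succ m ih =>
        intro x
        rw [pow_succ, pow_succ]
        exact ih _
    have hτ : τ ^ p ^ 1 = 1 := by
      rw [pow_one]
      funext x
      apply Subtype.ext
      rw [hp, hσ]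
      rfl
    have hmod := Equiv.Perm.card_fixedPoints_modEq hτ
    have hemp : IsEmpty (Function.fixedPoints τ) := by
      refine ⟨fun ⟨x, hx⟩ => hw ?_⟩
      rw [← x.2]
      exact h0 x (congrArg Subtype.val hx)
    rw [Fintype.card_eq_zero (α := Function.fixedPoints τ)] at hmod
    rw [← Fintype.card_subtype]
    exact (Nat.modEq_zero_iff_dvd).1 hmod
  obtain ⟨d, hd⟩ := hdvd
  rw [hd, mul_comm, mul_smul, hW, smul_zero]

/-- The function `f - w` vanishes at the fixed points of `σ`, so its sum vanishes in characteristic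
p. -/
theorem sum_eq_card_smul_of_perm {X : Type*} [Finite X] (σ : Equiv.Perm X) (hσ : σ ^ p = 1)
    (f : X → W) (hf : ∀ x, f (σ x) = f x) (w : W) (h0 : ∀ x, σ x = x → f x = w) :
    ∑ᶠ x, f x = (Nat.card X : C) • w := by
  have := Fintype.ofFinite X
  have h := sum_eq_zero_of_perm (p := p) (fun w : W => by
    rw [← Nat.cast_smul_eq_nsmul C, CharP.cast_eq_zero, zero_smul]) σ hσ (fun x => f x - w) (fun x => by simp only [hf])
    fun x hx => by simp only [h0 x hx, sub_self]
  rw [finsum_eq_sum_of_fintype] at h ⊢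
  rw [Finset.sum_sub_distrib, sub_eq_zero] at h
  rw [h, Finset.sum_const, Finset.card_univ, Nat.card_eq_fintype_card, Nat.cast_smul_eq_nsmul]

end FixedPoints

/-! ### Sums over cosets, and cocycles trivial on a subgroup of invertible index -/

section CosetSums

variable {C V Γ : Type*} [Field C] [AddCommGroup V] [Module C V] [Group Γ]

/-- A function on a group that is right invariant under a subgroup `L` is determined by its values
on the chosen representatives of the left cosets. -/
theorem apply_out_eq {W : Type*} {L : Subgroup Γ} (Ψ : Γ → W)
    (hΨ : ∀ u, ∀ l ∈ L, Ψ (u * l) = Ψ u) (u : Γ) : Ψ (u : Γ ⧸ L).out = Ψ u := by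
  obtain ⟨l, hl⟩ := QuotientGroup.mk_out_eq_mul L u
  rw [hl, hΨ _ _ l.2]

/-- Left translation permutes the cosets, and right invariance makes the choice of representatives
immaterial. -/
theorem finsum_coset_translate {W : Type*} [AddCommMonoid W] {L : Subgroup Γ} (Ψ : Γ → W)
    (hΨ : ∀ u, ∀ l ∈ L, Ψ (u * l) = Ψ u) (g : Γ) :
    ∑ᶠ c : Γ ⧸ L, Ψ (g * c.out) = ∑ᶠ c : Γ ⧸ L, Ψ c.out := by
  rw [← finsum_comp_equiv (MulAction.toPerm g : Equiv.Perm (Γ ⧸ L)) (f := fun c => Ψ c.out)]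
  refine finsum_congr fun c => ?_
  have : g • c = ((g * c.out : Γ) : Γ ⧸ L) := by
    conv_lhs => rw [← QuotientGroup.out_eq' c]
    rfl
  rw [MulAction.toPerm_apply, this, apply_out_eq Ψ hΨ]

/-- A cocycle that vanishes on a subgroup of invertible finite index is a coboundary. -/
theorem coboundary_of_vanishing (ρ : Representation C Γ V) (f : Γ → V)
    (hf : ∀ g h, f (g * h) = f g + ρ g (f h)) (L : Subgroup Γ) (hL : ∀ l ∈ L, f l = 0)
    (hi : (L.index : C) ≠ 0) : ∃ v, ∀ g, f g = ρ g v - v := by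
  have hfin : L.FiniteIndex := ⟨fun h => hi (by rw [h, Nat.cast_zero])⟩
  have := Fintype.ofFinite (Γ ⧸ L)
  have hinv : ∀ u, ∀ l ∈ L, f (u * l) = f u := fun u l hl => by
    rw [hf, hL l hl, map_zero, add_zero]
  -- Summing f(gc) = f(g) + g f(c) over the cosets c, and reindexing the left side, expresses
  -- (index) · f(g) as a coboundary; dividing by the index gives this vector.
  refine ⟨-((L.index : C)⁻¹ • ∑ᶠ c : Γ ⧸ L, f c.out), fun g => ?_⟩
  have h1 : ∑ᶠ c : Γ ⧸ L, f c.out = (L.index : C) • f g + ρ g (∑ᶠ c : Γ ⧸ L, f c.out) := by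
    conv_lhs => rw [← finsum_coset_translate f hinv g]
    simp only [finsum_eq_sum_of_fintype, hf, Finset.sum_add_distrib, map_sum, Finset.sum_const,
      Finset.card_univ]
    rw [Subgroup.index, Nat.card_eq_fintype_card, Nat.cast_smul_eq_nsmul]
  have h2 := congrArg (fun w => (L.index : C)⁻¹ • w) h1
  simp only [smul_add, smul_smul, inv_mul_cancel₀ hi, one_smul] at h2
  rw [map_neg, map_smul, sub_neg_eq_add, eq_comm, neg_add_eq_sub, sub_eq_iff_eq_add]
  exact h2

end CosetSums

/-- The structure of a `p`-adic group needed for the `p`-modular theory of its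
representations with vectors fixed by a pro-`ℓ` Iwahori subgroup `U`: `T` is the group of integral
points of a torus, `L` is a basis of congruence subgroups and `s m` is a regular element of
`T`, of order `p` modulo `L m`. -/
structure IwahoriDatum (p : ℕ) (G : Type*) [Group G] [TopologicalSpace G] where
  /-- The pro-`ℓ` Iwahori subgroup. -/
  U : Subgroup G
  /-- The integral points of the torus. -/
  T : Subgroup G
  /-- The congruence subgroups. -/
  L : ℕ → Subgroup G
  /-- Regular elements of the torus of order `p` modulo `L m`. -/
  s : ℕ → G
  L_le : ∀ m, L m ≤ U
  L_open : ∀ m, IsOpen (L m : Set G)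
  L_basis : ∀ H : Subgroup G, IsOpen (H : Set G) → ∃ m, L m ≤ H
  L_conj : ∀ m, ∀ u ∈ U, ∀ l ∈ L m, u⁻¹ * l * u ∈ L m
  coprime : ∀ m, p.Coprime ((L m).relIndex U)
  T_conj : ∀ t ∈ T, ∀ u ∈ U, t * u * t⁻¹ ∈ U
  T_conj_L : ∀ m, ∀ t ∈ T, ∀ l ∈ L m, t * l * t⁻¹ ∈ L m
  s_mem : ∀ m, s m ∈ T
  s_pow : ∀ m, s m ^ p ∈ L m
  fixed : ∀ m, ∀ u ∈ U, u⁻¹ * s m * u * (s m)⁻¹ ∈ L m → ∃ t ∈ T, ∃ l ∈ L m, u = t * l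

/-! ### The fixed-point principle for averages over the group U -/

namespace IwahoriDatum

variable {p : ℕ} [Fact p.Prime] {G : Type*} [Group G] [TopologicalSpace G] (D : IwahoriDatum p G)
  {C V W : Type*} [Field C] [CharP C p] [AddCommGroup V] [Module C V] [AddCommGroup W] [Module C W]

/-- The normaliser of the torus. -/
abbrev N : Subgroup G := Subgroup.normalizer (D.T : Set G)

/-- The congruence subgroup `L m` as a subgroup of `U`. -/
abbrev LU (m : ℕ) : Subgroup D.U := (D.L m).subgroupOf D.U

theorem index_ne_zero (m : ℕ) : ((D.LU m).index : C) ≠ 0 := by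
  rw [Ne, CharP.cast_eq_zero_iff C p]
  exact (Nat.Prime.coprime_iff_not_dvd Fact.out).1 (D.coprime m)

instance (m : ℕ) : (D.LU m).FiniteIndex := ⟨fun h => by
  have := D.coprime m
  -- An infinite index is recorded as 0, and p is coprime to 0 only if p = 1.
  rw [Subgroup.relIndex, h, Nat.coprime_zero_right] at this
  exact (Fact.out : p.Prime).one_lt.ne' this⟩

/-- Conjugation by `s m` as a permutation of `U ⧸ L m`. -/
def conjPerm (m : ℕ) : Equiv.Perm (D.U ⧸ D.LU m) where
  toFun := Quotient.map' (fun u => ⟨D.s m * u * (D.s m)⁻¹, D.T_conj _ (D.s_mem m) _ u.2⟩) <| by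
    intro a b h
    rw [QuotientGroup.leftRel_apply, Subgroup.mem_subgroupOf] at h ⊢
    have := D.T_conj_L m _ (D.s_mem m) _ h
    convert this using 1
    simp only [Subgroup.coe_mul, Subgroup.coe_inv]
    group
  invFun := Quotient.map' (fun u => ⟨(D.s m)⁻¹ * u * (D.s m), by
      simpa using D.T_conj _ (inv_mem (D.s_mem m)) _ u.2⟩) <| by
    intro a b h
    rw [QuotientGroup.leftRel_apply, Subgroup.mem_subgroupOf] at h ⊢
    have := D.T_conj_L m _ (inv_mem (D.s_mem m)) _ h
    convert this using 1
    simp only [Subgroup.coe_mul, Subgroup.coe_inv]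
    group
  left_inv := by
    rintro ⟨u⟩
    refine congrArg (Quotient.mk'') (Subtype.ext ?_)
    simp only
    group
  right_inv := by
    rintro ⟨u⟩
    refine congrArg (Quotient.mk'') (Subtype.ext ?_)
    simp only
    group

theorem conjPerm_mk (m : ℕ) (u : D.U) : D.conjPerm m (u : D.U ⧸ D.LU m) =
    ((⟨D.s m * u * (D.s m)⁻¹, D.T_conj _ (D.s_mem m) _ u.2⟩ : D.U) : D.U ⧸ D.LU m) := rfl

theorem conjPerm_pow_mk (m k : ℕ) (u : D.U) : (D.conjPerm m ^ k) (u : D.U ⧸ D.LU m) =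
    ((⟨D.s m ^ k * u * (D.s m ^ k)⁻¹, D.T_conj _ (pow_mem (D.s_mem m) k) _ u.2⟩ : D.U) :
      D.U ⧸ D.LU m) := by
  induction k generalizing u with
  | zero => simp
  | succ k ih =>
    rw [pow_succ, Equiv.Perm.mul_apply, conjPerm_mk, ih]
    refine congrArg _ (Subtype.ext ?_)
    simp only
    group

/-- The p-th power of `s m` lies in `L m`, which is normalised by `U`, so conjugating u by it moves
u only within u `L m`. -/
theorem conjPerm_pow (m : ℕ) : D.conjPerm m ^ p = 1 := by
  ext ⟨u⟩
  change (D.conjPerm m ^ p) (u : D.U ⧸ D.LU m) = (u : D.U ⧸ D.LU m)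
  rw [conjPerm_pow_mk, eq_comm, QuotientGroup.eq, Subgroup.mem_subgroupOf]
  have h1 := D.L_conj m _ u.2 _ (D.s_pow m)
  have h2 := mul_mem h1 (inv_mem (D.s_pow m))
  simpa only [Subgroup.coe_mul, Subgroup.coe_inv, mul_assoc] using h2

/-- Averages over `U` of functions invariant under conjugation by the torus are computed at the
fixed points. -/
theorem sum_eq (m : ℕ) (Ψ : G → W) (h1 : ∀ u ∈ D.U, ∀ l ∈ D.L m, Ψ (u * l) = Ψ u)
    (h2 : ∀ u ∈ D.U, Ψ (D.s m * u * (D.s m)⁻¹) = Ψ u)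
    (h3 : ∀ t ∈ D.T, t ∈ D.U → Ψ t = Ψ 1) :
    ∑ᶠ c : D.U ⧸ D.LU m, Ψ c.out = ((D.LU m).index : C) • Ψ 1 := by
  have hΨ : ∀ u : D.U, ∀ l ∈ D.LU m, (fun u : D.U => Ψ u) (u * l) = (fun u : D.U => Ψ u) u :=
    fun u l hl => h1 u u.2 l (Subgroup.mem_subgroupOf.1 hl)
  refine sum_eq_card_smul_of_perm (p := p) (D.conjPerm m) (D.conjPerm_pow m) _ ?_ _ ?_
  · rintro ⟨u⟩
    change Ψ (D.conjPerm m (u : D.U ⧸ D.LU m)).out = Ψ (u : D.U ⧸ D.LU m).out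
    rw [conjPerm_mk]
    have e1 := apply_out_eq (fun u : D.U => Ψ u) hΨ u
    have e2 := apply_out_eq (fun u : D.U => Ψ u) hΨ ⟨D.s m * u * (D.s m)⁻¹, D.T_conj _ (D.s_mem m) _ u.2⟩
    rw [e1, e2]
    exact h2 u u.2
  · rintro ⟨u⟩ hu
    change D.conjPerm m (u : D.U ⧸ D.LU m) = (u : D.U ⧸ D.LU m) at hu
    change Ψ (u : D.U ⧸ D.LU m).out = Ψ 1
    have e1 := apply_out_eq (fun u : D.U => Ψ u) hΨ u
    rw [e1]
    rw [conjPerm_mk, eq_comm, QuotientGroup.eq, Subgroup.mem_subgroupOf] at hu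
    -- A fixed coset means that the commutator of u⁻¹ and `s m` lies in `L m`; regularity of `s m`
    -- then puts u in T · `L m`, where Ψ takes the value Ψ(1).
    obtain ⟨t, ht, l, hl, htl⟩ := D.fixed m u u.2 (by
      simpa only [Subgroup.coe_mul, Subgroup.coe_inv, mul_assoc] using hu)
    have htU : t ∈ D.U := by
      rw [← mul_inv_eq_iff_eq_mul] at htl
      rw [← htl]
      exact mul_mem u.2 (inv_mem (D.L_le m hl))
    rw [htl, h1 t htU l hl, h3 t ht htU]

/-- Right translation by `u` as a permutation of `U ⧸ L m`. -/
def rightPerm (m : ℕ) (u : D.U) : Equiv.Perm (D.U ⧸ D.LU m) where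
  toFun := Quotient.map' (· * u) <| by
    intro a b h
    rw [QuotientGroup.leftRel_apply, Subgroup.mem_subgroupOf] at h ⊢
    have := D.L_conj m _ u.2 _ h
    simpa only [Subgroup.coe_mul, Subgroup.coe_inv, _root_.mul_inv_rev, mul_assoc, inv_inv] using this
  invFun := Quotient.map' (· * u⁻¹) <| by
    intro a b h
    rw [QuotientGroup.leftRel_apply, Subgroup.mem_subgroupOf] at h ⊢
    have := D.L_conj m _ (inv_mem u.2) _ h
    simpa only [Subgroup.coe_mul, Subgroup.coe_inv, _root_.mul_inv_rev, mul_assoc, inv_inv] using this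
  left_inv := by
    rintro ⟨w⟩
    exact congrArg Quotient.mk'' (mul_inv_cancel_right w u)
  right_inv := by
    rintro ⟨w⟩
    exact congrArg Quotient.mk'' (inv_mul_cancel_right w u)

theorem rightPerm_mk (m : ℕ) (u w : D.U) :
    D.rightPerm m u (w : D.U ⧸ D.LU m) = ((w * u : D.U) : D.U ⧸ D.LU m) := rfl

/-! ### The projection onto the U-fixed vectors and the action of the normaliser of the torus -/

section Projection

variable (π : Representation C G V)

/-- The vectors fixed by `U`. -/
abbrev fixedVectors : Submodule C V := Representation.invariants (π.comp D.U.subtype)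

/-- The span of the vectors `u v - v`. -/
abbrev movedVectors : Submodule C V := Representation.Coinvariants.ker (π.comp D.U.subtype)

theorem mem_fixedVectors {v : V} : v ∈ D.fixedVectors π ↔ ∀ u ∈ D.U, π u v = v :=
  ⟨fun h u hu => h ⟨u, hu⟩, fun h u => h u u.2⟩

theorem sub_mem_movedVectors {u : G} (hu : u ∈ D.U) (v : V) : π u v - v ∈ D.movedVectors π :=
  Representation.Coinvariants.sub_mem_ker (ρ := π.comp D.U.subtype) ⟨u, hu⟩ v

/-- The average of `v` over `U`, if `v` is fixed by `L m`. -/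
def average (m : ℕ) : V →ₗ[C] V :=
  ((D.LU m).index : C)⁻¹ • ∑ᶠ c : D.U ⧸ D.LU m, π c.out

theorem average_apply (m : ℕ) (v : V) : D.average π m v =
    ((D.LU m).index : C)⁻¹ • ∑ᶠ c : D.U ⧸ D.LU m, π c.out v := by
  have := Fintype.ofFinite (D.U ⧸ D.LU m)
  simp only [average, finsum_eq_sum_of_fintype, LinearMap.smul_apply, LinearMap.sum_apply]

variable {π} in
theorem right_invariant {m : ℕ} {v : V} (hv : ∀ l ∈ D.L m, π l v = v) :
    ∀ u : D.U, ∀ l ∈ D.LU m, (fun u : D.U => π u v) (u * l) = (fun u : D.U => π u v) u := by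
  intro u l hl
  simp only [Subgroup.coe_mul, map_mul, Module.End.mul_apply, hv l (Subgroup.mem_subgroupOf.1 hl)]

variable {π} in
theorem average_mem {m : ℕ} {v : V} (hv : ∀ l ∈ D.L m, π l v = v) :
    D.average π m v ∈ D.fixedVectors π := by
  rw [mem_fixedVectors]
  intro u hu
  have := Fintype.ofFinite (D.U ⧸ D.LU m)
  rw [average_apply, map_smul]
  conv_rhs => rw [← finsum_coset_translate (fun u : D.U => π u v) (D.right_invariant hv) ⟨u, hu⟩]
  simp only [finsum_eq_sum_of_fintype, map_sum, Subgroup.coe_mul, map_mul, Module.End.mul_apply]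

theorem average_sub_mem (m : ℕ) (v : V) : v - D.average π m v ∈ D.movedVectors π := by
  have := Fintype.ofFinite (D.U ⧸ D.LU m)
  have h : v - D.average π m v =
      -(((D.LU m).index : C)⁻¹ • ∑ c : D.U ⧸ D.LU m, (π c.out v - v)) := by
    rw [average_apply, finsum_eq_sum_of_fintype, Finset.sum_sub_distrib, Finset.sum_const,
      Finset.card_univ, ← Nat.card_eq_fintype_card, smul_sub, ← Nat.cast_smul_eq_nsmul C,
      smul_smul, Subgroup.index, inv_mul_cancel₀ (D.index_ne_zero m), one_smul]
    abel
  rw [h]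
  exact neg_mem (Submodule.smul_mem _ _ (Submodule.sum_mem _ fun c _ =>
    D.sub_mem_movedVectors π c.out.2 v))

theorem average_of_fixed (m : ℕ) {v : V} (hv : v ∈ D.fixedVectors π) : D.average π m v = v := by
  have := Fintype.ofFinite (D.U ⧸ D.LU m)
  rw [mem_fixedVectors] at hv
  rw [average_apply, finsum_eq_sum_of_fintype,
    Finset.sum_congr rfl (g := fun _ => v) (fun c _ => hv _ c.out.2), Finset.sum_const,
    Finset.card_univ, ← Nat.card_eq_fintype_card, ← Nat.cast_smul_eq_nsmul C,
    smul_smul, Subgroup.index, inv_mul_cancel₀ (D.index_ne_zero m), one_smul]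

variable {π}

/-- The stabiliser of a vector. -/
def stab (π : Representation C G V) (v : V) : Subgroup G where
  carrier := {g | π g v = v}
  mul_mem' {a b} ha hb := by
    simp only [Set.mem_ofPred_eq, map_mul, Module.End.mul_apply] at ha hb ⊢
    rw [hb, ha]
  one_mem' := by simp
  inv_mem' {a} ha := by
    simp only [Set.mem_ofPred_eq] at ha ⊢
    conv_lhs => rw [← ha]
    simp

theorem exists_level (hπ : IsSmooth π) (v : V) : ∃ m, ∀ l ∈ D.L m, π l v = v :=
  D.L_basis (stab π v) (hπ v)

/-- A vector v fixed by `L m` is the sum of its average, which is U-fixed, and of a combination of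
vectors v - uv; this uses that the index of `L m` is invertible. The two spaces meet in zero because
averages kill moved vectors and preserve fixed ones. -/
theorem isCompl (hπ : IsSmooth π) : IsCompl (D.fixedVectors π) (D.movedVectors π) := by
  constructor
  · rw [Submodule.disjoint_def]
    intro v hv hv'
    -- The level at which the average vanishes depends on the vector. Quantifying over all
    -- sufficiently deep levels makes the property stable under sums.
    have h : ∃ H : Subgroup G, IsOpen (H : Set G) ∧ ∀ m, D.L m ≤ H → D.average π m v = 0 := by
      refine Submodule.span_induction (p := fun v _ => ∃ H : Subgroup G, IsOpen (H : Set G) ∧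
        ∀ m, D.L m ≤ H → D.average π m v = 0) ?_ ?_ ?_ ?_ hv'
      · rintro _ ⟨⟨u, x⟩, rfl⟩
        refine ⟨stab π x ⊓ stab π (π u x), (hπ x).inter (hπ (π u x)), fun m hm => ?_⟩
        have h1 : ∀ l ∈ D.L m, π l x = x := fun l hl => (hm hl).1
        have h2 : ∀ l ∈ D.L m, π l (π u x) = π u x := fun l hl => (hm hl).2
        have h3 : D.average π m (π u x) = D.average π m x := by
          have hinv : ∀ w : D.U, ∀ l ∈ D.LU m, (fun w : D.U => π (w * u : D.U) x) (w * l) =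
              (fun w : D.U => π (w * u : D.U) x) w := by
            intro w l hl
            simp only [Subgroup.coe_mul, map_mul, Module.End.mul_apply,
              h2 l (Subgroup.mem_subgroupOf.1 hl)]
          rw [average_apply, average_apply]
          congr 1
          -- Averages of x and of ux agree because right translation by u permutes the cosets of the
          -- normal subgroup `L m` of U.
          rw [← finsum_comp_equiv (D.rightPerm m u) (f := fun c => π c.out x)]
          refine finsum_congr fun c => ?_
          obtain ⟨w, rfl⟩ := QuotientGroup.mk_surjective c
          rw [D.rightPerm_mk]
          have e1 := apply_out_eq (fun w : D.U => π (w * u : D.U) x) hinv w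
          have e2 := apply_out_eq (fun u : D.U => π u x) (D.right_invariant h1) (w * u)
          simp only [Subgroup.coe_mul, map_mul, Module.End.mul_apply] at e1 e2 ⊢
          rw [e1, e2]
        simpa [sub_eq_zero] using h3
      · exact ⟨⊤, isOpen_univ, fun m _ => map_zero _⟩
      · rintro x y _ _ ⟨H, hH, hx⟩ ⟨H', hH', hy⟩
        exact ⟨H ⊓ H', hH.inter hH', fun m hm => by
          rw [map_add, hx m (hm.trans inf_le_left), hy m (hm.trans inf_le_right), add_zero]⟩
      · rintro c x _ ⟨H, hH, hx⟩
        exact ⟨H, hH, fun m hm => by rw [map_smul, hx m hm, smul_zero]⟩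
    obtain ⟨H, hH, h⟩ := h
    obtain ⟨m, hm⟩ := D.L_basis H hH
    rw [← D.average_of_fixed π m hv, h m hm]
  · rw [codisjoint_iff, eq_top_iff]
    intro v _
    obtain ⟨m, hm⟩ := D.exists_level hπ v
    rw [← add_sub_cancel (D.average π m v) v]
    exact Submodule.add_mem_sup (D.average_mem hm) (D.average_sub_mem π m v)

/-- The projection of a smooth representation onto the vectors fixed by `U`. -/
def proj (hπ : IsSmooth π) : V →ₗ[C] V := Submodule.projection _ _ (D.isCompl hπ)

theorem proj_mem (hπ : IsSmooth π) (v : V) : D.proj hπ v ∈ D.fixedVectors π :=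
  Submodule.projection_apply_mem _ _

theorem proj_of_mem (hπ : IsSmooth π) {v : V} (hv : v ∈ D.fixedVectors π) : D.proj hπ v = v :=
  Submodule.projection_apply_of_mem_left _ hv

theorem proj_eq (hπ : IsSmooth π) {v w : V} (hw : w ∈ D.fixedVectors π)
    (h : v - w ∈ D.movedVectors π) : D.proj hπ v = w := by
  rw [← D.proj_of_mem hπ hw, ← sub_eq_zero, ← map_sub]
  exact (Submodule.projection_apply_eq_zero_iff _).2 h

theorem sub_proj_mem (hπ : IsSmooth π) (v : V) : v - D.proj hπ v ∈ D.movedVectors π := by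
  refine (Submodule.projection_apply_eq_zero_iff (D.isCompl hπ)).1 ?_
  rw [map_sub, sub_eq_zero]
  exact (D.proj_of_mem hπ (D.proj_mem hπ v)).symm

theorem proj_eq_average (hπ : IsSmooth π) {m : ℕ} {v : V} (hv : ∀ l ∈ D.L m, π l v = v) :
    D.proj hπ v = D.average π m v :=
  D.proj_eq hπ (D.average_mem hv) (D.average_sub_mem π m v)

theorem proj_apply_U (hπ : IsSmooth π) {u : G} (hu : u ∈ D.U) (v : V) :
    D.proj hπ (π u v) = D.proj hπ v := by
  rw [← sub_eq_zero, ← map_sub]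
  exact (Submodule.projection_apply_eq_zero_iff _).2 (D.sub_mem_movedVectors π hu v)

/-- The projection is natural for maps that are equivariant up to an automorphism of `U`. -/
theorem proj_map {π' : Representation C G W} (hπ : IsSmooth π) (hπ' : IsSmooth π')
    (A : V →ₗ[C] W) (h1 : ∀ u ∈ D.U, ∃ u' ∈ D.U, ∀ v, A (π u v) = π' u' (A v))
    (h2 : ∀ u ∈ D.U, ∃ u' ∈ D.U, ∀ v, π' u (A v) = A (π u' v)) (v : V) :
    D.proj hπ' (A v) = A (D.proj hπ v) := by
  refine D.proj_eq hπ' ?_ ?_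
  · rw [mem_fixedVectors]
    intro u hu
    obtain ⟨u', hu', h⟩ := h2 u hu
    rw [h, (D.mem_fixedVectors π).1 (D.proj_mem hπ v) u' hu']
  · rw [← map_sub]
    have h : D.movedVectors π ≤ (D.movedVectors π').comap A := by
      refine Submodule.span_le.2 ?_
      rintro _ ⟨⟨u, x⟩, rfl⟩
      obtain ⟨u', hu', h⟩ := h1 u u.2
      simp only [Submodule.comap_coe, Set.mem_preimage, map_sub, SetLike.mem_coe]
      have := D.sub_mem_movedVectors π' hu' (A x)
      rw [← h] at this
      exact this
    exact h (D.sub_proj_mem hπ v)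

theorem proj_map_of_equivariant {π' : Representation C G W} (hπ : IsSmooth π) (hπ' : IsSmooth π')
    (A : V →ₗ[C] W) (h : ∀ u ∈ D.U, ∀ v, A (π u v) = π' u (A v)) (v : V) :
    D.proj hπ' (A v) = A (D.proj hπ v) :=
  D.proj_map hπ hπ' A (fun u hu => ⟨u, hu, h u hu⟩) (fun u hu => ⟨u, hu, fun v => (h u hu v).symm⟩) v

variable (π) in
/-- The integral torus acts trivially on the vectors fixed by `U`. -/
def TorusTrivial : Prop := ∀ t ∈ D.T, ∀ v ∈ D.fixedVectors π, π t v = v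

/-- Conjugation by t preserves U, so t commutes with the projection, and it is trivial on the image
by assumption. -/
theorem proj_apply_T (hπ : IsSmooth π) (hT : D.TorusTrivial π) {t : G} (ht : t ∈ D.T) (v : V) :
    D.proj hπ (π t v) = D.proj hπ v := by
  rw [D.proj_map hπ hπ (π t) _ _, hT t ht _ (D.proj_mem hπ v)]
  · intro u hu
    refine ⟨t * u * t⁻¹, D.T_conj t ht u hu, fun v => ?_⟩
    simp only [← Module.End.mul_apply, ← map_mul]
    group
  · intro u hu
    refine ⟨t⁻¹ * u * t, by simpa using D.T_conj _ (inv_mem ht) u hu, fun v => ?_⟩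
    simp only [← Module.End.mul_apply, ← map_mul]
    group

/-- As the index of `U ∩ g U g⁻¹` in `U` is `1` modulo `p`, the operators `e g` on the vectors
fixed by `U` are multiplicative for `g` in the normaliser of the torus. -/
theorem proj_mul (hπ : IsSmooth π) (hT : D.TorusTrivial π) {x y : G} (hx : x ∈ D.N)
    (hy : y ∈ D.N) {v : V} (hv : v ∈ D.fixedVectors π) :
    D.proj hπ (π x (D.proj hπ (π y v))) = D.proj hπ (π (x * y) v) := by
  obtain ⟨m, hm⟩ := D.exists_level hπ (π y v)
  have := Fintype.ofFinite (D.U ⧸ D.LU m)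
  -- The inner projection is an average over u of u y v, so the left side is the average of Ψ(u) =
  -- e(x u y v), and the fixed-point principle leaves only u = 1.
  have h := D.sum_eq (C := C) m (fun u => D.proj hπ (π (x * u * y) v)) ?_ ?_ ?_
  · rw [D.proj_eq_average hπ hm, average_apply, map_smul, map_smul]
    simp only [finsum_eq_sum_of_fintype, map_sum, map_mul, Module.End.mul_apply] at h ⊢
    rw [h, smul_smul, inv_mul_cancel₀ (D.index_ne_zero m), one_smul]
    simp
  · intro u _ l hl
    have := hm l hl
    simp only [map_mul, Module.End.mul_apply, this]
  · intro u _
    -- Since x and y normalise T, the conjugates of `s m` on the two outer sides lie in T; the left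
    -- one is absorbed by e and the right one by v.
    have h1 : x * (D.s m * u * (D.s m)⁻¹) * y =
      (x * D.s m * x⁻¹) * ((x * u * y) * (y⁻¹ * (D.s m)⁻¹ * y)) := by group
    rw [h1, map_mul, Module.End.mul_apply, D.proj_apply_T hπ hT
      ((Subgroup.mem_normalizer_iff.1 hx _).1 (D.s_mem m)), map_mul, Module.End.mul_apply,
      hT _ ((Subgroup.mem_normalizer_iff''.1 hy _).1 (inv_mem (D.s_mem m))) v hv]
  · intro t ht _
    have h1 : x * t * y = (x * t * x⁻¹) * (x * 1 * y) := by group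
    rw [h1, map_mul, Module.End.mul_apply, D.proj_apply_T hπ hT
      ((Subgroup.mem_normalizer_iff.1 hx _).1 ht)]

/-- The action of the normaliser of the torus on the vectors fixed by `U`. -/
def weylRep (hπ : IsSmooth π) (hT : D.TorusTrivial π) :
    Representation C D.N (D.fixedVectors π) where
  toFun g := (D.proj hπ ∘ₗ π g ∘ₗ (D.fixedVectors π).subtype).codRestrict _ fun _ =>
    D.proj_mem hπ _
  map_one' := by
    ext v
    simp [D.proj_of_mem hπ v.2]
  map_mul' g h := by
    ext v
    exact (D.proj_mul hπ hT g.2 h.2 v.2).symm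

theorem weylRep_apply (hπ : IsSmooth π) (hT : D.TorusTrivial π) (g : D.N)
    (v : D.fixedVectors π) : (D.weylRep hπ hT g v : V) = D.proj hπ (π g v) := rfl

end Projection
end IwahoriDatum

/-! ### Subgroups of order prime to p, and values of cocycles on the torus -/

namespace IwahoriDatum

variable {p : ℕ} [Fact p.Prime] {G : Type*} [Group G] [TopologicalSpace G] (D : IwahoriDatum p G)
  {C V W : Type*} [Field C] [CharP C p] [AddCommGroup V] [Module C V] [AddCommGroup W] [Module C W]

/-- Subgroups having arbitrarily small congruence subgroups of index prime to `p`. -/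
def IsPrimeTo (M : Subgroup G) : Prop :=
  ∀ O : Subgroup G, IsOpen (O : Set G) → ∃ m, D.L m ≤ O ∧ D.L m ≤ M ∧ p.Coprime ((D.L m).relIndex M)

theorem isPrimeTo_U : D.IsPrimeTo D.U := fun O hO => by
  obtain ⟨m, hm⟩ := D.L_basis O hO
  exact ⟨m, hm, D.L_le m, D.coprime m⟩

theorem isOpen_U [ContinuousMul G] : IsOpen (D.U : Set G) :=
  Subgroup.isOpen_mono (D.L_le 0) (D.L_open 0)

variable {D} in
-- By multiplicativity, the index of `L m` in the smaller group divides its index in the larger one.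
theorem IsPrimeTo.mono {M M' : Subgroup G} (h : D.IsPrimeTo M') (hM : IsOpen (M : Set G))
    (hle : M ≤ M') : D.IsPrimeTo M := fun O hO => by
  obtain ⟨m, hm, hm', hc⟩ := h (O ⊓ M) (hO.inter hM)
  refine ⟨m, hm.trans inf_le_left, hm.trans inf_le_right, ?_⟩
  refine Nat.Coprime.coprime_dvd_right ?_ hc
  exact ⟨_, (Subgroup.relIndex_mul_relIndex _ _ _ (hm.trans inf_le_right) hle).symm⟩

variable {D} in
-- Needed to trivialise a cocycle on the part of H conjugated into U by t. The level subgroups are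
-- not stable under conjugation by t, so a deeper `L m'` is placed inside the conjugate of `L m`;
-- the index of that conjugate in M then divides the index of `L m'`.
theorem IsPrimeTo.comap_conj [IsTopologicalGroup G] {M : Subgroup G} (h : D.IsPrimeTo M)
    (hM : IsOpen (M : Set G)) (t : G) :
    D.IsPrimeTo (M.comap (MulAut.conj t).toMonoidHom) := fun O hO => by
  have hcont : Continuous (MulAut.conj t : G → G) := by
    have : (MulAut.conj t : G → G) = fun g => t * g * t⁻¹ := by ext; simp
    rw [this]; fun_prop
  have hcont' : Continuous (MulAut.conj t⁻¹ : G → G) := by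
    have : (MulAut.conj t⁻¹ : G → G) = fun g => t⁻¹ * g * t := by ext; simp
    rw [this]; fun_prop
  obtain ⟨m, hm⟩ := D.L_basis (O ⊓ M.comap (MulAut.conj t).toMonoidHom)
    (hO.inter (hM.preimage hcont))
  obtain ⟨m', h1, h2, h3⟩ := h ((D.L m).comap (MulAut.conj t⁻¹).toMonoidHom)
    ((D.L_open m).preimage hcont')
  refine ⟨m, hm.trans inf_le_left, hm.trans inf_le_right, ?_⟩
  refine Nat.Coprime.coprime_dvd_right ?_ h3
  have h4 : (D.L m).relIndex (M.comap (MulAut.conj t).toMonoidHom) =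
      ((D.L m).comap (MulAut.conj t⁻¹).toMonoidHom).relIndex M := by
    have h5 : D.L m = ((D.L m).comap (MulAut.conj t⁻¹).toMonoidHom).comap
        (MulAut.conj t).toMonoidHom := by
      ext g
      simp [mul_assoc]
    conv_lhs => rw [h5]
    rw [Subgroup.relIndex_comap, Subgroup.map_comap_eq_self_of_surjective (MulAut.conj t).surjective]
  rw [h4]
  exact Subgroup.relIndex_dvd_of_le_left _ h1

section Cocycles

variable {π : Representation C G V} {H : Subgroup G}

/-- The subgroup on which a cocycle vanishes. -/
def cocycleKer (f : contCocycles (π.comp H.subtype)) : Subgroup H where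
  carrier := {h | (f : H → V) h = 0}
  mul_mem' {a b} ha hb := by
    simp only [Set.mem_ofPred_eq] at ha hb ⊢
    rw [f.2.2, ha, hb, map_zero, add_zero]
  one_mem' := by
    have := f.2.2 1 1
    simpa using this
  inv_mem' {a} ha := by
    simp only [Set.mem_ofPred_eq] at ha ⊢
    have h1 : (f : H → V) 1 = 0 := by simpa using f.2.2 1 1
    have := f.2.2 a⁻¹ a
    rw [inv_mul_cancel, h1, ha, map_zero, add_zero] at this
    exact this.symm

theorem cocycle_one (f : contCocycles (π.comp H.subtype)) : (f : H → V) 1 = 0 :=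
  (cocycleKer f).one_mem

theorem isOpen_cocycleKer (hH : IsOpen (H : Set G)) (f : contCocycles (π.comp H.subtype)) :
    IsOpen (((cocycleKer f).map H.subtype : Subgroup G) : Set G) :=
  hH.isOpenMap_subtype_val _ (f.2.1.isOpen_fiber 0)

variable {D} in
/-- Continuous cohomology of pro-prime-to-`p` subgroups vanishes. -/
theorem IsPrimeTo.exists_coboundary (hH : IsOpen (H : Set G)) {M : Subgroup G} (hM : D.IsPrimeTo M)
    (hMH : M ≤ H) (f : contCocycles (π.comp H.subtype)) :
    ∃ v, ∀ g (hg : g ∈ M), (f : H → V) ⟨g, hMH hg⟩ = π g v - v := by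
  obtain ⟨m, h1, h2, h3⟩ := hM _ (isOpen_cocycleKer hH f)
  have hL : ∀ l ∈ (D.L m).subgroupOf M, (f : H → V) ⟨l, hMH l.2⟩ = 0 := by
    intro l hl
    obtain ⟨k, hk, hkl⟩ := h1 (Subgroup.mem_subgroupOf.1 hl)
    have : k = ⟨l, hMH l.2⟩ := Subtype.ext hkl
    rw [← this]
    exact hk
  have hi : (((D.L m).subgroupOf M).index : C) ≠ 0 := by
    rw [Ne, CharP.cast_eq_zero_iff C p]
    exact (Nat.Prime.coprime_iff_not_dvd Fact.out).1 h3
  obtain ⟨v, hv⟩ := coboundary_of_vanishing (π.comp M.subtype)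
    (fun g => (f : H → V) ⟨g, hMH g.2⟩) (fun g h => f.2.2 ⟨g, hMH g.2⟩ ⟨h, hMH h.2⟩)
    ((D.L m).subgroupOf M) hL hi
  exact ⟨v, fun g hg => hv ⟨g, hg⟩⟩

/-- After subtraction of a coboundary the cocycle vanishes on U. Expanding both sides of uy =
y(y⁻¹uy) then shows that u fixes the corrected value at y, because y normalises U. -/
theorem cocycle_decomp (hH : IsOpen (H : Set G)) (hU : D.U ≤ H) (hT : D.T ≤ H)
    (f : contCocycles (π.comp H.subtype)) :
    ∃ v, (∀ u (hu : u ∈ D.U), (f : H → V) ⟨u, hU hu⟩ = π u v - v) ∧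
      ∀ y (hy : y ∈ D.T), (f : H → V) ⟨y, hT hy⟩ - (π y v - v) ∈ D.fixedVectors π := by
  obtain ⟨v, hv⟩ := D.isPrimeTo_U.exists_coboundary hH hU f
  refine ⟨v, hv, fun y hy => ?_⟩
  rw [mem_fixedVectors]
  intro u hu
  have hu' : y⁻¹ * u * y ∈ D.U := by simpa using D.T_conj _ (inv_mem hy) u hu
  have h1 := f.2.2 ⟨u, hU hu⟩ ⟨y, hT hy⟩
  have h2 := f.2.2 ⟨y, hT hy⟩ ⟨y⁻¹ * u * y, hU hu'⟩
  have h3 : (⟨u, hU hu⟩ : H) * ⟨y, hT hy⟩ = ⟨y, hT hy⟩ * ⟨y⁻¹ * u * y, hU hu'⟩ := by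
    apply Subtype.ext
    simp only [Subgroup.coe_mul]
    group
  have h5 : π y (π (y⁻¹ * u * y) v) = π u (π y v) := by
    simp only [← Module.End.mul_apply, ← map_mul]
    group
  rw [h3, h2, hv u hu, hv _ hu'] at h1
  simp only [MonoidHom.comp_apply, Subgroup.subtype_apply, map_sub, h5] at h1 ⊢
  rw [← sub_eq_zero] at h1 ⊢
  rw [← neg_eq_zero, ← h1]
  abel

theorem mem_N_of_commute {t : G} (ht : ∀ y ∈ D.T, t * y = y * t) : t ∈ D.N := by
  rw [N, Subgroup.mem_normalizer_iff]
  intro h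
  constructor
  · intro hh
    rwa [ht h hh, mul_inv_cancel_right]
  · intro hh
    have := ht _ hh
    have h2 : h = t * h * t⁻¹ := by
      rw [inv_mul_cancel_right] at this
      exact (mul_left_cancel this).symm
    rwa [h2]

/-- Moving y to the left past t replaces it by an element of T, which e absorbs. With t = 1 this
makes evaluation at a torus element well defined on cohomology classes. -/
theorem proj_torus_coboundary (hπ : IsSmooth π) (hTT : D.TorusTrivial π) {t : G}
    (ht : t ∈ D.N) {y : G} (hy : y ∈ D.T) (v : V) :
    D.proj hπ (π t (π y v - v)) = 0 := by
  have h : π t (π y v) = π (t * y * t⁻¹) (π t v) := by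
    simp only [← Module.End.mul_apply, ← map_mul]
    group
  rw [map_sub, map_sub, h, D.proj_apply_T hπ hTT ((Subgroup.mem_normalizer_iff.1 ht y).1 hy),
    sub_self]

/-- The value at a torus element of the restriction of a class to the torus, projected
to the `U`-fixed vectors. -/
def torusEval (hπ : IsSmooth π) (hTT : D.TorusTrivial π) (hT : D.T ≤ H) (y : D.T) :
    H1 (π.comp H.subtype) →ₗ[C] D.fixedVectors π :=
  Submodule.liftQ _
    { toFun f := ⟨D.proj hπ ((f : H → V) ⟨y, hT y.2⟩), D.proj_mem hπ _⟩
      map_add' f g := Subtype.ext (by simp)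
      map_smul' c f := Subtype.ext (by simp) } <| by
    rintro f ⟨v, hv⟩
    apply Subtype.ext
    have := D.proj_torus_coboundary hπ hTT (one_mem _) y.2 v
    simpa [hv] using this

theorem torusEval_mk (hπ : IsSmooth π) (hTT : D.TorusTrivial π) (hT : D.T ≤ H) (y : D.T)
    (f : contCocycles (π.comp H.subtype)) :
    (D.torusEval hπ hTT hT y (Submodule.Quotient.mk f) : V) =
      D.proj hπ ((f : H → V) ⟨y, hT y.2⟩) := rfl

/-- In general e t and e t e differ. A value of a cocycle on the torus, however, is a U-fixed vector
plus a coboundary term yv - v, and the latter is killed both by e and by e t. -/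
theorem proj_translate (hπ : IsSmooth π) (hTT : D.TorusTrivial π) (hH : IsOpen (H : Set G))
    (hU : D.U ≤ H) (hT : D.T ≤ H) {t : G} (ht : t ∈ D.N) (y : D.T)
    (f : contCocycles (π.comp H.subtype)) :
    D.proj hπ (π t ((f : H → V) ⟨y, hT y.2⟩)) =
      D.proj hπ (π t (D.proj hπ ((f : H → V) ⟨y, hT y.2⟩))) := by
  obtain ⟨v, -, hv⟩ := D.cocycle_decomp hH hU hT f
  have h1 := D.proj_of_mem hπ (hv y y.2)
  have h2 := D.proj_torus_coboundary hπ hTT (one_mem _) y.2 v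
  rw [map_one, Module.End.one_apply] at h2
  rw [map_sub, h2, sub_zero] at h1
  rw [h1, map_sub (π t), map_sub, D.proj_torus_coboundary hπ hTT ht y.2, sub_zero]

end Cocycles

/-! ### Double coset operators seen on the torus -/

section Orbits

variable [IsTopologicalGroup G] {π : Representation C G V} {H : Subgroup G}

/-- The left cosets of `H` in `U t H`. -/
abbrev orbitU (H : Subgroup G) (t : G) : Set (G ⧸ H) := MulAction.orbit D.U (t : G ⧸ H)

theorem mem_orbitU {t g : G} :
    (g : G ⧸ H) ∈ D.orbitU H t ↔ ∃ u ∈ D.U, ∃ h ∈ H, g = u * t * h := by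
  constructor
  · rintro ⟨u, hu⟩
    change ((u * t : G) : G ⧸ H) = g at hu
    rw [QuotientGroup.eq] at hu
    exact ⟨u, u.2, _, hu, by group⟩
  · rintro ⟨u, hu, h, hh, rfl⟩
    refine ⟨⟨u, hu⟩, ?_⟩
    change ((u * t : G) : G ⧸ H) = _
    rw [QuotientGroup.eq]
    simpa [mul_assoc] using hh

theorem smul_mem_orbitU {t : G} (hT : D.T ≤ H) (ht : ∀ y ∈ D.T, t * y = y * t) {y : G}
    (hy : y ∈ D.T) {c : G ⧸ H} (hc : c ∈ D.orbitU H t) : y • c ∈ D.orbitU H t := by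
  obtain ⟨g, rfl⟩ := QuotientGroup.mk_surjective c
  obtain ⟨u, hu, h, hh, rfl⟩ := D.mem_orbitU.1 hc
  refine D.mem_orbitU.2 ⟨y * u * y⁻¹, D.T_conj y hy u hu, y * h, mul_mem (hT hy) hh, ?_⟩
  have := ht y hy
  change y * (u * t * h) = _
  calc y * (u * t * h) = y * u * y⁻¹ * (y * t) * h := by group
    _ = _ := by rw [← this]; group

theorem exists_level_conj (hH : IsOpen (H : Set G)) (t : G) :
    ∃ m, ∀ l ∈ D.L m, t⁻¹ * l * t ∈ H := by
  have hcont' : Continuous (MulAut.conj t⁻¹ : G → G) := by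
    have : (MulAut.conj t⁻¹ : G → G) = fun g => t⁻¹ * g * t := by ext; simp
    rw [this]; fun_prop
  obtain ⟨m, hm⟩ := D.L_basis (H.comap (MulAut.conj t⁻¹).toMonoidHom) (hH.preimage hcont')
  exact ⟨m, fun l hl => by simpa using hm hl⟩

/-- For m deep enough t⁻¹ `L m` t lies in H, so the orbit is an image of the finite set U / `L m`.
-/
theorem finite_orbitU (hH : IsOpen (H : Set G)) (t : G) : (D.orbitU H t).Finite := by
  obtain ⟨m, hm⟩ := D.exists_level_conj hH t
  have := Fintype.ofFinite (D.U ⧸ D.LU m)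
  refine (Set.finite_range fun c : D.U ⧸ D.LU m => ((c.out * t : G) : G ⧸ H)).subset ?_
  rintro _ ⟨u, rfl⟩
  refine ⟨(u : D.U ⧸ D.LU m), ?_⟩
  change (((u : D.U ⧸ D.LU m).out * t : G) : G ⧸ H) = ((u * t : G) : G ⧸ H)
  obtain ⟨l, hl⟩ := QuotientGroup.mk_out_eq_mul (D.LU m) u
  rw [hl, eq_comm, QuotientGroup.eq]
  have := hm _ (Subgroup.mem_subgroupOf.1 l.2)
  convert this using 1
  simp only [Subgroup.coe_mul]
  group

/-- If `t H` is the only coset in `U t H` fixed by the regular elements of the torus, the number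
of cosets in `U t H` is `1` modulo `p`. -/
theorem card_orbitU (hH : IsOpen (H : Set G)) (hT : D.T ≤ H) {t : G}
    (ht : ∀ y ∈ D.T, t * y = y * t)
    (hfix : ∀ m, ∀ u ∈ D.U, ((D.s m * (u * t) : G) : G ⧸ H) = ((u * t : G) : G ⧸ H) →
      ((u * t : G) : G ⧸ H) = t) :
    (((D.finite_orbitU hH t).toFinset.card : ℕ) : C) = 1 := by
  classical
  obtain ⟨m, hm⟩ := D.exists_level_conj hH t
  have hfin := (D.finite_orbitU hH t).to_subtype
  have := Fintype.ofFinite (D.orbitU H t)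
  let σ : Equiv.Perm (D.orbitU H t) := (MulAction.toPerm (D.s m) : Equiv.Perm (G ⧸ H)).subtypePerm
    fun c => ⟨fun h => by
        have := D.smul_mem_orbitU hT ht (inv_mem (D.s_mem m)) h
        simpa using this,
      fun h => D.smul_mem_orbitU hT ht (D.s_mem m) h⟩
  have hσ : ∀ k : ℕ, ∀ c, ((σ ^ k) c : G ⧸ H) = (D.s m ^ k) • (c : G ⧸ H) := by
    intro k
    induction k with
    | zero => intro c; simp
    | succ k ih =>
      intro c
      rw [pow_succ, Equiv.Perm.mul_apply, ih, pow_succ, mul_smul]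
      rfl
  let x₀ : D.orbitU H t := ⟨t, MulAction.mem_orbit_self _⟩
  have hx₀ : σ x₀ = x₀ := by
    apply Subtype.ext
    change ((D.s m * t : G) : G ⧸ H) = t
    rw [← ht _ (D.s_mem m), eq_comm, QuotientGroup.eq, inv_mul_cancel_left]
    exact hT (D.s_mem m)
  -- Applied to the function that is 0 at the coset of t and 1 elsewhere: this coset is the only
  -- fixed point, so the number of the others vanishes modulo p.
  have h := sum_eq_zero_of_perm (p := p) (W := C) (fun w => by
    rw [nsmul_eq_mul, CharP.cast_eq_zero, zero_mul]) σ ?_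
    (fun x => if x = x₀ then 0 else 1) ?_ ?_
  · rw [finsum_eq_sum_of_fintype, Finset.sum_ite, Finset.sum_const_zero, zero_add,
      Finset.sum_const, nsmul_one] at h
    have h2 : (Finset.univ.filter fun x : D.orbitU H t => ¬ x = x₀) = Finset.univ.erase x₀ := by
      ext; simp
    have h3 : (D.finite_orbitU hH t).toFinset.card = (Finset.univ.erase x₀).card + 1 := by
      rw [Finset.card_erase_add_one (Finset.mem_univ _), Finset.card_univ, ← Set.toFinset_card]
      congr 1
      ext; simp
    rw [h3, Nat.cast_add, ← h2, h, zero_add, Nat.cast_one]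
  · ext c
    rw [hσ]
    obtain ⟨c, hc⟩ := c
    obtain ⟨g, rfl⟩ := QuotientGroup.mk_surjective c
    obtain ⟨u, hu, h, hh, rfl⟩ := D.mem_orbitU.1 hc
    change ((D.s m ^ p * (u * t * h) : G) : G ⧸ H) = ((u * t * h : G) : G ⧸ H)
    rw [eq_comm, QuotientGroup.eq]
    have h1 := hm _ (D.L_conj m u hu _ (D.s_pow m))
    have h2 := mul_mem (mul_mem (inv_mem hh) h1) hh
    convert h2 using 1
    group
  · intro x
    have : σ x = x₀ ↔ x = x₀ := ⟨fun h => σ.injective (h.trans hx₀.symm), fun h => by rw [h, hx₀]⟩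
    simp only [this]
  · rintro ⟨c, hc⟩ hx
    obtain ⟨g, rfl⟩ := QuotientGroup.mk_surjective c
    obtain ⟨u, hu, h, hh, rfl⟩ := D.mem_orbitU.1 hc
    have hx' : ((D.s m * (u * t * h) : G) : G ⧸ H) = ((u * t * h : G) : G ⧸ H) :=
      congrArg Subtype.val hx
    have e1 : ((u * t * h : G) : G ⧸ H) = ((u * t : G) : G ⧸ H) :=
      QuotientGroup.mk_mul_of_mem _ hh
    have e2 : ((D.s m * (u * t * h) : G) : G ⧸ H) = ((D.s m * (u * t) : G) : G ⧸ H) := by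
      rw [← mul_assoc]
      exact QuotientGroup.mk_mul_of_mem _ hh
    rw [e1, e2] at hx'
    rw [if_pos (Subtype.ext (e1.trans (hfix m u hu hx')))]

/-- Write the representative of a coset c as u t z with u in U and z in H. The term at c equals e t
f(y) + φ(c) - φ(yc), where φ(c) = e t f(z). As y permutes the orbit, the φ-terms cancel in the sum.
-/
theorem sum_orbitU (hπ : IsSmooth π) (hTT : D.TorusTrivial π) (hH : IsOpen (H : Set G))
    (hT : D.T ≤ H) {t : G} (ht : ∀ y ∈ D.T, t * y = y * t) (y : D.T)
    (f : contCocycles (π.comp H.subtype)) :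
    ∑ c ∈ (D.finite_orbitU hH t).toFinset, D.proj hπ (π ((⟨y, hT y.2⟩ : H) • c).out
        ((f : H → V) (cosetCocycle H ⟨y, hT y.2⟩ c))) =
      ((D.finite_orbitU hH t).toFinset.card : C) •
        D.proj hπ (π t ((f : H → V) ⟨y, hT y.2⟩)) := by
  set yH : H := ⟨y, hT y.2⟩ with hyH
  have hout : ∀ c : G ⧸ H, ∃ (u : G) (h : H), c ∈ D.orbitU H t → u ∈ D.U ∧ c.out = u * t * h := by
    intro c
    by_cases hc : c ∈ D.orbitU H t
    · rw [← QuotientGroup.out_eq' c] at hc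
      obtain ⟨u, hu, h, hh, e⟩ := D.mem_orbitU.1 hc
      exact ⟨u, ⟨h, hh⟩, fun _ => ⟨hu, e⟩⟩
    · exact ⟨1, 1, fun h => absurd h hc⟩
  choose u z huz using hout
  have hcont : Continuous (MulAut.conj t : G → G) := by
    have : (MulAut.conj t : G → G) = fun g => t * g * t⁻¹ := by ext; simp
    rw [this]; fun_prop
  -- On H ∩ t⁻¹Ut the cocycle is a coboundary mv - v. Such values are killed by e t, because t m t⁻¹
  -- lies in U.
  obtain ⟨v, hv⟩ := ((D.isPrimeTo_U.comap_conj D.isOpen_U t).mono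
    (M := D.U.comap (MulAut.conj t).toMonoidHom ⊓ H)
    ((D.isOpen_U.preimage hcont).inter hH) inf_le_left).exists_coboundary hH inf_le_right f
  set φ : G ⧸ H → V := fun c => D.proj hπ (π t ((f : H → V) (z c))) with hφ
  have hterm : ∀ c ∈ D.orbitU H t, D.proj hπ (π (yH • c).out ((f : H → V) (cosetCocycle H yH c))) =
      D.proj hπ (π t ((f : H → V) yH)) + φ c - φ (yH • c) := by
    intro c hc
    have hc' : yH • c ∈ D.orbitU H t := D.smul_mem_orbitU hT ht y.2 hc
    obtain ⟨hu, he⟩ := huz c hc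
    obtain ⟨hu', he'⟩ := huz _ hc'
    -- The error m measures the failure of z to be compatible with y; t m t⁻¹ is a product of
    -- elements of U because t commutes with T.
    set m : H := z (yH • c) * cosetCocycle H yH c * (z c)⁻¹ * yH⁻¹ with hm
    have hcoc : cosetCocycle H yH c = (z (yH • c))⁻¹ * (m * (yH * z c)) := by
      rw [hm]; group
    have hmt : t * (m : G) * t⁻¹ = (u (yH • c))⁻¹ * (y * u c * (y : G)⁻¹) := by
      have h1 : (cosetCocycle H yH c : G) = (yH • c).out⁻¹ * ((y : G) * c.out) := rfl
      have h2 : (m : G) = z (yH • c) * (cosetCocycle H yH c : G) * (z c : G)⁻¹ * (y : G)⁻¹ := rfl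
      rw [h2, h1, he, he']
      have h3 := ht y y.2
      have h4 : t * (y : G)⁻¹ * t⁻¹ = (y : G)⁻¹ := by
        rw [mul_inv_eq_iff_eq_mul, ← ht _ (inv_mem y.2)]
      calc _ = (u (yH • c))⁻¹ * (y * u c * (t * (y : G)⁻¹ * t⁻¹)) := by group
        _ = _ := by rw [h4]
    have hmU : t * (m : G) * t⁻¹ ∈ D.U := by
      rw [hmt]
      exact mul_mem (inv_mem hu') (D.T_conj y y.2 _ hu)
    have hmv : (f : H → V) m = π m v - v :=
      hv m ⟨by simpa using hmU, m.2⟩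
    have habs : ∀ w, D.proj hπ (π t (π m w)) = D.proj hπ (π t w) := by
      intro w
      rw [← D.proj_apply_U hπ hmU (π t w)]
      simp only [← Module.End.mul_apply, ← map_mul]
      group
    have hz : π (z (yH • c)) ((f : H → V) (z (yH • c))⁻¹) = -(f : H → V) (z (yH • c)) := by
      have := f.2.2 (z (yH • c)) (z (yH • c))⁻¹
      rw [mul_inv_cancel, cocycle_one] at this
      exact (neg_eq_of_add_eq_zero_right this.symm).symm
    have hzz : ∀ w, π (z (yH • c)) ((π.comp H.subtype) (z (yH • c))⁻¹ w) = w := by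
      intro w
      simp only [MonoidHom.comp_apply, Subgroup.subtype_apply, Subgroup.coe_inv]
      rw [← Module.End.mul_apply, ← map_mul, mul_inv_cancel, map_one, Module.End.one_apply]
    have hty : D.proj hπ (π t (π y ((f : H → V) (z c)))) = φ c := by
      rw [← Module.End.mul_apply (π t), ← map_mul, ht y y.2, map_mul, Module.End.mul_apply,
        D.proj_apply_T hπ hTT y.2]
    rw [he', map_mul, map_mul, Module.End.mul_apply, Module.End.mul_apply,
      D.proj_apply_U hπ hu', hcoc, f.2.2, map_add, hz, hzz, f.2.2, f.2.2 yH, hmv]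
    simp only [MonoidHom.comp_apply, Subgroup.subtype_apply, map_add, map_sub, map_neg, habs,
      sub_self, zero_add]
    rw [← hty]
    simp only [hφ, hyH]
    abel
  rw [Finset.sum_congr rfl fun c hc => hterm c ((Set.Finite.mem_toFinset _).1 hc),
    Finset.sum_sub_distrib, Finset.sum_add_distrib, Finset.sum_const, Nat.cast_smul_eq_nsmul,
    add_sub_assoc, add_eq_left, sub_eq_zero, eq_comm]
  refine Finset.sum_equiv (MulAction.toPerm yH) (fun c => ?_) (fun c _ => rfl)
  simp only [Set.Finite.mem_toFinset, MulAction.toPerm_apply]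
  refine ⟨D.smul_mem_orbitU hT ht y.2, fun h => ?_⟩
  have := D.smul_mem_orbitU hT ht (inv_mem y.2) h
  change (y : G)⁻¹ • ((y : G) • c) ∈ _ at this
  rwa [inv_smul_smul] at this

/-- The double coset operator, computed on the torus: if `H g H` is the disjoint union of the sets
`U tᵢ H`, it acts as the sum of the `tᵢ`. -/
theorem torusEval_hecke (hπ : IsSmooth π) (hTT : D.TorusTrivial π) (hH : IsOpen (H : Set G))
    (hU : D.U ≤ H) (hT : D.T ≤ H) (g : G) {ι : Type*} (S : Finset ι) (t : ι → G)
    (ht : ∀ i, ∀ y ∈ D.T, t i * y = y * t i)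
    (hfix : ∀ i ∈ S, ∀ m, ∀ u ∈ D.U, ((D.s m * (u * t i) : G) : G ⧸ H) = ((u * t i : G) : G ⧸ H) →
      ((u * t i : G) : G ⧸ H) = t i)
    (hinj : ∀ i ∈ S, ∀ j ∈ S, (t i : G ⧸ H) = t j → i = j)
    (hcover : doubleCosetCosets H g = ⋃ i ∈ S, D.orbitU H (t i))
    (c : H1 (π.comp H.subtype)) (y : D.T) :
    D.torusEval hπ hTT hT y (heckeH1 π H hH g c) =
      ∑ i ∈ S, D.weylRep hπ hTT ⟨t i, D.mem_N_of_commute (ht i)⟩ (D.torusEval hπ hTT hT y c) := by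
  classical
  obtain ⟨f, rfl⟩ := Submodule.Quotient.mk_surjective _ c
  have hfin : (doubleCosetCosets H g).Finite := by
    rw [hcover]
    exact S.finite_toSet.biUnion fun i _ => D.finite_orbitU hH (t i)
  have hunion : hfin.toFinset = S.biUnion fun i => (D.finite_orbitU hH (t i)).toFinset := by
    ext c
    simp [hcover]
  have hdisj : (S : Set ι).PairwiseDisjoint fun i => (D.finite_orbitU hH (t i)).toFinset := by
    intro i hi j hj hij
    rw [Function.onFun, Finset.disjoint_left]
    intro c hc hc'
    apply hij
    rw [Set.Finite.mem_toFinset] at hc hc'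
    have h1 : (t j : G ⧸ H) ∈ D.orbitU H (t i) := by
      have h2 := MulAction.orbit_eq_iff.2 hc
      rw [orbitU, ← h2, MulAction.orbit_eq_iff.2 hc']
      exact MulAction.mem_orbit_self _
    obtain ⟨u, hu, h, hh, e⟩ := D.mem_orbitU.1 h1
    have e1 : (t j : G ⧸ H) = ((u * t i : G) : G ⧸ H) := by
      rw [e]
      exact QuotientGroup.mk_mul_of_mem _ hh
    -- If two orbits meet, the coset of `t j` lies in the orbit of `t i`. It is fixed by `s 0`,
    -- since `t j` commutes with T, so it must be the coset of `t i`.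
    refine hinj i hi j hj (Eq.trans (hfix i hi 0 u hu ?_).symm e1.symm)
    rw [← e1, ← smul_eq_mul]
    have e2 : ((D.s 0 • (u * t i) : G) : G ⧸ H) = D.s 0 • ((u * t i : G) : G ⧸ H) := rfl
    rw [e2, ← e1]
    change ((D.s 0 * t j : G) : G ⧸ H) = _
    rw [← ht j _ (D.s_mem 0)]
    exact QuotientGroup.mk_mul_of_mem _ (hT (D.s_mem 0))
  apply Subtype.ext
  rw [heckeH1, dif_pos hfin, Submodule.mapQ_apply, torusEval_mk]
  change D.proj hπ (∑ c ∈ hfin.toFinset, π ((⟨y, hT y.2⟩ : H) • c).out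
    ((f : H → V) (cosetCocycle H ⟨y, hT y.2⟩ c))) = _
  rw [map_sum, hunion, Finset.sum_biUnion hdisj, AddSubmonoidClass.coe_finsetSum]
  refine Finset.sum_congr rfl fun i hi => ?_
  rw [D.sum_orbitU hπ hTT hH hT (ht i), D.card_orbitU hH hT (ht i) (hfix i hi), one_smul,
    weylRep_apply, torusEval_mk, D.proj_translate hπ hTT hH hU hT (D.mem_N_of_commute (ht i))]

end Orbits

end IwahoriDatum

/-! ### Uniformizers and powers of the maximal ideal -/

section Valuations

variable {K : Type*} [Field K] [Valued K ℤᵐ⁰]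

theorem le_exp_neg_one {a : ℤᵐ⁰} (h : a < 1) : a ≤ WithZero.exp (-1 : ℤ) := by
  by_cases ha : a = 0
  · rw [ha]; exact zero_le
  rw [← WithZero.exp_log ha] at h ⊢
  rw [← WithZero.exp_zero, WithZero.exp_lt_exp] at h
  rw [WithZero.exp_le_exp]
  omega

theorem exists_pow_lt {c γ : ℤᵐ⁰} (hc : c = WithZero.exp (-1 : ℤ)) (hγ : γ ≠ 0) :
    ∃ m : ℕ, c ^ m < γ := by
  refine ⟨(1 - WithZero.log γ).toNat, ?_⟩
  rw [hc, ← WithZero.exp_nsmul, ← WithZero.exp_log hγ, WithZero.exp_lt_exp, WithZero.log_exp]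
  simp only [smul_neg, nsmul_eq_mul, mul_one]
  omega

theorem integer_isUnit_iff {x : 𝒪[K]} : IsUnit x ↔ Valued.v (x : K) = 1 :=
  (Valuation.integer.integers (Valued.v (R := K))).isUnit_iff_valuation_eq_one

theorem residue_eq_zero_iff {x : 𝒪[K]} :
    IsLocalRing.residue 𝒪[K] x = 0 ↔ Valued.v (x : K) < 1 := by
  rw [IsLocalRing.residue_eq_zero_iff, IsLocalRing.mem_maximalIdeal, mem_nonunits_iff,
    integer_isUnit_iff]
  exact ⟨fun h => lt_of_le_of_ne x.2 h, fun h => h.ne⟩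

theorem residue_eq_residue_iff {x y : 𝒪[K]} :
    IsLocalRing.residue 𝒪[K] x = IsLocalRing.residue 𝒪[K] y ↔ Valued.v ((x : K) - y) < 1 := by
  rw [← sub_eq_zero, ← map_sub, residue_eq_zero_iff]
  rfl

variable {ϖ : Kˣ}

theorem uniformizer_lt_one (hϖ : Valued.v (ϖ : K) = WithZero.exp (-1 : ℤ))
    : Valued.v (ϖ : K) < 1 := by
  rw [hϖ, ← WithZero.exp_zero, WithZero.exp_lt_exp]
  norm_num

theorem le_uniformizer (hϖ : Valued.v (ϖ : K) = WithZero.exp (-1 : ℤ))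
    {x : K} (hx : Valued.v x < 1) : Valued.v x ≤ Valued.v (ϖ : K) := by
  rw [hϖ]
  exact le_exp_neg_one hx

theorem uniformizer_pow_dvd_iff (hϖ : Valued.v (ϖ : K) = WithZero.exp (-1 : ℤ))
    {k : ℕ} {y : 𝒪[K]} : (⟨ϖ, (uniformizer_lt_one hϖ).le⟩ : 𝒪[K]) ^ k ∣ y ↔
      Valued.v (y : K) ≤ Valued.v (ϖ : K) ^ k := by
  constructor
  · rintro ⟨z, rfl⟩
    change Valued.v ((ϖ : K) ^ k * z) ≤ _
    rw [map_mul, map_pow]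
    exact mul_le_of_le_one_right' z.2
  · intro h
    refine ⟨⟨((ϖ : K) ^ k)⁻¹ * y, ?_⟩, Subtype.ext ?_⟩
    · change Valued.v (((ϖ : K) ^ k)⁻¹ * y) ≤ 1
      rw [map_mul, map_inv₀, map_pow]
      have h0 : Valued.v (ϖ : K) ^ k ≠ 0 := pow_ne_zero _ (by simp)
      calc _ ≤ (Valued.v (ϖ : K) ^ k)⁻¹ * Valued.v (ϖ : K) ^ k := by gcongr
        _ = 1 := inv_mul_cancel₀ h0
    · change (y : K) = (ϖ : K) ^ k * (((ϖ : K) ^ k)⁻¹ * y)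
      rw [mul_inv_cancel_left₀ (pow_ne_zero _ ϖ.ne_zero)]

theorem maximalIdeal_eq_span (hϖ : Valued.v (ϖ : K) = WithZero.exp (-1 : ℤ)) :
    𝓂[K] = Ideal.span {(⟨ϖ, (uniformizer_lt_one hϖ).le⟩ : 𝒪[K])} := by
  ext y
  have := uniformizer_pow_dvd_iff hϖ (k := 1) (y := y)
  rw [pow_one, pow_one] at this
  rw [Ideal.mem_span_singleton, this, ← IsLocalRing.residue_eq_zero_iff, residue_eq_zero_iff]
  exact ⟨fun h => le_uniformizer hϖ h, fun h => lt_of_le_of_lt h (uniformizer_lt_one hϖ)⟩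

theorem mem_maximalIdeal_pow (hϖ : Valued.v (ϖ : K) = WithZero.exp (-1 : ℤ)) {m : ℕ} {x : 𝒪[K]} :
    x ∈ 𝓂[K] ^ m ↔ Valued.v (x : K) ≤ Valued.v (ϖ : K) ^ m := by
  rw [maximalIdeal_eq_span hϖ, Ideal.span_singleton_pow, Ideal.mem_span_singleton,
    uniformizer_pow_dvd_iff hϖ]

theorem finite_quotient_maximalIdeal_pow (hϖ : Valued.v (ϖ : K) = WithZero.exp (-1 : ℤ)) [Finite 𝓀[K]] (m : ℕ) :
    Finite (𝒪[K] ⧸ 𝓂[K] ^ m) := by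
  have : Finite (𝒪[K] ⧸ 𝓂[K]) := inferInstanceAs (Finite 𝓀[K])
  exact Ideal.finite_quotient_pow ⟨{_}, by rw [maximalIdeal_eq_span hϖ, Finset.coe_singleton]⟩ m

end Valuations

/-! ### Integral matrices, congruence subgroups and the pro-ℓ Iwahori subgroup -/

section IntegralMatrices

variable {K : Type*} [Field K] [Valued K ℤᵐ⁰] {n : ℕ}

theorem integralGL_apply (a : GL (Fin n) 𝒪[K]) (i j : Fin n) :
    (integralGL K n a : Matrix (Fin n) (Fin n) K) i j = ((a : Matrix _ _ 𝒪[K]) i j : K) := rfl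

theorem reductionGL_apply (a : GL (Fin n) 𝒪[K]) (i j : Fin n) :
    (reductionGL K n a : Matrix _ _ 𝓀[K]) i j =
      IsLocalRing.residue 𝒪[K] ((a : Matrix _ _ 𝒪[K]) i j) := rfl

theorem exists_integralGL_of_isUnit (g : GL (Fin n) K)
    (h : ∀ i j, Valued.v ((g : Matrix (Fin n) (Fin n) K) i j) ≤ 1)
    (hu : IsUnit (Matrix.of fun i j => (⟨_, h i j⟩ : 𝒪[K]))) : ∃ a, integralGL K n a = g :=
  ⟨hu.unit, Units.ext rfl⟩

theorem exists_integralGL_of_det (g : GL (Fin n) K)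
    (h : ∀ i j, Valued.v ((g : Matrix (Fin n) (Fin n) K) i j) ≤ 1)
    (hd : Valued.v (g : Matrix (Fin n) (Fin n) K).det = 1) : ∃ a, integralGL K n a = g := by
  refine exists_integralGL_of_isUnit g h ?_
  rw [Matrix.isUnit_iff_isUnit_det, integer_isUnit_iff]
  have : (((Matrix.of fun i j => (⟨_, h i j⟩ : 𝒪[K])).det : 𝒪[K]) : K) =
      (g : Matrix (Fin n) (Fin n) K).det := RingHom.map_det (algebraMap 𝒪[K] K) _
  rw [this, hd]

theorem exists_integralGL_of_residue (g : GL (Fin n) K)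
    (h : ∀ i j, Valued.v ((g : Matrix (Fin n) (Fin n) K) i j) ≤ 1)
    (hu : (Matrix.of fun i j => IsLocalRing.residue 𝒪[K] ⟨_, h i j⟩).det ≠ 0) :
    ∃ a, integralGL K n a = g := by
  refine exists_integralGL_of_isUnit g h ?_
  rw [Matrix.isUnit_iff_isUnit_det]
  apply (isUnit_map_iff (IsLocalRing.residue 𝒪[K]) _).1
  rw [RingHom.map_det]
  exact isUnit_iff_ne_zero.2 hu

theorem val_integralGL_le (a : GL (Fin n) 𝒪[K]) (i j : Fin n) :
    Valued.v ((integralGL K n a : Matrix (Fin n) (Fin n) K) i j) ≤ 1 :=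
  ((a : Matrix (Fin n) (Fin n) 𝒪[K]) i j).2

theorem val_det_integralGL (a : GL (Fin n) 𝒪[K]) :
    Valued.v (integralGL K n a : Matrix (Fin n) (Fin n) K).det = 1 := by
  have : (integralGL K n a : Matrix (Fin n) (Fin n) K).det = ((a : Matrix (Fin n) (Fin n) 𝒪[K]).det : K) :=
    (RingHom.map_det (algebraMap 𝒪[K] K) _).symm
  rw [this]
  exact integer_isUnit_iff.1 ((Matrix.isUnit_iff_isUnit_det _).1 a.isUnit)

variable (K n) in
/-- The full congruence subgroup of level `m`. -/
def congruenceSubgroup (m : ℕ) : Subgroup (GL (Fin n) K) :=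
  (Matrix.GeneralLinearGroup.map (n := Fin n) (Ideal.Quotient.mk (𝓂[K] ^ m))).ker.map
    (integralGL K n)

variable (K n) in
/-- The upper triangular unipotent matrices. -/
def unitriangular (k : Type*) [Field k] : Subgroup (GL (Fin n) k) where
  carrier := {g | (g : Matrix (Fin n) (Fin n) k).BlockTriangular id ∧
    ∀ i, (g : Matrix (Fin n) (Fin n) k) i i = 1}
  mul_mem' {a b} ha hb := by
    refine ⟨by simpa using ha.1.mul hb.1, fun i => ?_⟩
    rw [Units.val_mul, Matrix.mul_apply, Finset.sum_eq_single i, ha.2, hb.2, one_mul]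
    · intro j _ hj
      rcases lt_or_gt_of_ne hj with h | h
      · rw [ha.1 h, zero_mul]
      · rw [hb.1 h, mul_zero]
    · simp
  one_mem' := ⟨by simpa using Matrix.blockTriangular_one, fun i => by simp⟩
  inv_mem' {a} ha := by
    have := a.invertible
    have h : ((a⁻¹ : GL (Fin n) k) : Matrix (Fin n) (Fin n) k).BlockTriangular id := by
      simpa using Matrix.blockTriangular_inv_of_blockTriangular ha.1
    refine ⟨h, fun i => ?_⟩
    have h1 : ((a * a⁻¹ : GL (Fin n) k) : Matrix (Fin n) (Fin n) k) i i = 1 := by simp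
    rw [Units.val_mul, Matrix.mul_apply, Finset.sum_eq_single i, ha.2, one_mul] at h1
    · exact h1
    · intro j _ hj
      rcases lt_or_gt_of_ne hj with h' | h'
      · rw [ha.1 h', zero_mul]
      · rw [h h', mul_zero]
    · simp

variable (K n) in
/-- The pro-`ℓ` Iwahori subgroup: integral matrices with unipotent upper triangular reduction. -/
def proIwahori : Subgroup (GL (Fin n) K) :=
  ((unitriangular n 𝓀[K]).comap (reductionGL K n)).map (integralGL K n)

theorem mem_proIwahori {g : GL (Fin n) K} : g ∈ proIwahori K n ↔
    (∀ i j, Valued.v ((g : Matrix (Fin n) (Fin n) K) i j) ≤ 1) ∧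
    (∀ i j, j < i → Valued.v ((g : Matrix (Fin n) (Fin n) K) i j) < 1) ∧
    ∀ i, Valued.v ((g : Matrix (Fin n) (Fin n) K) i i - 1) < 1 := by
  constructor
  · rintro ⟨a, ⟨ha, ha'⟩, rfl⟩
    refine ⟨val_integralGL_le a, fun i j hij => residue_eq_zero_iff.1 (ha hij), fun i => ?_⟩
    have := ha' i
    rw [reductionGL_apply, ← map_one (IsLocalRing.residue 𝒪[K]), residue_eq_residue_iff] at this
    exact this
  · rintro ⟨h1, h2, h3⟩
    set A : Matrix (Fin n) (Fin n) 𝓀[K] :=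
      Matrix.of fun i j => IsLocalRing.residue 𝒪[K] ⟨_, h1 i j⟩ with hA
    have hA1 : A.BlockTriangular id := fun i j hij => residue_eq_zero_iff.2 (h2 i j hij)
    have hA2 : ∀ i, A i i = 1 := fun i => by
      rw [← map_one (IsLocalRing.residue 𝒪[K])]
      exact residue_eq_residue_iff.2 (h3 i)
    obtain ⟨a, rfl⟩ := exists_integralGL_of_residue g h1 (by
      rw [← hA, Matrix.det_of_isUpperTriangular hA1]
      simp [hA2])
    exact ⟨a, ⟨hA1, hA2⟩, rfl⟩

theorem congruenceSubgroup_conj {m : ℕ} {g l : GL (Fin n) K} (hg : g ∈ (integralGL K n).range)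
    (hl : l ∈ congruenceSubgroup K n m) : g * l * g⁻¹ ∈ congruenceSubgroup K n m := by
  obtain ⟨a, rfl⟩ := hg
  obtain ⟨b, hb, rfl⟩ := hl
  exact ⟨a * b * a⁻¹, (MonoidHom.normal_ker _).conj_mem b hb a, by simp⟩

variable {ϖ : Kˣ}

theorem mem_ker_map_iff (hϖ : Valued.v (ϖ : K) = WithZero.exp (-1 : ℤ))
    {m : ℕ} {a : GL (Fin n) 𝒪[K]} :
    a ∈ (Matrix.GeneralLinearGroup.map (n := Fin n) (Ideal.Quotient.mk (𝓂[K] ^ m))).ker ↔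
    ∀ i j, Valued.v ((integralGL K n a : Matrix (Fin n) (Fin n) K) i j -
      (1 : Matrix (Fin n) (Fin n) K) i j) ≤ Valued.v (ϖ : K) ^ m := by
  have key : ∀ i j, (Ideal.Quotient.mk (𝓂[K] ^ m)) ((a : Matrix _ _ 𝒪[K]) i j) =
      (1 : Matrix (Fin n) (Fin n) (𝒪[K] ⧸ 𝓂[K] ^ m)) i j ↔
      Valued.v ((integralGL K n a : Matrix (Fin n) (Fin n) K) i j -
      (1 : Matrix (Fin n) (Fin n) K) i j) ≤ Valued.v (ϖ : K) ^ m := by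
    intro i j
    have h1 : (1 : Matrix (Fin n) (Fin n) (𝒪[K] ⧸ 𝓂[K] ^ m)) i j =
        Ideal.Quotient.mk (𝓂[K] ^ m) ((1 : Matrix (Fin n) (Fin n) 𝒪[K]) i j) := by
      simp only [Matrix.one_apply]
      split_ifs <;> simp
    have h2 : (1 : Matrix (Fin n) (Fin n) K) i j =
        (((1 : Matrix (Fin n) (Fin n) 𝒪[K]) i j : 𝒪[K]) : K) := by
      simp only [Matrix.one_apply]
      split_ifs <;> simp
    rw [h1, Ideal.Quotient.eq, mem_maximalIdeal_pow hϖ, h2]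
    rfl
  rw [MonoidHom.mem_ker]
  constructor
  · intro h i j
    rw [← key, ← Units.val_one, ← h]
    rfl
  · intro h
    ext i j
    exact (key i j).2 (h i j)

/-- For m positive the inequalities force the reduction to be the identity, hence integrality of the
inverse. At level 0 they would only bound the entries, which is why that level is excluded. -/
theorem mem_congruenceSubgroup (hϖ : Valued.v (ϖ : K) = WithZero.exp (-1 : ℤ))
    {m : ℕ} (hm : m ≠ 0) {g : GL (Fin n) K} :
    g ∈ congruenceSubgroup K n m ↔ ∀ i j, Valued.v ((g : Matrix (Fin n) (Fin n) K) i j -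
      (1 : Matrix (Fin n) (Fin n) K) i j) ≤ Valued.v (ϖ : K) ^ m := by
  constructor
  · rintro ⟨a, ha, rfl⟩
    exact (mem_ker_map_iff hϖ).1 ha
  · intro h
    have hlt : ∀ i j, Valued.v ((g : Matrix (Fin n) (Fin n) K) i j -
        (1 : Matrix (Fin n) (Fin n) K) i j) < 1 := fun i j =>
      (h i j).trans_lt (pow_lt_one₀ zero_le (uniformizer_lt_one hϖ) hm)
    have hg : g ∈ proIwahori K n := by
      rw [mem_proIwahori]
      refine ⟨fun i j => ?_, fun i j hij => ?_, fun i => ?_⟩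
      · have h1 : Valued.v ((1 : Matrix (Fin n) (Fin n) K) i j) ≤ 1 := by
          rw [Matrix.one_apply]
          split_ifs <;> simp
        simpa using (Valued.v.map_add _ _).trans (max_le (hlt i j).le h1)
      · simpa [Matrix.one_apply_ne hij.ne'] using hlt i j
      · simpa using hlt i i
    obtain ⟨a, _, rfl⟩ := hg
    exact ⟨a, (mem_ker_map_iff hϖ).2 h, rfl⟩

theorem congruenceSubgroup_le_proIwahori (hϖ : Valued.v (ϖ : K) = WithZero.exp (-1 : ℤ))
    {m : ℕ} (hm : m ≠ 0) :
    congruenceSubgroup K n m ≤ proIwahori K n := by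
  rintro _ ⟨a, ha, rfl⟩
  refine ⟨a, ?_, rfl⟩
  have : reductionGL K n a = 1 := reductionGL_eq_one K n a fun i j =>
    ((mem_ker_map_iff hϖ).1 ha i j).trans_lt (pow_lt_one₀ zero_le (uniformizer_lt_one hϖ) hm)
  rw [SetLike.mem_coe, Subgroup.mem_comap, this]
  exact one_mem _

theorem isOpen_valuation_le (m : ℕ) : IsOpen {x : K | Valued.v x ≤ Valued.v (ϖ : K) ^ m} := by
  have := Valued.isOpen_closedBall K (r := Valued.v.restrict ((ϖ : K) ^ m)) (by
    rw [Ne, map_eq_zero]; simp)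
  rw [← map_pow]
  simpa only [Valuation.restrict_le_iff] using this

theorem isOpen_congruenceSubgroup (hϖ : Valued.v (ϖ : K) = WithZero.exp (-1 : ℤ))
    {m : ℕ} (hm : m ≠ 0) :
    IsOpen (congruenceSubgroup K n m : Set (GL (Fin n) K)) := by
  have : (congruenceSubgroup K n m : Set (GL (Fin n) K)) = {g : GL (Fin n) K | ∀ i j,
      Valued.v ((g : Matrix (Fin n) (Fin n) K) i j - (1 : Matrix (Fin n) (Fin n) K) i j) ≤
        Valued.v (ϖ : K) ^ m} := by
    ext g
    exact mem_congruenceSubgroup hϖ hm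
  rw [this]
  simp only [Set.ofPred_forall]
  refine isOpen_iInter_of_finite fun i => isOpen_iInter_of_finite fun j => ?_
  refine (isOpen_valuation_le m).preimage
    (f := fun g : GL (Fin n) K => (g : Matrix (Fin n) (Fin n) K) i j -
      (1 : Matrix (Fin n) (Fin n) K) i j) ?_
  exact (Units.continuous_val.matrix_elem i j).sub continuous_const

theorem congruenceSubgroup_antitone (hϖ : Valued.v (ϖ : K) = WithZero.exp (-1 : ℤ))
    {m m' : ℕ} (h : m ≤ m') :
    congruenceSubgroup K n m' ≤ congruenceSubgroup K n m := by
  rintro _ ⟨a, ha, rfl⟩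
  refine ⟨a, (mem_ker_map_iff hϖ).2 fun i j => ((mem_ker_map_iff hϖ).1 ha i j).trans ?_, rfl⟩
  exact pow_le_pow_right_of_le_one' (uniformizer_lt_one hϖ).le h

-- The topology of the unit group is induced by g ↦ (g, g⁻¹). Closeness of the entries to those of 1
-- handles the first component, and the second follows because congruence subgroups are stable under
-- inversion.
open Filter Topology in
theorem exists_congruenceSubgroup_le (hϖ : Valued.v (ϖ : K) = WithZero.exp (-1 : ℤ))
    (H : Subgroup (GL (Fin n) K))
    (hH : IsOpen (H : Set (GL (Fin n) K))) : ∃ m, congruenceSubgroup K n (m + 1) ≤ H := by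
  let F : Filter (GL (Fin n) K) := ⨅ m : ℕ, 𝓟 (congruenceSubgroup K n (m + 1) : Set (GL (Fin n) K))
  have hbasis : F.HasBasis (fun _ => True)
      fun m : ℕ => (congruenceSubgroup K n (m + 1) : Set (GL (Fin n) K)) := by
    refine hasBasis_iInf_principal ?_
    intro a b
    exact ⟨max a b, congruenceSubgroup_antitone hϖ (by simp),
      congruenceSubgroup_antitone hϖ (by simp)⟩
  have hentry : ∀ i j, Tendsto (fun g : GL (Fin n) K => (g : Matrix (Fin n) (Fin n) K) i j) F
      (𝓝 ((1 : Matrix (Fin n) (Fin n) K) i j)) := by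
    intro i j s hs
    obtain ⟨γ, hγ⟩ := Valued.mem_nhds.1 hs
    obtain ⟨m, hm⟩ := exists_pow_lt hϖ
      ((map_ne_zero (MonoidWithZeroHom.ValueGroup₀.embedding)).2 γ.ne_zero)
    refine hbasis.mem_iff.2 ⟨m, trivial, fun g hg => hγ ?_⟩
    rw [Set.mem_ofPred_eq, Valuation.restrict_lt_iff_lt_embedding]
    refine ((mem_congruenceSubgroup hϖ (Nat.succ_ne_zero m)).1 hg i j).trans_lt (lt_of_le_of_lt ?_ hm)
    exact pow_le_pow_right_of_le_one' (uniformizer_lt_one hϖ).le (Nat.le_succ m)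
  have hval : Tendsto (fun g : GL (Fin n) K => (g : Matrix (Fin n) (Fin n) K)) F (𝓝 1) :=
    tendsto_pi_nhds.2 fun i => tendsto_pi_nhds.2 fun j => hentry i j
  have hinv : Tendsto (fun g : GL (Fin n) K => g⁻¹) F F :=
    hbasis.tendsto_iff hbasis |>.2 fun m _ => ⟨m, trivial, fun g hg => inv_mem hg⟩
  have hF : Tendsto id F (𝓝 (1 : GL (Fin n) K)) := by
    rw [Units.isInducing_embedProduct.nhds_eq_comap, tendsto_comap_iff, map_one]
    rw [Prod.one_eq_mk, nhds_prod_eq]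
    exact hval.prodMk ((MulOpposite.continuous_op.tendsto _).comp (hval.comp hinv))
  obtain ⟨m, _, hm⟩ := hbasis.mem_iff.1 (hF (hH.mem_nhds H.one_mem))
  exact ⟨m, hm⟩

end IntegralMatrices

/-! ### The diagonal torus -/

section Torus

variable (K : Type*) [Field K] (n : ℕ)

/-- The diagonal torus of `GL_n`. -/
def diagTorus : (Fin n → Kˣ) →* GL (Fin n) K :=
  (Units.map (Matrix.diagonalRingHom (Fin n) K).toMonoidHom).comp
    (MulEquiv.piUnits (M := fun _ : Fin n => K)).symm.toMonoidHom

variable {K n}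

theorem coe_diagTorus (d : Fin n → Kˣ) :
    (diagTorus K n d : Matrix (Fin n) (Fin n) K) = Matrix.diagonal fun i => (d i : K) := rfl

theorem diagTorus_mul_apply (d : Fin n → Kˣ) (g : GL (Fin n) K) (i j : Fin n) :
    ((diagTorus K n d * g : GL (Fin n) K) : Matrix (Fin n) (Fin n) K) i j =
      d i * (g : Matrix (Fin n) (Fin n) K) i j := by
  rw [Units.val_mul, coe_diagTorus, Matrix.diagonal_mul]

theorem mul_diagTorus_apply (d : Fin n → Kˣ) (g : GL (Fin n) K) (i j : Fin n) :
    ((g * diagTorus K n d : GL (Fin n) K) : Matrix (Fin n) (Fin n) K) i j =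
      (g : Matrix (Fin n) (Fin n) K) i j * d j := by
  rw [Units.val_mul, coe_diagTorus, Matrix.mul_diagonal]

theorem diagTorus_conj_apply (d : Fin n → Kˣ) (g : GL (Fin n) K) (i j : Fin n) :
    ((diagTorus K n d * g * (diagTorus K n d)⁻¹ : GL (Fin n) K) : Matrix (Fin n) (Fin n) K) i j =
      d i * (g : Matrix (Fin n) (Fin n) K) i j * (d j : K)⁻¹ := by
  rw [← map_inv, mul_diagTorus_apply, diagTorus_mul_apply, Pi.inv_apply, Units.val_inv_eq_inv_val]

theorem diagTorus_comm (d d' : Fin n → Kˣ) :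
    diagTorus K n d * diagTorus K n d' = diagTorus K n d' * diagTorus K n d := by
  rw [← map_mul, ← map_mul, mul_comm]

variable [Valued K ℤᵐ⁰]

variable (K n) in
/-- The integral points of the diagonal torus. -/
def integralTorus : Subgroup (GL (Fin n) K) :=
  Subgroup.map (diagTorus K n)
    { carrier := {d | ∀ i, Valued.v (d i : K) = 1}
      mul_mem' := fun ha hb i => by
        rw [Pi.mul_apply, Units.val_mul, map_mul, ha i, hb i, one_mul]
      one_mem' := fun i => by simp
      inv_mem' := fun {a} ha i => by
        rw [Pi.inv_apply, Units.val_inv_eq_inv_val, map_inv₀, ha i, inv_one] }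

theorem integralTorus_le_range : integralTorus K n ≤ (integralGL K n).range := by
  rintro _ ⟨d, hd, rfl⟩
  refine exists_integralGL_of_det _ (fun i j => ?_) ?_
  · rw [coe_diagTorus, Matrix.diagonal_apply]
    split_ifs
    · exact (hd i).le
    · simp
  · rw [coe_diagTorus, Matrix.det_diagonal, map_prod]
    exact Finset.prod_eq_one fun i _ => hd i

theorem integralTorus_conj_proIwahori {t u : GL (Fin n) K} (ht : t ∈ integralTorus K n)
    (hu : u ∈ proIwahori K n) : t * u * t⁻¹ ∈ proIwahori K n := by
  obtain ⟨d, hd, rfl⟩ := ht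
  obtain ⟨h1, h2, h3⟩ := mem_proIwahori.1 hu
  have hv : ∀ i j, Valued.v (((diagTorus K n d * u * (diagTorus K n d)⁻¹ : GL (Fin n) K) :
      Matrix (Fin n) (Fin n) K) i j) = Valued.v ((u : Matrix (Fin n) (Fin n) K) i j) := by
    intro i j
    rw [diagTorus_conj_apply, map_mul, map_mul, map_inv₀, hd i, hd j, inv_one, one_mul, mul_one]
  rw [mem_proIwahori]
  refine ⟨fun i j => (hv i j).trans_le (h1 i j), fun i j hij => (hv i j).trans_lt (h2 i j hij),
    fun i => ?_⟩
  rw [diagTorus_conj_apply, mul_right_comm, mul_inv_cancel₀ (d i).ne_zero, one_mul]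
  exact h3 i

end Torus

/-! ### Orders in the matrix ring and regular elements of the torus -/

section Orders

variable {K : Type*} [Field K] [Valued K ℤᵐ⁰] {n : ℕ}

/-- The order of the matrix ring cut out by the inequalities `v (A i j) ≤ c i j`. -/
def entryOrder (c : Fin n → Fin n → ℤᵐ⁰) (h1 : ∀ i, 1 ≤ c i i)
    (h2 : ∀ i j k, c i j * c j k ≤ c i k) : Subalgebra 𝒪[K] (Matrix (Fin n) (Fin n) K) where
  carrier := {A | ∀ i j, Valued.v (A i j) ≤ c i j}
  mul_mem' {A B} hA hB i j := by
    rw [Matrix.mul_apply]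
    refine Valuation.map_sum_le _ fun k _ => ?_
    rw [map_mul]
    exact (mul_le_mul' (hA i k) (hB k j)).trans (h2 i k j)
  add_mem' {A B} hA hB i j := (Valued.v.map_add _ _).trans (max_le (hA i j) (hB i j))
  algebraMap_mem' r i j := by
    rw [Matrix.algebraMap_matrix_apply]
    split_ifs with h
    · subst h
      exact (r.2 : Valued.v (r : K) ≤ 1).trans (h1 i)
    · simp

theorem mem_entryOrder {c : Fin n → Fin n → ℤᵐ⁰} {h1 h2} {A : Matrix (Fin n) (Fin n) K} :
    A ∈ entryOrder c h1 h2 ↔ ∀ i j, Valued.v (A i j) ≤ c i j := Iff.rfl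

theorem aeval_diagonal (d : Fin n → K) (P : 𝒪[K][X]) :
    Polynomial.aeval (Matrix.diagonal d) P =
      Matrix.diagonal fun i => Polynomial.aeval (d i) P := by
  have h := Polynomial.aeval_algHom_apply (Matrix.diagonalAlgHom (n := Fin n) (α := K) 𝒪[K]) d P
  have h2 : Polynomial.aeval d P = fun i => Polynomial.aeval (d i) P := by
    funext i
    exact (Polynomial.aeval_algHom_apply (Pi.evalAlgHom 𝒪[K] (fun _ : Fin n => K) i) d P).symm
  rw [h2] at h
  exact h

theorem aeval_conj (x : GL (Fin n) K) (A : Matrix (Fin n) (Fin n) K) (P : 𝒪[K][X]) :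
    Polynomial.aeval ((x⁻¹ : GL (Fin n) K) * A * (x : Matrix (Fin n) (Fin n) K)) P =
      (x⁻¹ : GL (Fin n) K) * Polynomial.aeval A P * (x : Matrix (Fin n) (Fin n) K) := by
  induction P using Polynomial.induction_on with
  | C a =>
    rw [Polynomial.aeval_C, Polynomial.aeval_C, ← Algebra.commutes, mul_assoc, Units.inv_mul,
      mul_one]
  | add P Q hP hQ => rw [map_add, map_add, hP, hQ, mul_add, add_mul]
  | monomial k a h =>
    rw [pow_succ, ← mul_assoc, map_mul _ (Polynomial.C a * Polynomial.X ^ k),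
      map_mul _ (Polynomial.C a * Polynomial.X ^ k), Polynomial.aeval_X, Polynomial.aeval_X, h]
    simp only [mul_assoc, Units.mul_inv_cancel_left]

/-- If conjugation by a regular element of the torus moves `x` by an element of an order, then `x`
lies in the order. -/
theorem mem_entryOrder_of_conj {c : Fin n → Fin n → ℤᵐ⁰} (h1 : ∀ i, 1 ≤ c i i)
    (h2 : ∀ i j k, c i j * c j k ≤ c i k) {d : Fin n → Kˣ} (hd : ∀ i, Valued.v (d i : K) = 1)
    (hdist : ∀ i j, i ≠ j → Valued.v ((d i : K) - d j) = 1) {x : GL (Fin n) K}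
    (hx : ∀ i, Valued.v (((x⁻¹ : GL (Fin n) K) : Matrix (Fin n) (Fin n) K) i i) = 1)
    (hc : ∀ i j, Valued.v (((x⁻¹ * diagTorus K n d * x * (diagTorus K n d)⁻¹ : GL (Fin n) K) :
      Matrix (Fin n) (Fin n) K) i j) ≤ c i j) (i j : Fin n) :
    Valued.v ((x : Matrix (Fin n) (Fin n) K) i j) ≤ c i j := by
  have hs : (diagTorus K n d : Matrix (Fin n) (Fin n) K) ∈ entryOrder c h1 h2 := by
    intro i j
    rw [coe_diagTorus, Matrix.diagonal_apply]
    split_ifs with h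
    · subst h
      exact (hd i).trans_le (h1 i)
    · simp
  have hY : ((x⁻¹ : GL (Fin n) K) : Matrix (Fin n) (Fin n) K) *
      (diagTorus K n d : Matrix (Fin n) (Fin n) K) * (x : Matrix (Fin n) (Fin n) K) ∈
      entryOrder c h1 h2 := by
    have h := (entryOrder c h1 h2).mul_mem (mem_entryOrder.2 hc) hs
    rw [← Units.val_mul, inv_mul_cancel_right, Units.val_mul, Units.val_mul] at h
    exact h
  -- P vanishes at every diagonal entry of s other than the i-th, where it is a unit. So P(s) is a
  -- unit multiple of the i-th diagonal idempotent, and the (i, j) entry of x⁻¹ P(s) x = P(x⁻¹ s x),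
  -- which lies in the order, is a unit times the (i, j) entry of x.
  let P : 𝒪[K][X] := ∏ b ∈ Finset.univ.erase i, (Polynomial.X - Polynomial.C ⟨d b, (hd b).le⟩)
  have hP : ∀ k, Polynomial.aeval (d k : K) P = ∏ b ∈ Finset.univ.erase i, ((d k : K) - d b) := by
    intro k
    simp only [P, map_prod, map_sub, Polynomial.aeval_X, Polynomial.aeval_C]
    rfl
  have hP0 : ∀ k, k ≠ i → Polynomial.aeval (d k : K) P = 0 := by
    intro k hk
    rw [hP]
    exact Finset.prod_eq_zero (Finset.mem_erase.2 ⟨hk, Finset.mem_univ k⟩) (sub_self _)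
  have hP1 : Valued.v (Polynomial.aeval (d i : K) P) = 1 := by
    rw [hP, map_prod]
    exact Finset.prod_eq_one fun b hb => hdist i b (Finset.ne_of_mem_erase hb).symm
  have hmem : Polynomial.aeval (((x⁻¹ : GL (Fin n) K) : Matrix (Fin n) (Fin n) K) *
      (diagTorus K n d : Matrix (Fin n) (Fin n) K) * (x : Matrix (Fin n) (Fin n) K)) P ∈
      entryOrder c h1 h2 :=
    (Algebra.adjoin_singleton_le hY) (Polynomial.aeval_mem_adjoin_singleton _ _)
  have hval := hmem i j
  rw [aeval_conj, coe_diagTorus, aeval_diagonal, Matrix.mul_apply, Finset.sum_eq_single i,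
    Matrix.mul_diagonal, map_mul, map_mul, hx i, hP1, one_mul, one_mul] at hval
  · exact hval
  · intro k _ hk
    rw [Matrix.mul_diagonal, hP0 k hk, mul_zero, zero_mul]
  · simp

end Orders

/-! ### The pro-ℓ Iwahori subgroup of the general linear group satisfies the axioms -/

section PrimeTo

variable {K : Type*} [Field K] [Valued K ℤᵐ⁰] {n : ℕ} {p : ℕ} [Fact p.Prime]

/-- The order q is zero in the residue field, whereas q = pk + 1 would be 1 there if p were zero. -/
theorem natCast_residue_ne_zero [Finite 𝓀[K]] (hq : Nat.card 𝓀[K] ≡ 1 [MOD p]) :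
    (p : 𝓀[K]) ≠ 0 := by
  intro h
  have := Fintype.ofFinite 𝓀[K]
  have h1 : ((Nat.card 𝓀[K] : ℕ) : 𝓀[K]) = 0 := by
    rw [Nat.card_eq_fintype_card]
    exact Nat.cast_card_eq_zero _
  have h2 : p ∣ Nat.card 𝓀[K] - 1 := hq.symm.dvd'
  obtain ⟨k, hk⟩ := h2
  have h3 : Nat.card 𝓀[K] = p * k + 1 := by
    have := Nat.card_pos (α := 𝓀[K])
    omega
  rw [h3, Nat.cast_add, Nat.cast_mul, h, zero_mul, zero_add, Nat.cast_one] at h1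
  exact one_ne_zero h1

/-- Factor a^p - 1 = (1 + a + ⋯ + a^{p-1})(a - 1). The reduction of the first factor is upper
triangular with p on the diagonal, hence invertible, so it can be cancelled modulo any power of the
maximal ideal. -/
theorem mem_ker_of_pow_mem_ker (hp : (p : 𝓀[K]) ≠ 0) {m : ℕ} {a : GL (Fin n) 𝒪[K]}
    (ha : reductionGL K n a ∈ unitriangular n 𝓀[K])
    (h : a ^ p ∈ (Matrix.GeneralLinearGroup.map (n := Fin n) (Ideal.Quotient.mk (𝓂[K] ^ m))).ker) :
    a ∈ (Matrix.GeneralLinearGroup.map (n := Fin n) (Ideal.Quotient.mk (𝓂[K] ^ m))).ker := by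
  set A : Matrix (Fin n) (Fin n) 𝒪[K] := (a : Matrix (Fin n) (Fin n) 𝒪[K]) with hA
  have hS : IsUnit (∑ i ∈ Finset.range p, A ^ i) := by
    rw [Matrix.isUnit_iff_isUnit_det]
    apply (isUnit_map_iff (IsLocalRing.residue 𝒪[K]) _).1
    rw [RingHom.map_det, map_sum]
    have hpow : ∀ i : ℕ, (IsLocalRing.residue 𝒪[K]).mapMatrix (A ^ i) =
        ((reductionGL K n a ^ i : GL (Fin n) 𝓀[K]) : Matrix (Fin n) (Fin n) 𝓀[K]) := by
      intro i
      rw [map_pow, Units.val_pow_eq_pow_val]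
      rfl
    have hmem : ∀ i : ℕ, reductionGL K n a ^ i ∈ unitriangular n 𝓀[K] := fun i => pow_mem ha i
    have htri : (∑ i ∈ Finset.range p, (IsLocalRing.residue 𝒪[K]).mapMatrix (A ^ i)).BlockTriangular
        id := by
      intro i j hij
      rw [Matrix.sum_apply]
      exact Finset.sum_eq_zero fun k _ => by rw [hpow]; exact (hmem k).1 hij
    rw [Matrix.det_of_isUpperTriangular htri, isUnit_iff_ne_zero, Finset.prod_ne_zero_iff]
    intro i _
    rw [Matrix.sum_apply, Finset.sum_congr rfl (g := fun _ => 1) fun k _ => by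
      rw [hpow]; exact (hmem k).2 i]
    simpa using hp
  have hprod : (∑ i ∈ Finset.range p, A ^ i) * (A - 1) = A ^ p - 1 := geom_sum_mul A p
  have h1 : (Ideal.Quotient.mk (𝓂[K] ^ m)).mapMatrix (A ^ p - 1) = 0 := by
    have h2 := congrArg Units.val (MonoidHom.mem_ker.1 h)
    have h3 : (Ideal.Quotient.mk (𝓂[K] ^ m)).mapMatrix ((a ^ p : GL (Fin n) 𝒪[K]) :
        Matrix (Fin n) (Fin n) 𝒪[K]) = 1 := h2
    rw [map_sub, hA, ← Units.val_pow_eq_pow_val, h3, map_one, sub_self]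
  rw [← hprod, map_mul, (hS.map _).mul_right_eq_zero, map_sub, map_one, sub_eq_zero] at h1
  exact MonoidHom.mem_ker.2 (Units.ext h1)

/-- By Cauchy's theorem p dividing the index would give an element of order p in the finite
quotient, which the previous factorisation excludes. -/
theorem coprime_relIndex {ϖ : Kˣ} (hϖ : Valued.v (ϖ : K) = WithZero.exp (-1 : ℤ)) [Finite 𝓀[K]]
    (hp : (p : 𝓀[K]) ≠ 0) (m : ℕ) :
    p.Coprime ((congruenceSubgroup K n m).relIndex (proIwahori K n)) := by
  rw [congruenceSubgroup, proIwahori,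
    Subgroup.relIndex_map_map_of_injective _ _ (integralGL_injective K n)]
  set N := (Matrix.GeneralLinearGroup.map (n := Fin n) (Ideal.Quotient.mk (𝓂[K] ^ m))).ker
  set Γ := (unitriangular n 𝓀[K]).comap (reductionGL K n)
  have := finite_quotient_maximalIdeal_pow hϖ m
  have : Finite (GL (Fin n) (𝒪[K] ⧸ 𝓂[K] ^ m)) := inferInstance
  have hfin : N.FiniteIndex := inferInstance
  rw [Subgroup.relIndex, Subgroup.index, Nat.Prime.coprime_iff_not_dvd Fact.out]
  have := Fintype.ofFinite (Γ ⧸ N.subgroupOf Γ)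
  rw [Nat.card_eq_fintype_card]
  intro hdvd
  obtain ⟨x, hx⟩ := exists_prime_orderOf_dvd_card p hdvd
  obtain ⟨a, rfl⟩ := QuotientGroup.mk_surjective x
  have h1 := pow_orderOf_eq_one (a : Γ ⧸ N.subgroupOf Γ)
  rw [hx, ← QuotientGroup.mk_pow, QuotientGroup.eq_one_iff, Subgroup.mem_subgroupOf] at h1
  have h2 : (a : GL (Fin n) 𝒪[K]) ∈ N := mem_ker_of_pow_mem_ker hp a.2 h1
  have h3 : (a : Γ ⧸ N.subgroupOf Γ) = 1 := by
    rw [QuotientGroup.eq_one_iff, Subgroup.mem_subgroupOf]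
    exact h2
  rw [h3, orderOf_one] at hx
  exact (Fact.out : p.Prime).one_lt.ne hx

/-- As p divides q - 1, the residue field contains an element of order p. An arbitrary lift raised
to the power q^m approximates its Teichmüller lift to the required precision, so no completeness is
needed. -/
theorem exists_almost_root_of_unity {ϖ : Kˣ} (hϖ : Valued.v (ϖ : K) = WithZero.exp (-1 : ℤ))
    [Finite 𝓀[K]] (hq : Nat.card 𝓀[K] ≡ 1 [MOD p]) (m : ℕ) :
    ∃ u : Kˣ, Valued.v (u : K) = 1 ∧ Valued.v ((u : K) ^ p - 1) ≤ Valued.v (ϖ : K) ^ (m + 1) ∧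
      ∀ i j, i < p → j < p → i ≠ j → Valued.v ((u : K) ^ i - (u : K) ^ j) = 1 := by
  have := Fintype.ofFinite 𝓀[K]
  classical
  set q := Nat.card 𝓀[K] with hqdef
  have hqc : q = Fintype.card 𝓀[K] := Nat.card_eq_fintype_card
  have hdvd : p ∣ Fintype.card (𝓀[K])ˣ := by
    rw [Fintype.card_units, ← hqc]
    exact hq.symm.dvd'
  obtain ⟨w, hw⟩ := exists_prime_orderOf_dvd_card p hdvd
  obtain ⟨u₀, hu₀⟩ := IsLocalRing.residue_surjective (R := 𝒪[K]) (w : 𝓀[K])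
  have hres : IsLocalRing.residue 𝒪[K] (u₀ ^ q ^ m) = w := by
    rw [map_pow, hu₀, hqc, FiniteField.pow_card_pow]
  have hunit : IsUnit (u₀ ^ q ^ m) := by
    apply (isUnit_map_iff (IsLocalRing.residue 𝒪[K]) _).1
    rw [hres]
    exact w.isUnit
  have hval := integer_isUnit_iff.1 hunit
  set u := u₀ ^ q ^ m with hu
  refine ⟨Units.mk0 (u : K) (fun h => by rw [h, map_zero] at hval; exact zero_ne_one hval), hval,
    ?_, ?_⟩
  -- Each q-th power gains one power of the maximal ideal: for z ≡ 1 the factor 1 + z + ⋯ + z^{q-1}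
  -- of z^q - 1 reduces to q = 0.
  · have key : ∀ k : ℕ, (u₀ ^ p) ^ q ^ k - 1 ∈ 𝓂[K] ^ (k + 1) := by
      intro k
      induction k with
      | zero =>
        rw [zero_add, pow_zero, pow_one, pow_one, ← IsLocalRing.residue_eq_zero_iff, map_sub,
          map_pow, hu₀, map_one, ← Units.val_pow_eq_pow_val, ← hw, pow_orderOf_eq_one,
          Units.val_one, sub_self]
      | succ k ih =>
        rw [pow_succ q, pow_mul, ← geom_sum_mul, pow_succ' _ (k + 1)]
        refine Ideal.mul_mem_mul ?_ ih
        have h1 : IsLocalRing.residue 𝒪[K] ((u₀ ^ p) ^ q ^ k) = 1 := by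
          rw [← map_one (IsLocalRing.residue 𝒪[K]), ← sub_eq_zero, ← map_sub,
            IsLocalRing.residue_eq_zero_iff]
          exact Ideal.pow_le_self (Nat.succ_ne_zero k) ih
        rw [← IsLocalRing.residue_eq_zero_iff, map_sum]
        simp only [map_pow] at h1 ⊢
        simp only [h1, one_pow, Finset.sum_const, Finset.card_range, nsmul_one]
        rw [hqc]
        exact Nat.cast_card_eq_zero _
    have h2 := (mem_maximalIdeal_pow hϖ).1 (key m)
    rw [← pow_mul, mul_comm, pow_mul] at h2
    exact h2
  · intro i j hi hj hij
    have h1 : IsUnit (u ^ i - u ^ j) := by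
      apply (isUnit_map_iff (IsLocalRing.residue 𝒪[K]) _).1
      rw [isUnit_iff_ne_zero, map_sub, map_pow _ u i, map_pow _ u j, hres, sub_ne_zero,
        ← Units.val_pow_eq_pow_val, ← Units.val_pow_eq_pow_val]
      intro h
      refine hij (pow_injOn_Iio_orderOf ?_ ?_ (Units.ext h))
      · rw [hw]; exact hi
      · rw [hw]; exact hj
    exact integer_isUnit_iff.1 h1

theorem val_diag_proIwahori {u : GL (Fin n) K} (hu : u ∈ proIwahori K n) (i : Fin n) :
    Valued.v ((u : Matrix (Fin n) (Fin n) K) i i) = 1 := by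
  have := (mem_proIwahori.1 hu).2.2 i
  have h := Valued.v.map_one_add_of_lt this
  simpa using h

/-- The data attached to the pro-`ℓ` Iwahori subgroup of `GL_n(K)`. -/
def iwahoriDatum (n : ℕ) {ϖ : Kˣ} (hϖ : Valued.v (ϖ : K) = WithZero.exp (-1 : ℤ)) [Finite 𝓀[K]]
    (hq : Nat.card 𝓀[K] ≡ 1 [MOD p]) (hn : n ≤ p) : IwahoriDatum p (GL (Fin n) K) where
  U := proIwahori K n
  T := integralTorus K n
  L m := congruenceSubgroup K n (m + 1)
  -- The exponents satisfy i < n ≤ p, so the powers remain distinct in the residue field and the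
  -- element is regular.
  s m := diagTorus K n fun i => (exists_almost_root_of_unity hϖ hq m).choose ^ (i : ℕ)
  L_le m := congruenceSubgroup_le_proIwahori hϖ (Nat.succ_ne_zero m)
  L_open m := isOpen_congruenceSubgroup hϖ (Nat.succ_ne_zero m)
  L_basis H hH := exists_congruenceSubgroup_le hϖ H hH
  L_conj m u hu l hl := by
    have hu' : u⁻¹ ∈ (integralGL K n).range := by
      obtain ⟨a, _, rfl⟩ := hu
      exact inv_mem ⟨a, rfl⟩
    simpa using congruenceSubgroup_conj hu' hl
  coprime m := coprime_relIndex hϖ (natCast_residue_ne_zero hq) (m + 1)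
  T_conj t ht u hu := integralTorus_conj_proIwahori ht hu
  T_conj_L m t ht l hl := congruenceSubgroup_conj (integralTorus_le_range ht) hl
  s_mem m := by
    refine ⟨_, fun i => ?_, rfl⟩
    rw [Units.val_pow_eq_pow_val, map_pow, (exists_almost_root_of_unity hϖ hq m).choose_spec.1,
      one_pow]
  s_pow m := by
    obtain ⟨h1, h2, -⟩ := (exists_almost_root_of_unity hϖ hq m).choose_spec
    set u := (exists_almost_root_of_unity hϖ hq m).choose
    rw [← map_pow, mem_congruenceSubgroup hϖ (Nat.succ_ne_zero m)]
    intro i j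
    rw [coe_diagTorus, ← Matrix.diagonal_one, Matrix.diagonal_apply, Matrix.diagonal_apply]
    split_ifs
    · rw [Pi.pow_apply, ← pow_mul, mul_comm, pow_mul, Units.val_pow_eq_pow_val,
        Units.val_pow_eq_pow_val, ← geom_sum_mul, map_mul]
      refine mul_le_of_le_one_of_le ?_ h2
      refine Valuation.map_sum_le _ fun k _ => ?_
      simp [h1]
    · simp
  fixed m x hx h := by
    obtain ⟨h1, h2, h3⟩ := (exists_almost_root_of_unity hϖ hq m).choose_spec
    set u := (exists_almost_root_of_unity hϖ hq m).choose
    have hm := Nat.succ_ne_zero m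
    have hle : Valued.v (ϖ : K) ^ (m + 1) ≤ 1 := pow_le_one₀ zero_le (uniformizer_lt_one hϖ).le
    -- The order used has off-diagonal entries bounded by ϖ^{m+1}. The off-diagonal part of x is
    -- then that small, and removing the diagonal of x leaves an element of the level subgroup.
    have hxe := mem_entryOrder_of_conj
      (c := fun i j => if i = j then 1 else Valued.v (ϖ : K) ^ (m + 1)) (fun i => by simp)
      (fun i j k => by
        by_cases hij : i = j
        · subst hij; simp
        by_cases hjk : j = k
        · subst hjk; simp
        simp only [if_neg hij, if_neg hjk]
        split_ifs
        · exact mul_le_one' hle hle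
        · exact mul_le_of_le_one_left' hle)
      (d := fun i => u ^ (i : ℕ)) (fun i => by simp [h1])
      (fun i j hij => by
        simpa using h3 i j (i.2.trans_le hn) (j.2.trans_le hn) (Fin.val_ne_of_ne hij))
      (fun i => val_diag_proIwahori (inv_mem hx) i)
      (fun i j => by
        have h4 := (mem_congruenceSubgroup hϖ hm).1 h i j
        split_ifs with hij
        · subst hij
          exact (mem_proIwahori.1 (congruenceSubgroup_le_proIwahori hϖ hm h)).1 i i
        · rwa [Matrix.one_apply_ne hij, sub_zero] at h4)
    have hd := val_diag_proIwahori hx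
    let d : Fin n → Kˣ := fun i => Units.mk0 ((x : Matrix (Fin n) (Fin n) K) i i) fun h => by
      have := hd i
      rw [h, map_zero] at this
      exact zero_ne_one this
    refine ⟨diagTorus K n d, ⟨d, hd, rfl⟩, (diagTorus K n d)⁻¹ * x, ?_, by group⟩
    rw [mem_congruenceSubgroup hϖ hm]
    intro i j
    rw [← map_inv, diagTorus_mul_apply, Pi.inv_apply, Units.val_inv_eq_inv_val]
    by_cases hij : i = j
    · subst hij
      simp only [d, Units.val_mk0, Matrix.one_apply_eq]
      have h0 : (x : Matrix (Fin n) (Fin n) K) i i ≠ 0 := (d i).ne_zero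
      rw [inv_mul_cancel₀ h0, sub_self, map_zero]
      exact zero_le
    · have := hxe i j
      rw [if_neg hij] at this
      rw [Matrix.one_apply_ne hij, sub_zero, map_mul, map_inv₀]
      change (Valued.v ((x : Matrix (Fin n) (Fin n) K) i i))⁻¹ * _ ≤ _
      rwa [hd i, inv_one, one_mul]

end PrimeTo

/-! ### Gaussian elimination with constrained row and column operations -/

section Elimination

variable {K : Type*} [Field K] {n : ℕ}

/-- The unipotent matrix with entries `x` below and above the diagonal in column `r`. -/
def columnUnipotent (r : Fin n) (x : Fin n → K) (hx : x r = 0) : GL (Fin n) K where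
  val := 1 + Matrix.vecMulVec x (Pi.single r 1)
  inv := 1 - Matrix.vecMulVec x (Pi.single r 1)
  val_inv := by
    have : Matrix.vecMulVec x (Pi.single r 1) * Matrix.vecMulVec x (Pi.single r 1) = 0 := by
      rw [Matrix.vecMulVec_mul_vecMulVec]
      simp [hx]
    rw [add_mul, mul_sub, mul_sub, this]
    simp
  inv_val := by
    have : Matrix.vecMulVec x (Pi.single r 1) * Matrix.vecMulVec x (Pi.single r 1) = 0 := by
      rw [Matrix.vecMulVec_mul_vecMulVec]
      simp [hx]
    rw [sub_mul, mul_add, mul_add, this]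
    simp

/-- The unipotent matrix with entries `y` to the left and right of the diagonal in row `c`. -/
def rowUnipotent (c : Fin n) (y : Fin n → K) (hy : y c = 0) : GL (Fin n) K where
  val := 1 + Matrix.vecMulVec (Pi.single c 1) y
  inv := 1 - Matrix.vecMulVec (Pi.single c 1) y
  val_inv := by
    have : Matrix.vecMulVec (Pi.single c 1) y * Matrix.vecMulVec (Pi.single c 1) y = 0 := by
      rw [Matrix.vecMulVec_mul_vecMulVec]
      simp [hy]
    rw [add_mul, mul_sub, mul_sub, this]
    simp
  inv_val := by
    have : Matrix.vecMulVec (Pi.single c 1) y * Matrix.vecMulVec (Pi.single c 1) y = 0 := by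
      rw [Matrix.vecMulVec_mul_vecMulVec]
      simp [hy]
    rw [sub_mul, mul_add, mul_add, this]
    simp

theorem columnUnipotent_apply (r : Fin n) (x : Fin n → K) (hx : x r = 0) (i j : Fin n) :
    (columnUnipotent r x hx : Matrix (Fin n) (Fin n) K) i j =
      (1 : Matrix (Fin n) (Fin n) K) i j + if j = r then x i else 0 := by
  simp [columnUnipotent, Matrix.vecMulVec_apply, Pi.single_apply]

theorem rowUnipotent_apply (c : Fin n) (y : Fin n → K) (hy : y c = 0) (i j : Fin n) :
    (rowUnipotent c y hy : Matrix (Fin n) (Fin n) K) i j =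
      (1 : Matrix (Fin n) (Fin n) K) i j + if i = c then y j else 0 := by
  simp [rowUnipotent, Matrix.vecMulVec_apply, Pi.single_apply]

theorem columnUnipotent_mul_apply (r : Fin n) (x : Fin n → K) (hx : x r = 0) (h : GL (Fin n) K)
    (i j : Fin n) : ((columnUnipotent r x hx * h : GL (Fin n) K) : Matrix (Fin n) (Fin n) K) i j =
      (h : Matrix (Fin n) (Fin n) K) i j + x i * (h : Matrix (Fin n) (Fin n) K) r j := by
  rw [Units.val_mul, Matrix.mul_apply]
  simp only [columnUnipotent_apply, add_mul, Finset.sum_add_distrib, ite_mul, zero_mul,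
    Finset.sum_ite_eq', Finset.mem_univ, if_true]
  rw [← Matrix.mul_apply, one_mul]

theorem mul_rowUnipotent_apply (c : Fin n) (y : Fin n → K) (hy : y c = 0) (h : GL (Fin n) K)
    (i j : Fin n) : ((h * rowUnipotent c y hy : GL (Fin n) K) : Matrix (Fin n) (Fin n) K) i j =
      (h : Matrix (Fin n) (Fin n) K) i j + (h : Matrix (Fin n) (Fin n) K) i c * y j := by
  rw [Units.val_mul, Matrix.mul_apply]
  simp only [rowUnipotent_apply, mul_add, Finset.sum_add_distrib, mul_ite, mul_zero,
    Finset.sum_ite_eq', Finset.mem_univ, if_true]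
  rw [← Matrix.mul_apply, mul_one]

/-- Two subgroups allow elimination if every submatrix of an invertible matrix with nonzero rows
contains an entry that can be used as a pivot. -/
def AllowsElimination (A D : Subgroup (GL (Fin n) K)) : Prop :=
  ∀ (h : Matrix (Fin n) (Fin n) K) (R S : Finset (Fin n)), R.Nonempty →
    (∀ r ∈ R, ∃ c ∈ S, h r c ≠ 0) → ∃ r ∈ R, ∃ c ∈ S, h r c ≠ 0 ∧
      (∀ x (hx : x r = 0), (∀ a, a ≠ r → x a = if a ∈ R then -(h a c / h r c) else 0) →
        columnUnipotent r x hx ∈ A) ∧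
      ∀ y (hy : y c = 0), (∀ b, b ≠ c → y b = if b ∈ S then -(h r b / h r c) else 0) →
        rowUnipotent c y hy ∈ D

/-- Successive pivots clear their row and their column. Earlier pivots are not disturbed, because
the operations only involve untreated rows and unused columns. -/
theorem exists_monomial {A D : Subgroup (GL (Fin n) K)} (hAD : AllowsElimination A D)
    (g : GL (Fin n) K) : ∃ a ∈ A, ∃ d ∈ D, ∃ σ : Equiv.Perm (Fin n),
      ∀ i j, j ≠ σ i → ((a * g * d : GL (Fin n) K) : Matrix (Fin n) (Fin n) K) i j = 0 := by
  classical
  -- Induction on the number of untreated rows R. A treated row i has its only nonzero entry in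
  -- column σ i; these columns are distinct, and they vanish in the untreated rows.
  have key : ∀ k : ℕ, ∀ R : Finset (Fin n), R.card = k → ∀ (σ : Fin n → Fin n) (h : GL (Fin n) K),
      Set.InjOn σ {i | i ∉ R} →
      (∀ i ∉ R, ∀ j, j ≠ σ i → (h : Matrix (Fin n) (Fin n) K) i j = 0) →
      (∀ i ∉ R, ∀ i' ∈ R, (h : Matrix (Fin n) (Fin n) K) i' (σ i) = 0) →
      ∃ a ∈ A, ∃ d ∈ D, ∃ σ : Equiv.Perm (Fin n),
      ∀ i j, j ≠ σ i → ((a * h * d : GL (Fin n) K) : Matrix (Fin n) (Fin n) K) i j = 0 := by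
    intro k
    induction k with
    | zero =>
      intro R hR σ h hσ h1 _
      rw [Finset.card_eq_zero] at hR
      subst hR
      have hinj : Function.Injective σ := fun i j hij => hσ (by simp) (by simp) hij
      refine ⟨1, one_mem _, 1, one_mem _,
        Equiv.ofBijective σ (Finite.injective_iff_bijective.1 hinj), fun i j hj => ?_⟩
      rw [one_mul, mul_one]
      exact h1 i (by simp) j hj
    | succ k ih =>
      intro R hR σ h hσ h1 h2
      set S : Finset (Fin n) := Finset.univ.filter fun j => ∀ i ∉ R, σ i ≠ j with hS
      have hmemS : ∀ j, j ∈ S ↔ ∀ i ∉ R, σ i ≠ j := fun j => by simp [hS]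
      -- S consists of the columns not yet used as pivots. An untreated row vanishing on S would be
      -- zero, contradicting invertibility.
      have hrow : ∀ r ∈ R, ∃ c ∈ S, (h : Matrix (Fin n) (Fin n) K) r c ≠ 0 := by
        intro r hr
        by_contra! hcon
        have hzero : ∀ j, (h : Matrix (Fin n) (Fin n) K) r j = 0 := by
          intro j
          by_cases hj : j ∈ S
          · exact hcon j hj
          · rw [hmemS] at hj
            push Not at hj
            obtain ⟨i, hi, rfl⟩ := hj
            exact h2 i hi r hr
        have hone : ((h * h⁻¹ : GL (Fin n) K) : Matrix (Fin n) (Fin n) K) r r = 0 := by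
          rw [Units.val_mul, Matrix.mul_apply]
          exact Finset.sum_eq_zero fun j _ => by rw [hzero, zero_mul]
        rw [mul_inv_cancel, Units.val_one, Matrix.one_apply_eq] at hone
        exact one_ne_zero hone
      obtain ⟨r, hr, c, hc, hrc, hA, hD⟩ := hAD h R S (Finset.card_pos.1 (by omega)) hrow
      let x : Fin n → K := fun a => if a = r then 0 else if a ∈ R then
        -((h : Matrix (Fin n) (Fin n) K) a c / (h : Matrix (Fin n) (Fin n) K) r c) else 0
      let y : Fin n → K := fun b => if b = c then 0 else if b ∈ S then
        -((h : Matrix (Fin n) (Fin n) K) r b / (h : Matrix (Fin n) (Fin n) K) r c) else 0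
      have hx : x r = 0 := by simp [x]
      have hy : y c = 0 := by simp [y]
      have hxA := hA x hx fun a ha => by simp [x, ha]
      have hyD := hD y hy fun b hb => by simp [y, hb]
      set h' := columnUnipotent r x hx * h * rowUnipotent c y hy with hh'
      have hentry : ∀ i j, (h' : Matrix (Fin n) (Fin n) K) i j =
          ((h : Matrix (Fin n) (Fin n) K) i j + x i * (h : Matrix (Fin n) (Fin n) K) r j) +
          ((h : Matrix (Fin n) (Fin n) K) i c + x i * (h : Matrix (Fin n) (Fin n) K) r c) * y j := by
        intro i j
        rw [hh', mul_rowUnipotent_apply, columnUnipotent_mul_apply, columnUnipotent_mul_apply]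
      have hcS := (hmemS c).1 hc
      have hxR : ∀ i ∉ R, x i = 0 := fun i hi => by simp [x, hi]
      have hclear : ∀ i ∈ R, i ≠ r →
          (h : Matrix (Fin n) (Fin n) K) i c + x i * (h : Matrix (Fin n) (Fin n) K) r c = 0 := by
        intro i hi hir
        simp only [x, if_neg hir, if_pos hi]
        field_simp
        ring
      have I1 : Set.InjOn (Function.update σ r c) {i | i ∉ R.erase r} := by
        intro i hi j hj hij
        simp only [Set.mem_ofPred_eq, Finset.mem_erase, not_and] at hi hj
        by_cases hir : i = r <;> by_cases hjr : j = r
        · rw [hir, hjr]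
        · rw [hir, Function.update_self, Function.update_of_ne hjr] at hij
          exact absurd hij.symm (hcS j (hj hjr))
        · rw [hjr, Function.update_self, Function.update_of_ne hir] at hij
          exact absurd hij (hcS i (hi hir))
        · rw [Function.update_of_ne hir, Function.update_of_ne hjr] at hij
          exact hσ (hi hir) (hj hjr) hij
      have I2 : ∀ i ∉ R.erase r, ∀ j, j ≠ Function.update σ r c i → (h' : Matrix (Fin n) (Fin n) K) i j = 0 := by
        intro i hi j hj
        rw [Finset.mem_erase, not_and] at hi
        by_cases hir : i = r
        · subst hir
          rw [Function.update_self] at hj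
          rw [hentry, hx]
          simp only [zero_mul, add_zero]
          by_cases hjS : j ∈ S
          · simp only [y, if_neg hj, if_pos hjS]
            field_simp
            ring
          · have hj0 : (h : Matrix (Fin n) (Fin n) K) i j = 0 := by
              rw [hmemS] at hjS
              push Not at hjS
              obtain ⟨i', hi', rfl⟩ := hjS
              exact h2 i' hi' i hr
            simp [y, hj, hjS, hj0]
        · rw [Function.update_of_ne hir] at hj
          rw [hentry, hxR i (hi hir), h1 i (hi hir) j hj, h1 i (hi hir) c (hcS i (hi hir)).symm]
          ring
      have I3 : ∀ i ∉ R.erase r, ∀ i' ∈ R.erase r,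
          (h' : Matrix (Fin n) (Fin n) K) i' (Function.update σ r c i) = 0 := by
        intro i hi i' hi'
        rw [Finset.mem_erase, not_and] at hi
        rw [Finset.mem_erase] at hi'
        rw [hentry, hclear i' hi'.2 hi'.1, zero_mul, add_zero]
        by_cases hir : i = r
        · rw [hir, Function.update_self]
          exact hclear i' hi'.2 hi'.1
        · rw [Function.update_of_ne hir, h2 i (hi hir) i' hi'.2, h2 i (hi hir) r hr]
          ring
      obtain ⟨a, ha, d, hd, τ, hτ⟩ := ih (R.erase r) (by rw [Finset.card_erase_of_mem hr]; omega)
        (Function.update σ r c) h' I1 I2 I3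
      refine ⟨a * columnUnipotent r x hx, mul_mem ha hxA, rowUnipotent c y hy * d,
        mul_mem hyD hd, τ, fun i j hj => ?_⟩
      rw [← hτ i j hj, hh']
      simp only [mul_assoc]

  exact key n Finset.univ (by simp) id g (by intro i hi; simp at hi) (by simp) (by simp)

end Elimination

/-! ### Permutation matrices -/

section Weyl

variable (K : Type*) [Field K] {n : ℕ}

/-- The permutation matrix of `w`, with nonzero entries in positions `(i, w i)`. -/
def weyl (w : Equiv.Perm (Fin n)) : GL (Fin n) K where
  val := w.permMatrix K
  inv := w⁻¹.permMatrix K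
  val_inv := by rw [← Matrix.permMatrix_mul]; simp
  inv_val := by rw [← Matrix.permMatrix_mul]; simp

variable {K}

theorem weyl_apply (w : Equiv.Perm (Fin n)) (i j : Fin n) :
    (weyl K w : Matrix (Fin n) (Fin n) K) i j = if j = w i then 1 else 0 := by
  simp [weyl, Equiv.Perm.permMatrix, PEquiv.toMatrix_apply, Equiv.toPEquiv_apply, eq_comm]

theorem weyl_mul_apply (w : Equiv.Perm (Fin n)) (g : GL (Fin n) K) (i j : Fin n) :
    ((weyl K w * g : GL (Fin n) K) : Matrix (Fin n) (Fin n) K) i j =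
      (g : Matrix (Fin n) (Fin n) K) (w i) j := by
  rw [Units.val_mul, Matrix.mul_apply]
  simp [weyl_apply]

theorem weyl_mul_diagTorus (w : Equiv.Perm (Fin n)) (d : Fin n → Kˣ) :
    weyl K w * diagTorus K n d = diagTorus K n (d ∘ w) * weyl K w := by
  ext i j
  rw [weyl_mul_apply, diagTorus_mul_apply, weyl_apply, coe_diagTorus, Matrix.diagonal_apply]
  by_cases h : w i = j
  · simp [h]
  · simp [h, Ne.symm h]

theorem exists_eq_diagTorus_mul_weyl {g : GL (Fin n) K} {σ : Equiv.Perm (Fin n)}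
    (h : ∀ i j, j ≠ σ i → (g : Matrix (Fin n) (Fin n) K) i j = 0) :
    ∃ d, g = diagTorus K n d * weyl K σ := by
  have hne : ∀ i, (g : Matrix (Fin n) (Fin n) K) i (σ i) ≠ 0 := by
    intro i hi
    have hone : ((g * g⁻¹ : GL (Fin n) K) : Matrix (Fin n) (Fin n) K) i i = 0 := by
      rw [Units.val_mul, Matrix.mul_apply]
      refine Finset.sum_eq_zero fun j _ => ?_
      by_cases hj : j = σ i
      · rw [hj, hi, zero_mul]
      · rw [h i j hj, zero_mul]
    rw [mul_inv_cancel, Units.val_one, Matrix.one_apply_eq] at hone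
    exact one_ne_zero hone
  refine ⟨fun i => Units.mk0 _ (hne i), ?_⟩
  ext i j
  rw [diagTorus_mul_apply, weyl_apply]
  by_cases hj : j = σ i
  · simp [hj]
  · simp [hj, h i j hj]

variable [Valued K ℤᵐ⁰]

theorem weyl_mem_range (w : Equiv.Perm (Fin n)) : weyl K w ∈ (integralGL K n).range := by
  refine exists_integralGL_of_det _ (fun i j => ?_) ?_
  · rw [weyl_apply]
    split_ifs <;> simp
  · change Valued.v (w.permMatrix K).det = 1
    rw [Matrix.det_permutation]
    rcases Int.units_eq_one_or (Equiv.Perm.sign w) with h | h <;> simp [h]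

end Weyl

/-! ### Iwasawa and Bruhat decompositions -/

section Decompositions

variable {K : Type*} [Field K] [Valued K ℤᵐ⁰] {n : ℕ}

/-- Division by the leftmost entry of maximal valuation gives integral quotients, strictly smaller
than 1 to the left of the pivot. This is the condition for a row operation matrix to lie in the
pro-ℓ Iwahori subgroup. -/
theorem exists_leftmost_max (f : Fin n → ℤᵐ⁰) {S : Finset (Fin n)} (hS : S.Nonempty) :
    ∃ c ∈ S, ∀ b ∈ S, f b ≤ f c ∧ (b < c → f b < f c) := by
  classical
  obtain ⟨c₀, hc₀, hmax⟩ := S.exists_max_image f hS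
  have hne : (S.filter fun c => f c = f c₀).Nonempty := ⟨c₀, by simp [hc₀]⟩
  have hc := Finset.min'_mem _ hne
  set c := Finset.min' _ hne with hcdef
  rw [Finset.mem_filter] at hc
  refine ⟨c, hc.1, fun b hb => ⟨hc.2.symm ▸ hmax b hb, fun hlt => ?_⟩⟩
  refine lt_of_le_of_ne (hc.2.symm ▸ hmax b hb) fun heq => ?_
  have := Finset.min'_le (S.filter fun c => f c = f c₀) b
    (Finset.mem_filter.2 ⟨hb, heq.trans hc.2⟩)
  exact absurd hlt (not_lt.2 this)

theorem rowUnipotent_mem_proIwahori {c : Fin n} {y : Fin n → K} (hy : y c = 0)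
    (h1 : ∀ b, Valued.v (y b) ≤ 1) (h2 : ∀ b < c, Valued.v (y b) < 1) :
    rowUnipotent c y hy ∈ proIwahori K n := by
  rw [mem_proIwahori]
  refine ⟨fun i j => ?_, fun i j hij => ?_, fun i => ?_⟩
  · rw [rowUnipotent_apply]
    refine (Valued.v.map_add _ _).trans (max_le ?_ ?_)
    · rw [Matrix.one_apply]
      split_ifs <;> simp
    · split_ifs
      · exact h1 j
      · simp
  · rw [rowUnipotent_apply, Matrix.one_apply_ne hij.ne', zero_add]
    split_ifs with h
    · exact h2 j (h ▸ hij)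
    · simp
  · rw [rowUnipotent_apply, Matrix.one_apply_eq]
    split_ifs with h
    · simp [h, hy]
    · simp

theorem columnUnipotent_mem_proIwahori {r : Fin n} {x : Fin n → K} (hx : x r = 0)
    (h1 : ∀ a, Valued.v (x a) ≤ 1) (h2 : ∀ a, r < a → Valued.v (x a) < 1) :
    columnUnipotent r x hx ∈ proIwahori K n := by
  rw [mem_proIwahori]
  refine ⟨fun i j => ?_, fun i j hij => ?_, fun i => ?_⟩
  · rw [columnUnipotent_apply]
    refine (Valued.v.map_add _ _).trans (max_le ?_ ?_)
    · rw [Matrix.one_apply]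
      split_ifs <;> simp
    · split_ifs
      · exact h1 i
      · simp
  · rw [columnUnipotent_apply, Matrix.one_apply_ne hij.ne', zero_add]
    split_ifs with h
    · exact h2 i (h ▸ hij)
    · simp
  · rw [columnUnipotent_apply, Matrix.one_apply_eq]
    split_ifs with h
    · simp [h, hx]
    · simp

variable (K n) in
/-- The upper triangular Borel subgroup. -/
def borel : Subgroup (GL (Fin n) K) where
  carrier := {g | (g : Matrix (Fin n) (Fin n) K).BlockTriangular id}
  mul_mem' ha hb := by simpa using Matrix.BlockTriangular.mul ha hb
  one_mem' := by simpa using Matrix.blockTriangular_one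
  inv_mem' {a} ha := by
    have := a.invertible
    simpa using Matrix.blockTriangular_inv_of_blockTriangular ha

theorem rowUnipotent_pivot {h : Matrix (Fin n) (Fin n) K} {r c : Fin n} {S : Finset (Fin n)}
    (hrc : h r c ≠ 0)
    (hmax : ∀ b ∈ S, Valued.v (h r b) ≤ Valued.v (h r c) ∧
      (b < c → Valued.v (h r b) < Valued.v (h r c))) (y : Fin n → K) (hy : y c = 0)
    (hyb : ∀ b, b ≠ c → y b = if b ∈ S then -(h r b / h r c) else 0) :
    rowUnipotent c y hy ∈ proIwahori K n := by
  have hpos : 0 < Valued.v (h r c) := (Valuation.pos_iff _).2 hrc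
  refine rowUnipotent_mem_proIwahori hy (fun b => ?_) fun b hb => ?_
  · by_cases hbc : b = c
    · simp [hbc, hy]
    · rw [hyb b hbc]
      split_ifs with hbS
      · rw [Valuation.map_neg, map_div₀, div_le_one₀ hpos]
        exact (hmax b hbS).1
      · simp
  · rw [hyb b hb.ne]
    split_ifs with hbS
    · rw [Valuation.map_neg, map_div₀, div_lt_one₀ hpos]
      exact (hmax b hbS).2 hb
    · simp

/-- Taking the lowest untreated row as pivot row, row operations add it only to higher rows and so
are upper triangular. The pivot column is the leftmost one of maximal valuation. -/
theorem allowsElimination_borel : AllowsElimination (borel K n) (proIwahori K n) := by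
  intro h R S hR hrow
  have hr := R.max'_mem hR
  set r := R.max' hR with hrdef
  obtain ⟨c₀, hc₀, hne⟩ := hrow r hr
  obtain ⟨c, hc, hmax⟩ := exists_leftmost_max (fun c => Valued.v (h r c)) ⟨c₀, hc₀⟩
  have hrc : h r c ≠ 0 := by
    intro h0
    have := (hmax c₀ hc₀).1
    rw [h0, map_zero, le_zero_iff, map_eq_zero] at this
    exact hne this
  refine ⟨r, hr, c, hc, hrc, fun x hx hxa i j hij => ?_, fun y hy hyb =>
    rowUnipotent_pivot hrc hmax y hy hyb⟩
  replace hij : j < i := hij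
  rw [columnUnipotent_apply]
  have h0 : (1 : Matrix (Fin n) (Fin n) K) i j = 0 := Matrix.one_apply_ne hij.ne'
  rw [h0, zero_add]
  split_ifs with hj
  · subst hj
    rw [hxa i hij.ne', if_neg]
    intro hi
    exact absurd (R.le_max' i hi) (not_le.2 hij)
  · rfl

/-- The pivot is an entry of maximal valuation, in the lowest row where the maximum occurs and
leftmost within that row. Quotients are then integral, and strictly small wherever the operation
matrix has an entry below the diagonal. -/
theorem allowsElimination_proIwahori : AllowsElimination (proIwahori K n) (proIwahori K n) := by
  intro h R S hR hrow
  have hS : S.Nonempty := by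
    obtain ⟨r, hr⟩ := hR
    obtain ⟨c, hc, _⟩ := hrow r hr
    exact ⟨c, hc⟩
  have hsup : ∀ r, ∃ c ∈ S, ∀ b ∈ S, Valued.v (h r b) ≤ Valued.v (h r c) ∧
      (b < c → Valued.v (h r b) < Valued.v (h r c)) := fun r => exists_leftmost_max _ hS
  choose c hc hmax using hsup
  -- Reversing the order of the rows turns the leftmost maximum into the lowest one.
  obtain ⟨r', hr', hrmax⟩ := exists_leftmost_max (fun r => Valued.v (h r.rev (c r.rev)))
    (S := R.map Fin.revPerm.toEmbedding) (by simpa using hR)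
  obtain ⟨r, hr, rfl⟩ := Finset.mem_map.1 hr'
  have hrmax' : ∀ a ∈ R, Valued.v (h a (c a)) ≤ Valued.v (h r (c r)) ∧
      (r < a → Valued.v (h a (c a)) < Valued.v (h r (c r))) := by
    intro a ha
    have := hrmax a.rev (Finset.mem_map.2 ⟨a, ha, rfl⟩)
    simpa using this
  have hrc : h r (c r) ≠ 0 := by
    intro h0
    obtain ⟨b, hb, hne⟩ := hrow r hr
    have := (hmax r b hb).1
    rw [h0, map_zero, le_zero_iff, map_eq_zero] at this
    exact hne this
  have hpos : 0 < Valued.v (h r (c r)) := (Valuation.pos_iff _).2 hrc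
  refine ⟨r, hr, c r, hc r, hrc, fun x hx hxa => ?_, fun y hy hyb =>
    rowUnipotent_pivot hrc (hmax r) y hy hyb⟩
  refine columnUnipotent_mem_proIwahori hx (fun a => ?_) fun a ha => ?_
  · by_cases har : a = r
    · simp [har, hx]
    · rw [hxa a har]
      split_ifs with haR
      · rw [Valuation.map_neg, map_div₀, div_le_one₀ hpos]
        exact ((hmax a _ (hc r)).1).trans (hrmax' a haR).1
      · simp
  · rw [hxa a ha.ne']
    split_ifs with haR
    · rw [Valuation.map_neg, map_div₀, div_lt_one₀ hpos]
      exact ((hmax a _ (hc r)).1).trans_lt ((hrmax' a haR).2 ha)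
    · simp

/-- The Iwasawa decomposition. -/
theorem exists_iwasawa (g : GL (Fin n) K) : ∃ b ∈ borel K n, ∃ w : Equiv.Perm (Fin n),
    ∃ u ∈ proIwahori K n, g = b * weyl K w * u := by
  obtain ⟨a, ha, d, hd, σ, hσ⟩ := exists_monomial (allowsElimination_borel (K := K)) g
  obtain ⟨t, ht⟩ := exists_eq_diagTorus_mul_weyl hσ
  refine ⟨a⁻¹ * diagTorus K n t, mul_mem (inv_mem ha) ?_, σ, d⁻¹, inv_mem hd, ?_⟩
  · exact Matrix.blockTriangular_diagonal _
  · rw [mul_assoc a⁻¹, ← ht]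
    group

/-- The Bruhat decomposition with respect to the pro-`ℓ` Iwahori subgroup. -/
theorem exists_bruhat (g : GL (Fin n) K) : ∃ u ∈ proIwahori K n, ∃ t, ∃ w : Equiv.Perm (Fin n),
    ∃ u' ∈ proIwahori K n, g = u * (diagTorus K n t * weyl K w) * u' := by
  obtain ⟨a, ha, d, hd, σ, hσ⟩ := exists_monomial (allowsElimination_proIwahori (K := K)) g
  obtain ⟨t, ht⟩ := exists_eq_diagTorus_mul_weyl hσ
  exact ⟨a⁻¹, inv_mem ha, t, σ, d⁻¹, inv_mem hd, by rw [← ht]; group⟩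

end Decompositions

theorem exists_perm_of_card_fiber_eq {α γ : Type*} [Fintype α] [DecidableEq γ] {f g : α → γ}
    (h : ∀ c, (Finset.univ.filter fun a => f a = c).card =
      (Finset.univ.filter fun a => g a = c).card) :
    ∃ σ : Equiv.Perm α, ∀ a, g (σ a) = f a := by
  have e : ∀ c, Nonempty ({a // f a = c} ≃ {a // g a = c}) := fun c => by
    refine Fintype.card_eq.1 ?_
    rw [Fintype.card_subtype, Fintype.card_subtype]
    exact h c
  exact ⟨Equiv.ofFiberEquiv fun c => (e c).some, fun a => Equiv.ofFiberEquiv_map _ a⟩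

/-- Subsets of a finite type of the same cardinality, contained in the same subset, are conjugate
under the permutations preserving that subset. -/
theorem exists_perm_of_subset {α : Type*} [Fintype α] [DecidableEq α] {A S S' : Finset α}
    (hS : S ⊆ A) (hS' : S' ⊆ A) (h : S.card = S'.card) :
    ∃ σ : Equiv.Perm α, (∀ a, σ a ∈ A ↔ a ∈ A) ∧ ∀ a, σ a ∈ S' ↔ a ∈ S := by
  have hf : ∀ S ⊆ A, ∀ c : Prop × Prop, (Finset.univ.filter fun a => (a ∈ A, a ∈ S) = c).card =
      open Classical in if c.1 then if c.2 then S.card else A.card - S.card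
        else if c.2 then 0 else Fintype.card α - A.card := by
    classical
    rintro S hS ⟨x, y⟩
    simp only [Prod.mk.injEq, eq_iff_iff]
    by_cases hx : x <;> by_cases hy : y <;> simp only [hx, hy, if_true, if_false, iff_true, iff_false]
    · congr 1; ext a; simpa using fun h => hS h
    · rw [← Finset.card_sdiff_of_subset hS]
      congr 1; ext a; simp
    · rw [Finset.card_eq_zero]
      ext a; simpa using fun h h' => h (hS h')
    · rw [← Finset.card_compl]
      congr 1; ext a; simpa using fun h h' => h (hS h')
  classical
  -- The pair of memberships in A and in S cuts the type into pieces whose sizes depend only on the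
  -- cardinality of S.
  obtain ⟨σ, hσ⟩ := exists_perm_of_card_fiber_eq (f := fun a => (a ∈ A, a ∈ S))
    (g := fun a => (a ∈ A, a ∈ S')) fun c => by
      have h1 := hf S hS c
      have h2 := hf S' hS' c
      rw [h] at h1
      convert h1.trans h2.symm
  refine ⟨σ, fun a => ?_, fun a => ?_⟩
  · exact iff_of_eq (congrArg Prod.fst (hσ a))
  · exact iff_of_eq (congrArg Prod.snd (hσ a))

/-! ### The double cosets of the parahoric subgroup -/

section Parahoric

variable {K : Type*} [Field K] [Valued K ℤᵐ⁰] {n : ℕ} {ϖ : Kˣ}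

/-- The bounds on the valuations of the entries of an element of the parahoric subgroup. -/
def parahoricBound (ϖ : Kˣ) (n n₁ : ℕ) (i j : Fin n) : ℤᵐ⁰ :=
  if n₁ ≤ (i : ℕ) ∧ (j : ℕ) < n₁ then Valued.v (ϖ : K) else 1

theorem parahoricBound_le_one (hϖ : Valued.v (ϖ : K) = WithZero.exp (-1 : ℤ)) (n₁ : ℕ)
    (i j : Fin n) : parahoricBound ϖ n n₁ i j ≤ 1 := by
  unfold parahoricBound
  split_ifs
  · exact (uniformizer_lt_one hϖ).le
  · exact le_rfl

theorem one_le_parahoricBound (n₁ : ℕ) (i : Fin n) : 1 ≤ parahoricBound ϖ n n₁ i i := by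
  rw [parahoricBound, if_neg (by omega)]

theorem parahoricBound_mul (hϖ : Valued.v (ϖ : K) = WithZero.exp (-1 : ℤ)) (n₁ : ℕ)
    (i j k : Fin n) :
    parahoricBound ϖ n n₁ i j * parahoricBound ϖ n n₁ j k ≤ parahoricBound ϖ n n₁ i k := by
  have h1 := (uniformizer_lt_one hϖ).le
  by_cases hik : n₁ ≤ (i : ℕ) ∧ (k : ℕ) < n₁
  · by_cases hj : (j : ℕ) < n₁
    · rw [parahoricBound, if_pos ⟨hik.1, hj⟩, parahoricBound, if_neg (by omega), parahoricBound,
        if_pos hik, mul_one]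
    · rw [parahoricBound, if_neg (by omega), parahoricBound, if_pos ⟨not_lt.1 hj, hik.2⟩,
        parahoricBound, if_pos hik, one_mul]
  · refine (mul_le_one' (parahoricBound_le_one hϖ _ _ _) (parahoricBound_le_one hϖ _ _ _)).trans ?_
    rw [parahoricBound, if_neg hik]

theorem mem_parahoric (hϖ : Valued.v (ϖ : K) = WithZero.exp (-1 : ℤ)) {n₁ : ℕ}
    {g : GL (Fin n) K} : g ∈ parahoric K n n₁ ↔
      (∀ i j, Valued.v ((g : Matrix (Fin n) (Fin n) K) i j) ≤ parahoricBound ϖ n n₁ i j) ∧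
        Valued.v (g : Matrix (Fin n) (Fin n) K).det = 1 := by
  have hblock : ∀ i j : Fin n, (if (j : ℕ) < n₁ then 0 else 1 : ℕ) < (if (i : ℕ) < n₁ then 0 else 1) ↔
      n₁ ≤ (i : ℕ) ∧ (j : ℕ) < n₁ := by
    intro i j
    split_ifs <;> simp <;> omega
  constructor
  · rintro ⟨a, ha, rfl⟩
    refine ⟨fun i j => ?_, val_det_integralGL a⟩
    unfold parahoricBound
    split_ifs with h
    · have := ha ((hblock i j).2 h)
      exact le_uniformizer hϖ (residue_eq_zero_iff.1 this)
    · exact val_integralGL_le a i j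
  · rintro ⟨h1, h2⟩
    obtain ⟨a, rfl⟩ := exists_integralGL_of_det g
      (fun i j => (h1 i j).trans (parahoricBound_le_one hϖ _ _ _)) h2
    refine ⟨a, fun i j hij => ?_, rfl⟩
    rw [hblock] at hij
    refine residue_eq_zero_iff.2 ?_
    have := h1 i j
    rw [parahoricBound, if_pos hij] at this
    exact this.trans_lt (uniformizer_lt_one hϖ)

theorem proIwahori_le_parahoric (hϖ : Valued.v (ϖ : K) = WithZero.exp (-1 : ℤ)) (n₁ : ℕ) :
    proIwahori K n ≤ parahoric K n n₁ := by
  intro g hg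
  rw [mem_parahoric hϖ]
  obtain ⟨h1, h2, -⟩ := mem_proIwahori.1 hg
  constructor
  · intro i j
    unfold parahoricBound
    split_ifs with h
    · exact le_uniformizer hϖ (h2 i j (by rw [Fin.lt_def]; omega))
    · exact h1 i j
  · obtain ⟨a, -, rfl⟩ := hg
    exact val_det_integralGL a

theorem integralTorus_le_parahoric (hϖ : Valued.v (ϖ : K) = WithZero.exp (-1 : ℤ)) (n₁ : ℕ) :
    integralTorus K n ≤ parahoric K n n₁ := by
  rintro _ ⟨d, hd, rfl⟩
  rw [mem_parahoric hϖ]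
  constructor
  · intro i j
    rw [coe_diagTorus, Matrix.diagonal_apply]
    split_ifs with h
    · subst h
      exact (hd i).trans_le (one_le_parahoricBound n₁ i)
    · simp
  · rw [coe_diagTorus, Matrix.det_diagonal, map_prod]
    exact Finset.prod_eq_one fun i _ => hd i

theorem val_det_weyl (w : Equiv.Perm (Fin n)) :
    Valued.v (weyl K w : Matrix (Fin n) (Fin n) K).det = 1 := by
  obtain ⟨a, ha⟩ := weyl_mem_range (K := K) w
  rw [← ha]
  exact val_det_integralGL a

theorem weyl_mem_parahoric (hϖ : Valued.v (ϖ : K) = WithZero.exp (-1 : ℤ)) {n₁ : ℕ}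
    {w : Equiv.Perm (Fin n)} (hw : ∀ i, ((w i : Fin n) : ℕ) < n₁ → (i : ℕ) < n₁) :
    weyl K w ∈ parahoric K n n₁ := by
  rw [mem_parahoric hϖ]
  refine ⟨fun i j => ?_, val_det_weyl w⟩
  rw [weyl_apply]
  split_ifs with h
  · subst h
    have := hw i
    rw [parahoricBound, if_neg (by omega), map_one]
  · simp

/-- The element of the torus with entries `ϖ` at the elements of `S` and `1` elsewhere. -/
def subsetExp (ϖ : Kˣ) (S : Finset (Fin n)) (i : Fin n) : Kˣ := if i ∈ S then ϖ else 1

/-- The positions of the second block. -/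
def lastBlock (n n₁ : ℕ) : Finset (Fin n) := Finset.univ.filter fun i => n₁ ≤ (i : ℕ)

theorem mem_lastBlock {n₁ : ℕ} {i : Fin n} : i ∈ lastBlock n n₁ ↔ n₁ ≤ (i : ℕ) := by
  simp [lastBlock]

/-- The monomial matrix N and ϖN⁻¹ both lie in the parahoric order, so every nonzero entry of N has
the valuation of 1 or of ϖ. The first block of the middle factor is the identity, which forces N to
preserve the blocks and to have unit entries in the first. The determinant counts the remaining
entries of valuation that of ϖ. -/
theorem exists_subset_of_mem_doubleCoset (hϖ : Valued.v (ϖ : K) = WithZero.exp (-1 : ℤ)) {n₁ : ℕ}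
    {S₀ : Finset (Fin n)} (hS₀ : S₀ ⊆ lastBlock n n₁) {a b : GL (Fin n) K}
    (ha : a ∈ parahoric K n n₁) (hb : b ∈ parahoric K n n₁) {t : Fin n → Kˣ}
    {w : Equiv.Perm (Fin n)}
    (h : diagTorus K n t * weyl K w = a * diagTorus K n (subsetExp ϖ S₀) * b) :
    ∃ S ∈ (lastBlock n n₁).powersetCard S₀.card, ∃ z ∈ parahoric K n n₁,
      diagTorus K n t * weyl K w = diagTorus K n (subsetExp ϖ S) * z := by
  classical
  have hϖ1 := uniformizer_lt_one hϖ
  set N := diagTorus K n t * weyl K w with hN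
  have hNentry : ∀ i j, (N : Matrix (Fin n) (Fin n) K) i j = if j = w i then (t i : K) else 0 := by
    intro i j
    rw [hN, diagTorus_mul_apply, weyl_apply]
    split_ifs <;> simp
  let O := entryOrder (K := K) (parahoricBound ϖ n n₁) (one_le_parahoricBound n₁)
    (parahoricBound_mul hϖ n₁)
  have hmemO : ∀ z ∈ parahoric K n n₁, (z : Matrix (Fin n) (Fin n) K) ∈ O := fun z hz =>
    ((mem_parahoric hϖ).1 hz).1
  have hsub : ∀ i, Valued.v ((subsetExp ϖ S₀ i : Kˣ) : K) ≤ 1 := by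
    intro i
    unfold subsetExp
    split_ifs
    · exact hϖ1.le
    · simp
  have hgO : (diagTorus K n (subsetExp ϖ S₀) : Matrix (Fin n) (Fin n) K) ∈ O := by
    intro i j
    rw [coe_diagTorus, Matrix.diagonal_apply]
    split_ifs with hij
    · subst hij
      exact (hsub i).trans (one_le_parahoricBound n₁ i)
    · simp
  have hNO : (N : Matrix (Fin n) (Fin n) K) ∈ O := by
    rw [h, Units.val_mul, Units.val_mul]
    exact O.mul_mem (O.mul_mem (hmemO a ha) hgO) (hmemO b hb)
  have hN'O : ((diagTorus K n (fun _ => ϖ) * N⁻¹ : GL (Fin n) K) : Matrix (Fin n) (Fin n) K) ∈ O := by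
    have hcomm : ∀ z : GL (Fin n) K, diagTorus K n (fun _ => ϖ) * z =
        z * diagTorus K n (fun _ => ϖ) := fun z => by
      ext i j
      rw [diagTorus_mul_apply, mul_diagTorus_apply, mul_comm]
    have : diagTorus K n (fun _ => ϖ) * N⁻¹ =
        b⁻¹ * diagTorus K n ((fun _ => ϖ) * (subsetExp ϖ S₀)⁻¹) * a⁻¹ := by
      rw [h, map_mul, map_inv, _root_.mul_inv_rev, _root_.mul_inv_rev, ← mul_assoc, ← mul_assoc, hcomm,
        mul_assoc b⁻¹]
    rw [this, Units.val_mul, Units.val_mul]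
    refine O.mul_mem (O.mul_mem (hmemO _ (inv_mem hb)) ?_) (hmemO _ (inv_mem ha))
    intro i j
    rw [coe_diagTorus, Matrix.diagonal_apply]
    split_ifs with hij
    · subst hij
      refine le_trans ?_ (one_le_parahoricBound n₁ i)
      simp only [subsetExp, Pi.mul_apply, Pi.inv_apply]
      split_ifs
      · simp
      · simpa using hϖ1.le
    · simp
  have hle1 : ∀ i, Valued.v (t i : K) ≤ 1 := by
    intro i
    have := hNO i (w i)
    rw [hNentry, if_pos rfl] at this
    exact this.trans (parahoricBound_le_one hϖ _ _ _)
  have hge : ∀ i, Valued.v (ϖ : K) ≤ Valued.v (t i : K) := by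
    intro i
    have hinv : ((N⁻¹ : GL (Fin n) K) : Matrix (Fin n) (Fin n) K) (w i) i = (t i : K)⁻¹ := by
      have h1 : ((N * N⁻¹ : GL (Fin n) K) : Matrix (Fin n) (Fin n) K) i i = 1 := by simp
      rw [Units.val_mul, Matrix.mul_apply, Finset.sum_eq_single (w i), hNentry, if_pos rfl] at h1
      · exact eq_inv_of_mul_eq_one_right h1
      · intro j _ hj
        rw [hNentry, if_neg hj, zero_mul]
      · simp
    have := hN'O (w i) i
    rw [diagTorus_mul_apply, hinv, map_mul, map_inv₀] at this
    have hpos : 0 < Valued.v (t i : K) := (Valuation.pos_iff _).2 (t i).ne_zero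
    have h2 := this.trans (parahoricBound_le_one hϖ _ _ _)
    rwa [← div_eq_mul_inv, div_le_one₀ hpos] at h2
  have hval : ∀ i, Valued.v (t i : K) ≠ 1 → Valued.v (t i : K) = Valued.v (ϖ : K) := fun i hi =>
    le_antisymm (le_uniformizer hϖ (lt_of_le_of_ne (hle1 i) hi)) (hge i)
  -- Otherwise column j of N vanishes modulo ϖ. Then so does column j of b: in the first rows
  -- because the middle factor is 1 there, in the others by the parahoric condition. This
  -- contradicts the invertibility of b.
  have hcol : ∀ j : Fin n, (j : ℕ) < n₁ → ((w.symm j : Fin n) : ℕ) < n₁ ∧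
      Valued.v (t (w.symm j) : K) = 1 := by
    intro j hj
    by_contra hcon
    have hNj : ∀ i, Valued.v ((N : Matrix (Fin n) (Fin n) K) i j) < 1 := by
      intro i
      have hij := hNO i j
      by_cases hi : (i : ℕ) < n₁
      · rw [hNentry]
        split_ifs with hji
        · subst hji
          rw [Equiv.symm_apply_apply] at hcon
          exact lt_of_le_of_ne (hle1 i) fun h1 => hcon ⟨hi, h1⟩
        · simp
      · rw [parahoricBound, if_pos ⟨not_lt.1 hi, hj⟩] at hij
        exact hij.trans_lt hϖ1
    have hprod : a⁻¹ * N = diagTorus K n (subsetExp ϖ S₀) * b := by rw [h]; group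
    have hbj : ∀ k, Valued.v ((b : Matrix (Fin n) (Fin n) K) k j) < 1 := by
      intro k
      by_cases hk : (k : ℕ) < n₁
      · have h1 : Valued.v (((a⁻¹ * N : GL (Fin n) K) : Matrix (Fin n) (Fin n) K) k j) < 1 := by
          rw [Units.val_mul, Matrix.mul_apply]
          refine Valuation.map_sum_lt _ one_ne_zero fun i _ => ?_
          rw [map_mul]
          exact mul_lt_one_of_nonneg_of_lt_one_right ((hmemO _ (inv_mem ha) k i).trans
            (parahoricBound_le_one hϖ _ _ _)) zero_le (hNj i)
        rw [hprod, diagTorus_mul_apply, subsetExp, if_neg, Units.val_one, one_mul] at h1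
        · exact h1
        · intro hkS
          have := mem_lastBlock.1 (hS₀ hkS)
          omega
      · have := hmemO b hb k j
        rw [parahoricBound, if_pos ⟨not_lt.1 hk, hj⟩] at this
        exact this.trans_lt hϖ1
    have h1 : Valued.v (((b⁻¹ * b : GL (Fin n) K) : Matrix (Fin n) (Fin n) K) j j) < 1 := by
      rw [Units.val_mul, Matrix.mul_apply]
      refine Valuation.map_sum_lt _ one_ne_zero fun i _ => ?_
      rw [map_mul]
      exact mul_lt_one_of_nonneg_of_lt_one_right ((hmemO _ (inv_mem hb) j i).trans
        (parahoricBound_le_one hϖ _ _ _)) zero_le (hbj i)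
    simp at h1
  have hwinv : Set.MapsTo (w.symm : Equiv.Perm (Fin n)) {j | (j : ℕ) < n₁} {j | (j : ℕ) < n₁} :=
    fun j hj => (hcol j hj).1
  have hw : ∀ i : Fin n, (i : ℕ) < n₁ → ((w i : Fin n) : ℕ) < n₁ := by
    intro i hi
    exact Equiv.Perm.perm_symm_mapsTo_of_mapsTo _ hwinv hi
  have hfirst : ∀ i : Fin n, (i : ℕ) < n₁ → Valued.v (t i : K) = 1 := by
    intro i hi
    have := (hcol (w i) (hw i hi)).2
    rwa [Equiv.symm_apply_apply] at this
  let S : Finset (Fin n) := Finset.univ.filter fun i => Valued.v (t i : K) ≠ 1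
  have hmemS : ∀ i, i ∈ S ↔ Valued.v (t i : K) ≠ 1 := fun i => by simp [S]
  have hprodval : ∀ S' : Finset (Fin n), ∏ i, Valued.v ((subsetExp ϖ S' i : Kˣ) : K) =
      Valued.v (ϖ : K) ^ S'.card := by
    intro S'
    rw [← Finset.prod_const, ← Finset.prod_subset (Finset.subset_univ S')]
    · exact Finset.prod_congr rfl fun i hi => by rw [subsetExp, if_pos hi]
    · intro i _ hi
      rw [subsetExp, if_neg hi, Units.val_one, map_one]
  have htS : ∀ i, Valued.v (t i : K) = Valued.v ((subsetExp ϖ S i : Kˣ) : K) := by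
    intro i
    unfold subsetExp
    split_ifs with hi
    · exact hval i ((hmemS i).1 hi)
    · rw [hmemS, not_not] at hi
      simpa using hi
  have hcard : S.card = S₀.card := by
    have hdet := congrArg (fun g : GL (Fin n) K => Valued.v (g : Matrix (Fin n) (Fin n) K).det) h
    simp only [hN, Units.val_mul, Matrix.det_mul, map_mul, val_det_weyl,
      ((mem_parahoric hϖ).1 ha).2, ((mem_parahoric hϖ).1 hb).2, mul_one, one_mul, coe_diagTorus,
      Matrix.det_diagonal, map_prod] at hdet
    rw [hprodval, Finset.prod_congr rfl fun i _ => htS i, hprodval] at hdet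
    exact pow_right_injective₀ ((Valuation.pos_iff _).2 ϖ.ne_zero) hϖ1.ne hdet
  refine ⟨S, Finset.mem_powersetCard.2 ⟨fun i hi => ?_, hcard⟩,
    diagTorus K n ((subsetExp ϖ S)⁻¹ * t) * weyl K w, mul_mem ?_ ?_, ?_⟩
  · rw [mem_lastBlock]
    by_contra hlt
    exact (hmemS i).1 hi (hfirst i (not_le.1 hlt))
  · refine integralTorus_le_parahoric hϖ n₁ ⟨_, fun i => ?_, rfl⟩
    rw [Pi.mul_apply, Pi.inv_apply, Units.val_mul, map_mul, Units.val_inv_eq_inv_val, map_inv₀,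
      htS i, inv_mul_cancel₀]
    exact (Valuation.ne_zero_iff _).2 (Units.ne_zero _)
  · refine weyl_mem_parahoric hϖ fun i hi => ?_
    have := hwinv hi
    simpa using this
  · rw [hN, ← mul_assoc, ← map_mul, mul_inv_cancel_left]

variable {p : ℕ} [Fact p.Prime] [Finite 𝓀[K]]

/-- Put x = d⁻¹ u d. As d commutes with s, a fixed coset gives x⁻¹ s x in the parahoric subgroup.
The entries of x need not be integral a priori, but its diagonal and that of its inverse are those
of u and u⁻¹, hence units, so regularity of s puts x in the parahoric order. -/
theorem fixed_coset_eq (hϖ : Valued.v (ϖ : K) = WithZero.exp (-1 : ℤ))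
    (hq : Nat.card 𝓀[K] ≡ 1 [MOD p]) (hn : n ≤ p) {n₁ : ℕ} (d : Fin n → Kˣ) (m : ℕ)
    {u : GL (Fin n) K} (hu : u ∈ proIwahori K n)
    (h : (((iwahoriDatum n hϖ hq hn).s m * (u * diagTorus K n d) : GL (Fin n) K) :
      GL (Fin n) K ⧸ parahoric K n n₁) = ((u * diagTorus K n d : GL (Fin n) K) : _ ⧸ _)) :
    ((u * diagTorus K n d : GL (Fin n) K) : GL (Fin n) K ⧸ parahoric K n n₁) =
      (diagTorus K n d : GL (Fin n) K ⧸ parahoric K n n₁) := by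
  obtain ⟨h1, h2, h3⟩ := (exists_almost_root_of_unity hϖ hq m).choose_spec
  set r := (exists_almost_root_of_unity hϖ hq m).choose with hr
  have hs : (iwahoriDatum n hϖ hq hn).s m = diagTorus K n fun i => r ^ (i : ℕ) := rfl
  set e : Fin n → Kˣ := fun i => r ^ (i : ℕ)
  have hsT : (iwahoriDatum n hϖ hq hn).s m ∈ parahoric K n n₁ :=
    integralTorus_le_parahoric hϖ n₁ ((iwahoriDatum n hϖ hq hn).s_mem m)
  set x := (diagTorus K n d)⁻¹ * u * diagTorus K n d with hx
  have hxmem : x⁻¹ * diagTorus K n e * x * (diagTorus K n e)⁻¹ ∈ parahoric K n n₁ := by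
    rw [hs] at hsT h
    refine mul_mem ?_ (inv_mem hsT)
    have h4 := QuotientGroup.eq.1 h.symm
    have h5 : x⁻¹ * diagTorus K n e * x = (u * diagTorus K n d)⁻¹ *
        (diagTorus K n e * (u * diagTorus K n d)) := by
      have := diagTorus_comm (K := K) (n := n) e d
      calc x⁻¹ * diagTorus K n e * x = (diagTorus K n d)⁻¹ * u⁻¹ *
          (diagTorus K n d * diagTorus K n e) * (diagTorus K n d)⁻¹ * u * diagTorus K n d := by
            rw [hx]; group
        _ = _ := by rw [← this]; group
    rw [h5]
    exact h4
  have hdiag : ∀ (z : GL (Fin n) K) (i : Fin n),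
      (((diagTorus K n d)⁻¹ * z * diagTorus K n d : GL (Fin n) K) : Matrix (Fin n) (Fin n) K) i i =
        (z : Matrix (Fin n) (Fin n) K) i i := by
    intro z i
    rw [mul_diagTorus_apply, ← map_inv, diagTorus_mul_apply, Pi.inv_apply,
      Units.val_inv_eq_inv_val, mul_right_comm, inv_mul_cancel₀ (Units.ne_zero _), one_mul]
  have hentries := mem_entryOrder_of_conj (one_le_parahoricBound (ϖ := ϖ) n₁)
    (parahoricBound_mul hϖ n₁) (d := e) (fun i => by simp [e, h1])
    (fun i j hij => by
      simpa [e] using h3 i j (i.2.trans_le hn) (j.2.trans_le hn) (Fin.val_ne_of_ne hij))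
    (x := x) (fun i => by
      have : x⁻¹ = (diagTorus K n d)⁻¹ * u⁻¹ * diagTorus K n d := by rw [hx]; group
      rw [this, hdiag]
      exact val_diag_proIwahori (inv_mem hu) i)
    ((mem_parahoric hϖ).1 hxmem).1
  have hxp : x ∈ parahoric K n n₁ := by
    refine (mem_parahoric hϖ).2 ⟨hentries, ?_⟩
    obtain ⟨a, -, rfl⟩ := hu
    have hdet : (x : Matrix (Fin n) (Fin n) K).det =
        (integralGL K n a : Matrix (Fin n) (Fin n) K).det := by
      have h6 : diagTorus K n d * x = integralGL K n a * diagTorus K n d := by rw [hx]; group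
      have h7 := congrArg (fun g : GL (Fin n) K => (g : Matrix (Fin n) (Fin n) K).det) h6
      simp only [Units.val_mul, Matrix.det_mul] at h7
      rw [mul_comm] at h7
      refine mul_right_cancel₀ ?_ h7
      rw [coe_diagTorus, Matrix.det_diagonal]
      exact Finset.prod_ne_zero_iff.2 fun i _ => (d i).ne_zero
    rw [hdet, val_det_integralGL]
  symm
  rw [QuotientGroup.eq, ← mul_assoc]
  exact hxp

theorem injOn_subsetExp_coset (hϖ : Valued.v (ϖ : K) = WithZero.exp (-1 : ℤ)) {n₁ : ℕ}
    {S S' : Finset (Fin n)} (h : (diagTorus K n (subsetExp ϖ S) : GL (Fin n) K ⧸ parahoric K n n₁) =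
      diagTorus K n (subsetExp ϖ S')) : S = S' := by
  have key : ∀ S S' : Finset (Fin n),
      (diagTorus K n (subsetExp ϖ S) : GL (Fin n) K ⧸ parahoric K n n₁) =
        diagTorus K n (subsetExp ϖ S') → S ⊆ S' := by
    intro S S' h i hi
    by_contra hi'
    have hmem := ((mem_parahoric hϖ).1 (QuotientGroup.eq.1 h)).1 i i
    rw [← map_inv, ← map_mul, coe_diagTorus, Matrix.diagonal_apply_eq, Pi.mul_apply, Pi.inv_apply,
      subsetExp, if_pos hi, subsetExp, if_neg hi', mul_one, Units.val_inv_eq_inv_val,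
      map_inv₀] at hmem
    have h1 := hmem.trans (parahoricBound_le_one hϖ _ _ _)
    rw [inv_le_one₀ ((Valuation.pos_iff _).2 ϖ.ne_zero)] at h1
    exact absurd (uniformizer_lt_one hϖ) (not_lt.2 h1)
  exact (key S S' h).antisymm (key S' S h.symm)

/-- The Bruhat decomposition reduces an element of the double coset to a monomial one, which a
subset S then describes. Conversely, subsets of the last block of equal size are conjugate under
permutations preserving the blocks, whose matrices lie in the parahoric subgroup. -/
theorem doubleCosetCosets_eq (hϖ : Valued.v (ϖ : K) = WithZero.exp (-1 : ℤ))
    (hq : Nat.card 𝓀[K] ≡ 1 [MOD p]) (hn : n ≤ p) {n₁ : ℕ} {S₀ : Finset (Fin n)}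
    (hS₀ : S₀ ⊆ lastBlock n n₁) :
    doubleCosetCosets (parahoric K n n₁) (diagTorus K n (subsetExp ϖ S₀)) =
      ⋃ S ∈ (lastBlock n n₁).powersetCard S₀.card,
        (iwahoriDatum n hϖ hq hn).orbitU (parahoric K n n₁) (diagTorus K n (subsetExp ϖ S)) := by
  ext c
  obtain ⟨x, rfl⟩ := QuotientGroup.mk_surjective c
  simp only [Set.mem_iUnion, exists_prop, IwahoriDatum.mem_orbitU]
  have hmem : (x : GL (Fin n) K ⧸ parahoric K n n₁) ∈
      doubleCosetCosets (parahoric K n n₁) (diagTorus K n (subsetExp ϖ S₀)) ↔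
      ∃ a ∈ parahoric K n n₁, ∃ b ∈ parahoric K n n₁,
        x = a * diagTorus K n (subsetExp ϖ S₀) * b := by
    constructor
    · rintro ⟨z, hz⟩
      change (((z : GL (Fin n) K) * diagTorus K n (subsetExp ϖ S₀) : GL (Fin n) K) : GL (Fin n) K ⧸ parahoric K n n₁) =
        (x : GL (Fin n) K ⧸ parahoric K n n₁) at hz
      rw [QuotientGroup.eq] at hz
      exact ⟨z, z.2, _, hz, by group⟩
    · rintro ⟨a, ha, b, hb, rfl⟩
      refine ⟨⟨a, ha⟩, ?_⟩
      change ((a * diagTorus K n (subsetExp ϖ S₀) : GL (Fin n) K) : GL (Fin n) K ⧸ parahoric K n n₁) = _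
      rw [QuotientGroup.eq]
      simpa [mul_assoc] using hb
  rw [hmem]
  have hU := proIwahori_le_parahoric (n := n) hϖ n₁
  constructor
  · rintro ⟨a, ha, b, hb, rfl⟩
    obtain ⟨u, hu, t, w, u', hu', hx⟩ := exists_bruhat (a * diagTorus K n (subsetExp ϖ S₀) * b)
    obtain ⟨S, hS, z, hz, hSz⟩ := exists_subset_of_mem_doubleCoset hϖ hS₀
      (mul_mem (inv_mem (hU hu)) ha) (mul_mem hb (inv_mem (hU hu'))) (t := t) (w := w) (by
        calc diagTorus K n t * weyl K w = u⁻¹ * (u * (diagTorus K n t * weyl K w) * u') * u'⁻¹ := by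
              group
          _ = _ := by rw [← hx]; group)
    refine ⟨S, hS, u, hu, z * u', mul_mem hz (hU hu'), ?_⟩
    rw [hx, hSz]
    group
  · rintro ⟨S, hS, u, hu, h, hh, rfl⟩
    obtain ⟨hSA, hcard⟩ := Finset.mem_powersetCard.1 hS
    obtain ⟨w, hw1, hw2⟩ := exists_perm_of_subset hSA hS₀ hcard
    have hw : weyl K w ∈ parahoric K n n₁ := weyl_mem_parahoric hϖ fun i hi => by
      have := hw1 i
      rw [mem_lastBlock, mem_lastBlock] at this
      omega
    refine ⟨u * weyl K w, mul_mem (hU hu) hw, (weyl K w)⁻¹ * h, mul_mem (inv_mem hw) hh, ?_⟩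
    have h1 : subsetExp ϖ S₀ ∘ w = subsetExp ϖ S := by
      ext i
      simp [subsetExp, hw2]
    rw [mul_assoc u (weyl K w), weyl_mul_diagTorus, h1]
    group

/-- The positions of the entries `ϖ` of the matrix `heckeDiag`. -/
def heckePositions (n n₁ j : ℕ) : Finset (Fin n) :=
  Finset.univ.filter fun i => n₁ ≤ (i : ℕ) ∧ (i : ℕ) < n₁ + j

theorem heckeDiag_eq (n₁ j : ℕ) :
    heckeDiag n n₁ j ϖ = diagTorus K n (subsetExp ϖ (heckePositions n n₁ j)) := by
  ext i k
  have h : (heckeDiag n n₁ j ϖ : Matrix (Fin n) (Fin n) K) = Matrix.diagonal fun i : Fin n =>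
    (((if n₁ ≤ (i : ℕ) ∧ (i : ℕ) < n₁ + j then ϖ else 1 : Kˣ)) : K) := rfl
  rw [h, coe_diagTorus]
  simp [subsetExp, heckePositions]

theorem heckePositions_subset (n₁ j : ℕ) : heckePositions n n₁ j ⊆ lastBlock n n₁ := by
  intro i hi
  simp only [heckePositions, Finset.mem_filter] at hi
  exact mem_lastBlock.2 hi.2.1

theorem card_heckePositions {n₁ j : ℕ} (h : n₁ + j ≤ n) : (heckePositions n n₁ j).card = j := by
  have : (heckePositions n n₁ j).map Fin.valEmbedding = Finset.Ico n₁ (n₁ + j) := by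
    ext i
    simp only [heckePositions, Finset.mem_map, Finset.mem_filter, Finset.mem_univ, true_and,
      Fin.valEmbedding_apply, Finset.mem_Ico]
    constructor
    · rintro ⟨a, ha, rfl⟩
      exact ha
    · intro hi
      exact ⟨⟨i, by omega⟩, hi, rfl⟩
  rw [← Finset.card_map Fin.valEmbedding, this, Nat.card_Ico]
  omega

theorem card_lastBlock {n₁ n₂ : ℕ} (h : n₁ + n₂ = n) : (lastBlock n n₁).card = n₂ := by
  have : lastBlock n n₁ = heckePositions n n₁ n₂ := by
    ext i
    simp only [lastBlock, heckePositions, Finset.mem_filter, Finset.mem_univ, true_and]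
    omega
  rw [this, card_heckePositions h.le]

end Parahoric

section Compactness

variable {F : Type*} [Field F] [NumberField F]
    (x : IsDedekindDomain.HeightOneSpectrum (NumberField.RingOfIntegers F))
theorem compactSpace_integer [Finite 𝓀[x.adicCompletion F]] :
    CompactSpace 𝒪[x.adicCompletion F] := by
  have h1 : IsDiscreteValuationRing 𝒪[x.adicCompletion F] :=
    inferInstanceAs (IsDiscreteValuationRing (x.adicCompletionIntegers F))
  have h2 : CompleteSpace 𝒪[x.adicCompletion F] :=
    (Valued.isClosed_integer (x.adicCompletion F)).completeSpace_coe
  exact Valued.integer.compactSpace_iff_completeSpace_and_isDiscreteValuationRing_and_finite_residueField.2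
    ⟨h2, h1, inferInstance⟩

end Compactness

/-! ### Passage to subquotients -/

namespace IwahoriDatum

variable {p : ℕ} [Fact p.Prime] {G : Type*} [Group G] [TopologicalSpace G] (D : IwahoriDatum p G)
  {C V W : Type*} [Field C] [CharP C p] [AddCommGroup V] [Module C V] [AddCommGroup W] [Module C W]
  {π : Representation C G V} {π' : Representation C G W}

theorem map_mem_fixedVectors {A : V →ₗ[C] W} (hA : ∀ g v, A (π g v) = π' g (A v)) {v : V}
    (hv : v ∈ D.fixedVectors π) : A v ∈ D.fixedVectors π' := by
  rw [mem_fixedVectors] at hv ⊢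
  exact fun u hu => by rw [← hA, hv u hu]

/-- Passing to U-fixed vectors is exact, since the projection is natural: project any preimage. -/
theorem exists_fixedVectors_lift (hπ : IsSmooth π) (hπ' : IsSmooth π') {A : V →ₗ[C] W}
    (hA : ∀ g v, A (π g v) = π' g (A v)) (hs : Function.Surjective A) {w : W}
    (hw : w ∈ D.fixedVectors π') : ∃ v ∈ D.fixedVectors π, A v = w := by
  obtain ⟨v, rfl⟩ := hs w
  refine ⟨D.proj hπ v, D.proj_mem hπ v, ?_⟩
  rw [← D.proj_map_of_equivariant hπ hπ' A fun u _ v => hA u v, D.proj_of_mem hπ' hw]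

theorem TorusTrivial.of_injective {A : V →ₗ[C] W} (hA : ∀ g v, A (π g v) = π' g (A v))
    (hi : Function.Injective A) (h : D.TorusTrivial π') : D.TorusTrivial π := fun t ht v hv =>
  hi (by rw [hA, h t ht _ (D.map_mem_fixedVectors hA hv)])

theorem TorusTrivial.of_surjective (hπ : IsSmooth π) (hπ' : IsSmooth π') {A : V →ₗ[C] W}
    (hA : ∀ g v, A (π g v) = π' g (A v)) (hs : Function.Surjective A) (h : D.TorusTrivial π) :
    D.TorusTrivial π' := fun t ht w hw => by
  obtain ⟨v, hv, rfl⟩ := D.exists_fixedVectors_lift hπ hπ' hA hs hw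
  rw [← hA, h t ht v hv]

section TorusAction

variable {X : Type*} [CommGroup X] (τ : X →* D.N)

/-- The action of the group algebra of a commutative group mapping to the normaliser of the torus
on the vectors fixed by `U`. -/
def torusAction (hπ : IsSmooth π) (hT : D.TorusTrivial π) :
    MonoidAlgebra C X →ₐ[C] Module.End C (D.fixedVectors π) :=
  Representation.asAlgebraHom ((D.weylRep hπ hT).comp τ)

theorem torusAction_single (hπ : IsSmooth π) (hT : D.TorusTrivial π) (x : X) :
    D.torusAction τ hπ hT (MonoidAlgebra.single x 1) = D.weylRep hπ hT (τ x) := by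
  simp [torusAction]

theorem torusAction_map (hπ : IsSmooth π) (hT : D.TorusTrivial π) (hπ' : IsSmooth π')
    (hT' : D.TorusTrivial π') {A : V →ₗ[C] W} (hA : ∀ g v, A (π g v) = π' g (A v))
    (a : MonoidAlgebra C X) (v : D.fixedVectors π) :
    A (D.torusAction τ hπ hT a v) =
      D.torusAction τ hπ' hT' a ⟨A v, D.map_mem_fixedVectors hA v.2⟩ := by
  induction a using MonoidAlgebra.induction_on with
  | of x =>
    rw [MonoidAlgebra.of_apply, torusAction_single, torusAction_single, weylRep_apply,
      weylRep_apply, ← D.proj_map_of_equivariant hπ hπ' A fun u _ v => hA u v, hA]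
  | add a b ha hb => simp only [map_add, LinearMap.add_apply, Submodule.coe_add, ha, hb]
  | smul c a ha => simp only [map_smul, LinearMap.smul_apply, Submodule.coe_smul, ha]

/-- If an element of the group algebra acts as zero on the `U`-fixed vectors, it acts as zero on the
`U`-fixed vectors of every subquotient. -/
theorem torusAction_eq_zero_of_isSubquotient (hπ : IsSmooth π) (hπ' : IsSmooth π')
    (hT' : D.TorusTrivial π') (h : IsSubquotient π π') : ∃ hT : D.TorusTrivial π,
      ∀ a, D.torusAction τ hπ' hT' a = 0 → D.torusAction τ hπ hT a = 0 := by
  obtain ⟨M, hM, φ, hs, hφ⟩ := h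
  -- The vanishing descends first to the subrepresentation, whose fixed vectors embed, and then to
  -- its quotient, whose fixed vectors lift.
  let πM : Representation C G M :=
    { toFun g := (π' g).restrict (hM g)
      map_one' := by ext; simp
      map_mul' g h := by ext; simp }
  have hMsmooth : IsSmooth πM := fun m => by
    have := hπ' m
    simpa [πM, Subtype.ext_iff] using this
  have hι : ∀ g v, M.subtype (πM g v) = π' g (M.subtype v) := fun g v => rfl
  have hφ' : ∀ g v, φ (πM g v) = π g (φ v) := hφ
  have hTM : D.TorusTrivial πM := .of_injective D hι M.injective_subtype hT'
  have hT : D.TorusTrivial π := .of_surjective D hMsmooth hπ hφ' hs hTM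
  refine ⟨hT, fun a ha => ?_⟩
  have haM : D.torusAction τ hMsmooth hTM a = 0 := by
    ext v
    have := D.torusAction_map τ hMsmooth hTM hπ' hT' hι a v
    rw [ha] at this
    simpa using this
  ext v
  obtain ⟨m, hm, hmv⟩ := D.exists_fixedVectors_lift hMsmooth hπ hφ' hs v.2
  have := D.torusAction_map τ hMsmooth hTM hπ hT hφ' a ⟨m, hm⟩
  rw [haM] at this
  have hv : (⟨φ m, D.map_mem_fixedVectors hφ' hm⟩ : D.fixedVectors π) = v := Subtype.ext hmv
  rw [hv] at this
  simpa using this.symm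

end TorusAction
end IwahoriDatum


/-! ### Torus weights on the U-fixed vectors of an unramified principal series -/

section PrincipalSeries

variable {K : Type*} [Field K] [Valued K ℤᵐ⁰] {n : ℕ}

theorem isCompact_range_integralGL [CompactSpace 𝒪[K]] :
     IsCompact ((integralGL K n).range : Set (GL (Fin n) K)) := by
  have : CompactSpace (Matrix (Fin n) (Fin n) 𝒪[K]) := inferInstanceAs (CompactSpace (Fin n → Fin n → 𝒪[K]))
  have : T2Space 𝒪[K] := inferInstance
  have : CompactSpace (GL (Fin n) 𝒪[K]) := inferInstance
  have hc : Continuous (integralGL K n) := by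
    refine Continuous.units_map _ ?_
    exact continuous_id.matrix_map continuous_subtype_val
  rw [MonoidHom.coe_range]
  exact isCompact_range hc
variable {C : Type*} [Field C]

theorem diag_ne_zero_of_mem_borel {b : GL (Fin n) K} (hb : b ∈ borel K n) (i : Fin n) :
    (b : Matrix (Fin n) (Fin n) K) i i ≠ 0 := by
  have h : IsUnit (b : Matrix (Fin n) (Fin n) K).det := (Matrix.isUnit_iff_isUnit_det _).1 b.isUnit
  rw [Matrix.det_of_isUpperTriangular hb, isUnit_iff_ne_zero, Finset.prod_ne_zero_iff] at h
  exact h i (Finset.mem_univ i)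

theorem borel_mul_apply {χ : Fin n → Kˣ →* Cˣ} (f : principalSeriesSpace χ) {b : GL (Fin n) K}
    (hb : b ∈ borel K n) : ∃ a : Cˣ, ∀ g, (f : GL (Fin n) K → C) (b * g) = a * (f : GL (Fin n) K → C) g :=
  ⟨_, fun g => f.2.2 b g (fun i => Units.mk0 _ (diag_ne_zero_of_mem_borel hb i)) hb fun _ => rfl⟩

/-- By the Iwasawa decomposition a function is determined by its restriction to the compact group of
integral points. There local constancy is uniform, by the tube lemma. -/
theorem isSmooth_principalSeries [CompactSpace 𝒪[K]] (χ : Fin n → Kˣ →* Cˣ) :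
    IsSmooth (principalSeries (C := C) χ) := by
  intro f
  have hopen : IsOpen {x : GL (Fin n) K × GL (Fin n) K |
      (f : GL (Fin n) K → C) (x.1 * x.2) = (f : GL (Fin n) K → C) x.1} := by
    have h : IsLocallyConstant fun x : GL (Fin n) K × GL (Fin n) K =>
        (f : GL (Fin n) K → C) (x.1 * x.2) - (f : GL (Fin n) K → C) x.1 :=
      (f.2.1.comp_continuous continuous_mul).sub (f.2.1.comp_continuous continuous_fst)
    simpa only [sub_eq_zero] using h.isOpen_fiber 0
  obtain ⟨A, B, -, hB, hA', hB', hAB⟩ := generalized_tube_lemma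
    (isCompact_range_integralGL (K := K) (n := n)) (isCompact_singleton (x := (1 : GL (Fin n) K)))
    hopen (by rintro ⟨a, b⟩ ⟨_, rfl⟩; simp)
  refine Subgroup.isOpen_of_mem_nhds (IwahoriDatum.stab (principalSeries χ) f) (g := 1)
    (Filter.mem_of_superset (hB.mem_nhds (hB' rfl)) fun l hl => ?_)
  apply Subtype.ext
  funext g
  obtain ⟨b, hb, w, u, hu, rfl⟩ := exists_iwasawa g
  obtain ⟨a, ha⟩ := borel_mul_apply f hb
  have hz : weyl K w * u ∈ (integralGL K n).range := by
    refine mul_mem (weyl_mem_range w) ?_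
    obtain ⟨z, -, rfl⟩ := hu
    exact ⟨z, rfl⟩
  have h : (f : GL (Fin n) K → C) (weyl K w * u * l) = (f : GL (Fin n) K → C) (weyl K w * u) :=
    hAB (Set.mk_mem_prod (hA' hz) hl)
  change (f : GL (Fin n) K → C) (b * weyl K w * u * l) = (f : GL (Fin n) K → C) (b * weyl K w * u)
  rw [mul_assoc b, ha, ← h, ← ha]
  simp only [mul_assoc]

variable {χ : Fin n → Kˣ →* Cˣ}

theorem diagTorus_mul_principalSeries (f : principalSeriesSpace χ) (t : Fin n → Kˣ)
    (g : GL (Fin n) K) : (f : GL (Fin n) K → C) (diagTorus K n t * g) =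
      (∏ i, χ i (t i) : Cˣ) * (f : GL (Fin n) K → C) g :=
  f.2.2 _ g t (Matrix.blockTriangular_diagonal _) fun i => by
    rw [coe_diagTorus, Matrix.diagonal_apply_eq]

/-- The character of the diagonal torus obtained by permuting the `χ i`. -/
def twistedChar (χ : Fin n → Kˣ →* Cˣ) (w : Equiv.Perm (Fin n)) : (Fin n → Kˣ) →* C :=
  (Units.coeHom C).comp
    { toFun t := ∏ i, χ i (t (w i))
      map_one' := by simp
      map_mul' a b := by simp [Finset.prod_mul_distrib] }

theorem twistedChar_apply (w : Equiv.Perm (Fin n)) (t : Fin n → Kˣ) :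
    twistedChar χ w t = ∏ i, (χ i (t (w i)) : C) := by
  simp [twistedChar]

theorem weyl_mul_diagTorus_principalSeries (f : principalSeriesSpace χ) (w : Equiv.Perm (Fin n))
    (t : Fin n → Kˣ) (g : GL (Fin n) K) :
    (f : GL (Fin n) K → C) (weyl K w * (diagTorus K n t * g)) =
      twistedChar χ w t * (f : GL (Fin n) K → C) (weyl K w * g) := by
  rw [← mul_assoc, weyl_mul_diagTorus, mul_assoc, diagTorus_mul_principalSeries]
  rfl

theorem twistedChar_of_unramified (hχ : ∀ i, IsUnramifiedChar (χ i)) (w : Equiv.Perm (Fin n))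
    {t : Fin n → Kˣ} (ht : ∀ i, Valued.v (t i : K) = 1) : twistedChar χ w t = 1 := by
  rw [twistedChar_apply]
  exact Finset.prod_eq_one fun i _ => by rw [hχ i _ (ht _), Units.val_one]

variable {p : ℕ} [Fact p.Prime] [CharP C p] {ϖ : Kˣ} [Finite 𝓀[K]]
  (hϖ : Valued.v (ϖ : K) = WithZero.exp (-1 : ℤ)) (hq : Nat.card 𝓀[K] ≡ 1 [MOD p]) (hn : n ≤ p)

/-- The permutation matrices represent all double cosets of the Borel subgroup and U. -/
theorem principalSeries_ext {f f' : principalSeriesSpace χ}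
    (hf : f ∈ (iwahoriDatum n hϖ hq hn).fixedVectors (principalSeries χ))
    (hf' : f' ∈ (iwahoriDatum n hϖ hq hn).fixedVectors (principalSeries χ))
    (h : ∀ w, (f : GL (Fin n) K → C) (weyl K w) = (f' : GL (Fin n) K → C) (weyl K w)) : f = f' := by
  have key : ∀ f ∈ (iwahoriDatum n hϖ hq hn).fixedVectors (principalSeries χ),
      ∀ (g u : GL (Fin n) K), u ∈ proIwahori K n →
        (f : GL (Fin n) K → C) (g * u) = (f : GL (Fin n) K → C) g := by
    intro f hf g u hu
    have := ((iwahoriDatum n hϖ hq hn).mem_fixedVectors (principalSeries χ)).1 hf u hu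
    exact congrFun (congrArg Subtype.val this) g
  apply Subtype.ext
  funext g
  obtain ⟨b, hb, w, u, hu, rfl⟩ := exists_iwasawa g
  rw [key f hf _ u hu, key f' hf' _ u hu]
  have hd : ∀ i, (b : Matrix (Fin n) (Fin n) K) i i ≠ 0 := diag_ne_zero_of_mem_borel hb
  have h1 := f.2.2 b (weyl K w) (fun i => Units.mk0 _ (hd i)) hb fun i => rfl
  have h2 := f'.2.2 b (weyl K w) (fun i => Units.mk0 _ (hd i)) hb fun i => rfl
  rw [h1, h2, h]

/-- Translation by t preserves the U-fixed functions and multiplies the value at w by an unramified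
character evaluated at units. -/
theorem torusTrivial_principalSeries (hχ : ∀ i, IsUnramifiedChar (χ i)) :
    (iwahoriDatum n hϖ hq hn).TorusTrivial (principalSeries χ) := by
  rintro t ht f hf
  have hf' := ((iwahoriDatum n hϖ hq hn).mem_fixedVectors (principalSeries χ)).1 hf
  refine principalSeries_ext hϖ hq hn ?_ hf fun w => ?_
  · rw [IwahoriDatum.mem_fixedVectors]
    intro u hu
    have h1 := (iwahoriDatum n hϖ hq hn).T_conj _ (inv_mem ht) u hu
    rw [inv_inv] at h1
    have h2 := hf' _ h1
    rw [← Module.End.mul_apply, ← map_mul]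
    have h3 : u * t = t * (t⁻¹ * u * t) := by group
    rw [h3, map_mul, Module.End.mul_apply, h2]
  · obtain ⟨d, hd, rfl⟩ := ht
    have := weyl_mul_diagTorus_principalSeries f w d 1
    rw [mul_one, mul_one, twistedChar_of_unramified hχ w hd, one_mul] at this
    exact this

variable [CompactSpace 𝒪[K]]

/-- The value at w of the projection is the average of f(w u t) over u in U. This function of u is
invariant under conjugation by `s m`, so only u = 1 survives, and f(w t) is the twisted character of
t times f(w). -/
theorem proj_diagTorus_principalSeries (hχ : ∀ i, IsUnramifiedChar (χ i)) (t : Fin n → Kˣ)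
    {f : principalSeriesSpace χ}
    (hf : f ∈ (iwahoriDatum n hϖ hq hn).fixedVectors (principalSeries χ))
    (w : Equiv.Perm (Fin n)) :
    ((iwahoriDatum n hϖ hq hn).proj (isSmooth_principalSeries χ)
      (principalSeries χ (diagTorus K n t) f) : GL (Fin n) K → C) (weyl K w) =
      twistedChar χ w t * (f : GL (Fin n) K → C) (weyl K w) := by
  set D := iwahoriDatum n hϖ hq hn with hD
  have hTT := torusTrivial_principalSeries hϖ hq hn hχ
  obtain ⟨m, hm⟩ := D.exists_level (isSmooth_principalSeries χ)
    (principalSeries χ (diagTorus K n t) f)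
  have := Fintype.ofFinite (D.U ⧸ D.LU m)
  let E : principalSeriesSpace χ →ₗ[C] C :=
    LinearMap.proj (weyl K w) ∘ₗ (principalSeriesSpace χ).subtype
  have hE : ∀ x : GL (Fin n) K, ∀ f : principalSeriesSpace χ, E (principalSeries χ x f) =
    (f : GL (Fin n) K → C) (weyl K w * x) := fun x f => rfl
  have hTinv : ∀ y ∈ D.T, ∀ x : GL (Fin n) K, (f : GL (Fin n) K → C) (x * y) =
      (f : GL (Fin n) K → C) x := fun y hy x =>
    congrFun (congrArg Subtype.val (hTT y hy f hf)) x
  have hTinv' : ∀ y ∈ D.T, ∀ x : GL (Fin n) K, (f : GL (Fin n) K → C) (weyl K w * (y * x)) =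
      (f : GL (Fin n) K → C) (weyl K w * x) := by
    rintro _ ⟨d, hd, rfl⟩ x
    rw [weyl_mul_diagTorus_principalSeries, twistedChar_of_unramified hχ w hd, one_mul]
  have h := D.sum_eq (C := C) m
    (fun u => (f : GL (Fin n) K → C) (weyl K w * (u * diagTorus K n t))) ?_ ?_ ?_
  · change E (D.proj (isSmooth_principalSeries χ) (principalSeries χ (diagTorus K n t) f)) = _
    rw [D.proj_eq_average (isSmooth_principalSeries χ) hm, IwahoriDatum.average_apply, map_smul]
    simp only [finsum_eq_sum_of_fintype, map_sum, ← Module.End.mul_apply, ← map_mul, hE] at h ⊢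
    rw [h, smul_smul, inv_mul_cancel₀ (D.index_ne_zero m), one_smul, one_mul]
    have := weyl_mul_diagTorus_principalSeries f w t 1
    rwa [mul_one, mul_one] at this
  · intro u _ l hl
    have := congrFun (congrArg Subtype.val (hm l hl)) (weyl K w * u)
    change (f : GL (Fin n) K → C) (weyl K w * u * l * diagTorus K n t) =
      (f : GL (Fin n) K → C) (weyl K w * u * diagTorus K n t) at this
    simpa only [mul_assoc] using this
  · intro u _
    have hs := D.s_mem m
    obtain ⟨d, hd, hds⟩ := hs
    have h1 : D.s m * u * (D.s m)⁻¹ * diagTorus K n t =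
        D.s m * ((u * diagTorus K n t) * (D.s m)⁻¹) := by
      rw [← hds, ← map_inv]
      simp only [mul_assoc, diagTorus_comm t]
    rw [h1, hTinv' _ (D.s_mem m), ← mul_assoc, hTinv _ (inv_mem (D.s_mem m))]
  · intro y hy _
    rw [hTinv' y hy, one_mul]

/-- The diagonal torus in the normaliser of its group of integral points. -/
def diagTorusN : (Fin n → Kˣ) →* (iwahoriDatum n hϖ hq hn).N :=
  (diagTorus K n).codRestrict _ fun t => (iwahoriDatum n hϖ hq hn).mem_N_of_commute (by
    rintro _ ⟨d, _, rfl⟩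
    exact diagTorus_comm t d)

theorem torusAction_principalSeries (hχ : ∀ i, IsUnramifiedChar (χ i))
    (a : MonoidAlgebra C (Fin n → Kˣ))
    (f : (iwahoriDatum n hϖ hq hn).fixedVectors (principalSeries χ)) (w : Equiv.Perm (Fin n)) :
    (((iwahoriDatum n hϖ hq hn).torusAction (diagTorusN hϖ hq hn) (isSmooth_principalSeries χ)
      (torusTrivial_principalSeries hϖ hq hn hχ) a f : principalSeriesSpace χ) :
        GL (Fin n) K → C) (weyl K w) =
      MonoidAlgebra.lift C C (Fin n → Kˣ) (twistedChar χ w) a *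
        ((f : principalSeriesSpace χ) : GL (Fin n) K → C) (weyl K w) := by
  induction a using MonoidAlgebra.induction_on with
  | of x =>
    rw [MonoidAlgebra.of_apply, IwahoriDatum.torusAction_single, IwahoriDatum.weylRep_apply,
      MonoidAlgebra.lift_single, one_smul]
    exact proj_diagTorus_principalSeries hϖ hq hn hχ x f.2 w
  | add a b ha hb =>
    simp only [map_add, LinearMap.add_apply, Submodule.coe_add, Pi.add_apply, ha, hb, add_mul]
  | smul c a ha =>
    simp only [map_smul, LinearMap.smul_apply, Submodule.coe_smul, Pi.smul_apply, ha, smul_eq_mul,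
      mul_assoc]

/-- The weights of the diagonal torus on the vectors fixed by the pro-`ℓ` Iwahori subgroup in a
subquotient of a principal series. -/
theorem torusAction_eq_zero {V : Type*} [AddCommGroup V] [Module C V]
    {π : Representation C (GL (Fin n) K) V} (hπ : IsSmooth π) (hχ : ∀ i, IsUnramifiedChar (χ i))
    (h : IsSubquotient π (principalSeries χ)) :
    ∃ hT : (iwahoriDatum n hϖ hq hn).TorusTrivial π, ∀ a,
      (∀ w, MonoidAlgebra.lift C C (Fin n → Kˣ) (twistedChar χ w) a = 0) →
      (iwahoriDatum n hϖ hq hn).torusAction (diagTorusN hϖ hq hn) hπ hT a = 0 := by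
  obtain ⟨hT, h⟩ := (iwahoriDatum n hϖ hq hn).torusAction_eq_zero_of_isSubquotient
    (diagTorusN hϖ hq hn) hπ (isSmooth_principalSeries χ)
    (torusTrivial_principalSeries hϖ hq hn hχ) h
  refine ⟨hT, fun a ha => h a ?_⟩
  ext f : 1
  apply Subtype.ext
  refine principalSeries_ext hϖ hq hn (Subtype.mem _) (zero_mem _) fun w => ?_
  rw [torusAction_principalSeries hϖ hq hn hχ, ha, zero_mul]
  rfl

end PrincipalSeries

/-! ### Operators intertwined by a linear map -/

section Intertwining

variable {C H E : Type*} [Field C] [AddCommGroup H] [Module C H] [AddCommGroup E] [Module C E]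
  {Φ : H →ₗ[C] E}

theorem intertwines_aeval {T : Module.End C H} {A : Module.End C E} (h : ∀ c, Φ (T c) = A (Φ c))
    (P : C[X]) (c : H) : Φ (Polynomial.aeval T P c) = Polynomial.aeval A P (Φ c) := by
  induction P using Polynomial.induction_on generalizing c with
  | C a => simp
  | add P Q hP hQ => simp [hP, hQ]
  | monomial k a ih =>
    rw [pow_succ, ← mul_assoc, map_mul _ (Polynomial.C a * Polynomial.X ^ k),
      map_mul _ (Polynomial.C a * Polynomial.X ^ k), Polynomial.aeval_X, Polynomial.aeval_X,
      Module.End.mul_apply, Module.End.mul_apply, ih, h]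

theorem intertwines_prod {ι : Type*} (l : List ι) {T : ι → Module.End C H} {A : ι → Module.End C E}
    (h : ∀ i c, Φ (T i c) = A i (Φ c)) (c : H) :
    Φ ((l.map T).prod c) = (l.map A).prod (Φ c) := by
  induction l with
  | nil => simp
  | cons i l ih => simp [h, ih]

theorem intertwines_pow {T : Module.End C H} {A : Module.End C E} (h : ∀ c, Φ (T c) = A (Φ c))
    (m : ℕ) (c : H) : Φ ((T ^ m) c) = (A ^ m) (Φ c) := by
  simpa using intertwines_aeval h (Polynomial.X ^ m) c

end Intertwining

/-! ### Vectors whose translates are annihilated at one weight of an orbit -/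

section Weights

variable {C Y E : Type*} [Field C] [CommGroup Y] {n : ℕ} [AddCommGroup E] [Module C E]

theorem monoidAlgebra_algHom_ext {X B : Type*} [Monoid X] [Semiring B] [Algebra C B]
    {f g : MonoidAlgebra C X →ₐ[C] B}
    (h : ∀ t, f (MonoidAlgebra.single t 1) = g (MonoidAlgebra.single t 1)) : f = g := by
  refine AlgHom.ext fun a => ?_
  induction a using MonoidAlgebra.induction_on with
  | of t => exact h t
  | add a b ha hb => rw [map_add, map_add, ha, hb]
  | smul c a ha => rw [map_smul, map_smul, ha]

/-- Permutation of the coordinates of a torus. -/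
def permCoord (Y : Type*) [CommGroup Y] {n : ℕ} (w : Equiv.Perm (Fin n)) :
    (Fin n → Y) →* (Fin n → Y) where
  toFun t := t ∘ w
  map_one' := rfl
  map_mul' _ _ := rfl

theorem permCoord_apply (w : Equiv.Perm (Fin n)) (t : Fin n → Y) : permCoord Y w t = t ∘ w := rfl

/-- Evaluation of the group algebra of a torus at the translate of a character by a permutation. -/
def weightEval (e : (Fin n → Y) →* C) (w : Equiv.Perm (Fin n)) :
    MonoidAlgebra C (Fin n → Y) →ₐ[C] C :=
  MonoidAlgebra.lift C C (Fin n → Y) (e.comp (permCoord Y w))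

theorem weightEval_single (e : (Fin n → Y) →* C) (w : Equiv.Perm (Fin n)) (t : Fin n → Y) :
    weightEval e w (MonoidAlgebra.single t 1) = e (t ∘ w) := by
  simp [weightEval, permCoord_apply]

/-- The action of permutations on the group algebra of a torus. -/
def permAlg (C : Type*) [Field C] (w : Equiv.Perm (Fin n)) :
    MonoidAlgebra C (Fin n → Y) →ₐ[C] MonoidAlgebra C (Fin n → Y) :=
  MonoidAlgebra.mapDomainAlgHom C C (permCoord Y w)

theorem permAlg_single (w : Equiv.Perm (Fin n)) (t : Fin n → Y) :
    permAlg C w (MonoidAlgebra.single t 1) = MonoidAlgebra.single (t ∘ w) 1 := by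
  simp [permAlg, permCoord_apply]

theorem weightEval_permAlg (e : (Fin n → Y) →* C) (w w' : Equiv.Perm (Fin n))
    (a : MonoidAlgebra C (Fin n → Y)) :
    weightEval e w' (permAlg C w a) = weightEval e (w * w') a := by
  have h : (weightEval e w').comp (permAlg C w) = weightEval e (w * w') := by
    refine monoidAlgebra_algHom_ext fun t => ?_
    rw [AlgHom.comp_apply, permAlg_single, weightEval_single, weightEval_single]
    rfl
  exact DFunLike.congr_fun h a

/-- The permutations giving the weight of w₀ form a left coset of the stabiliser of e, so Lagrange's
theorem applies. The point is that this number is invertible in C as soon as n! is. -/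
theorem card_weightEval_eq_dvd (e : (Fin n → Y) →* C) (w₀ : Equiv.Perm (Fin n)) :
    Nat.card {w // weightEval e w = weightEval e w₀} ∣ n.factorial := by
  let H : Subgroup (Equiv.Perm (Fin n)) :=
    { carrier := {w | ∀ t : Fin n → Y, e (t ∘ w) = e t}
      mul_mem' := fun {a b} ha hb t => (hb (t ∘ a)).trans (ha t)
      one_mem' := fun t => rfl
      inv_mem' := fun {a} ha t => by
        rw [← ha]
        congr 1
        funext i
        simp }
  have hiff : ∀ w, weightEval e w = weightEval e w₀ ↔ w₀⁻¹ * w ∈ H := by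
    intro w
    constructor
    · intro h t
      have h1 := DFunLike.congr_fun h (MonoidAlgebra.single (t ∘ (w₀⁻¹ : Equiv.Perm (Fin n))) 1)
      rw [weightEval_single, weightEval_single] at h1
      refine Eq.trans h1 (congrArg e ?_)
      funext i
      simp
    · intro h
      refine monoidAlgebra_algHom_ext fun t => ?_
      rw [weightEval_single, weightEval_single, ← h (t ∘ w₀)]
      congr 1
      funext i
      simp
  have hcard : Nat.card {w // weightEval e w = weightEval e w₀} = Nat.card H :=
    Nat.card_congr ((Equiv.mulLeft w₀⁻¹).subtypeEquiv hiff)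
  rw [hcard]
  have := H.card_subgroup_dvd_card
  rwa [Nat.card_eq_fintype_card (α := Equiv.Perm (Fin n)), Fintype.card_perm,
    Fintype.card_fin] at this

/-- For each different weight choose a on which the two evaluations differ, and subtract from a its
value at the weight to be killed. The product of these factors works for all weights at once. -/
theorem exists_separating (e : (Fin n → Y) →* C) (w₀ : Equiv.Perm (Fin n)) :
    ∃ r : MonoidAlgebra C (Fin n → Y), weightEval e w₀ r ≠ 0 ∧
      ∀ w, weightEval e w ≠ weightEval e w₀ → weightEval e w r = 0 := by
  classical
  have h : ∀ w, ∃ r : MonoidAlgebra C (Fin n → Y), weightEval e w₀ r ≠ 0 ∧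
      (weightEval e w ≠ weightEval e w₀ → weightEval e w r = 0) := by
    intro w
    by_cases hw : weightEval e w = weightEval e w₀
    · exact ⟨1, by simp, fun h => absurd hw h⟩
    · obtain ⟨a, ha⟩ := DFunLike.ne_iff.1 hw
      refine ⟨a - algebraMap C _ (weightEval e w a), ?_, fun _ => ?_⟩
      · rw [map_sub, AlgHom.commutes, Algebra.algebraMap_self, RingHom.id_apply]
        exact sub_ne_zero.2 (Ne.symm ha)
      · rw [map_sub, AlgHom.commutes, Algebra.algebraMap_self, RingHom.id_apply, sub_self]
  choose r hr hr' using h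
  refine ⟨∏ w, r w, ?_, fun w hw => ?_⟩
  · rw [map_prod]
    exact Finset.prod_ne_zero_iff.2 fun w _ => hr w
  · rw [map_prod]
    exact Finset.prod_eq_zero (Finset.mem_univ w) (hr' w hw)

/-- A vector all of whose translates by permutations are annihilated by an element of the group
algebra that is nonzero at some weight vanishes, if the weights form one orbit. -/
theorem eq_zero_of_weights {ρ : MonoidAlgebra C (Fin n → Y) →ₐ[C] Module.End C E}
    {τ : Equiv.Perm (Fin n) → Module.End C E}
    (hτ : ∀ w t v, τ w (ρ (MonoidAlgebra.single t 1) v) =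
      ρ (MonoidAlgebra.single (t ∘ w) 1) (τ w v))
    {e : (Fin n → Y) →* C} (h0 : ∀ a, (∀ w, weightEval e w a = 0) → ρ a = 0)
    {Q : MonoidAlgebra C (Fin n → Y)} {w₀ : Equiv.Perm (Fin n)} (hQ : weightEval e w₀ Q ≠ 0)
    (hn : (n.factorial : C) ≠ 0) {x : E} (hx : ∀ w, ∃ y, x = τ w y ∧ ρ Q y = 0) : x = 0 := by
  classical
  have hτ' : ∀ w a v, τ w (ρ a v) = ρ (permAlg C w a) (τ w v) := by
    intro w a v
    induction a using MonoidAlgebra.induction_on with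
    | of t => rw [MonoidAlgebra.of_apply, hτ, permAlg_single]
    | add a b ha hb => simp only [map_add, LinearMap.add_apply, ha, hb]
    | smul c a ha => simp only [map_smul, LinearMap.smul_apply, ha]
  obtain ⟨r, hr, hr'⟩ := exists_separating e w₀
  have hε : ∀ w, weightEval e w (r * Q) =
      if weightEval e w = weightEval e w₀ then weightEval e w₀ (r * Q) else 0 := by
    intro w
    split_ifs with h
    · rw [h]
    · rw [map_mul, hr' w h, zero_mul]
  have hε0 : weightEval e w₀ (r * Q) ≠ 0 := by
    rw [map_mul]
    exact mul_ne_zero hr hQ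
  set N := Nat.card {w // weightEval e w = weightEval e w₀} with hN
  have hN0 : (N : C) ≠ 0 := by
    obtain ⟨d, hd⟩ := card_weightEval_eq_dvd e w₀
    intro h
    rw [hd, Nat.cast_mul, h, zero_mul] at hn
    exact hn rfl
  -- All weights lie in one orbit, so the sum of the translates of rQ takes the same value at each
  -- of them and must act as that scalar.
  have hsum : ρ (∑ w, permAlg C w (r * Q) -
      algebraMap C _ (N * weightEval e w₀ (r * Q))) = 0 := by
    refine h0 _ fun w' => ?_
    rw [map_sub, AlgHom.commutes, Algebra.algebraMap_self, RingHom.id_apply, map_sum, sub_eq_zero]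
    simp only [weightEval_permAlg]
    have hcomp := Equiv.sum_comp (Equiv.mulRight w') fun w => weightEval e w (r * Q)
    simp only [Equiv.coe_mulRight] at hcomp
    rw [hcomp, Finset.sum_congr rfl fun w _ => hε w, ← Finset.sum_filter, Finset.sum_const, nsmul_eq_mul,
      hN, Nat.card_eq_fintype_card, Fintype.card_subtype]
  -- On x = τ_w y the translate by w of rQ acts as τ_w r Q y, which is zero, so every summand kills
  -- x.
  have hzero : ρ (∑ w, permAlg C w (r * Q)) x = 0 := by
    rw [map_sum, LinearMap.sum_apply]
    refine Finset.sum_eq_zero fun w _ => ?_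
    obtain ⟨y, rfl, hy⟩ := hx w
    rw [← hτ', map_mul, Module.End.mul_apply, hy, map_zero, map_zero]
  rw [map_sub, AlgHom.commutes, sub_eq_zero] at hsum
  rw [hsum, Module.algebraMap_end_apply] at hzero
  exact (smul_eq_zero.1 hzero).resolve_left (mul_ne_zero hN0 hε0)

end Weights

/-! ### The Hecke operators as elements of the group algebra of the torus -/

section HeckeAlgebra

variable {K : Type*} [Field K] [Valued K ℤᵐ⁰] {n : ℕ} {C : Type*} [Field C] {ϖ : Kˣ}

theorem symmPoly_ne_zero (s : Multiset C) (n₂ j : ℕ) : symmPoly s n₂ j ≠ 0 :=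
  (Polynomial.monic_multiset_prod_of_monic _ _ fun _ _ => Polynomial.monic_X_sub_C _).ne_zero

theorem eval_symmPolyCoprime_ne_zero (s : Multiset C) (n₂ : ℕ) (α : C) (j : ℕ) :
    (symmPolyCoprime s n₂ α j).eval ((n₂.choose j : C) * α ^ j) ≠ 0 :=
  Polynomial.eval_divByMonic_pow_rootMultiplicity_ne_zero _ (symmPoly_ne_zero s n₂ j)

/-- The element of the group algebra of the torus through which the `j`-th Hecke operator acts. -/
def heckeElement (C : Type*) [Field C] (n n₁ : ℕ) (ϖ : Kˣ) (j : ℕ) :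
    MonoidAlgebra C (Fin n → Kˣ) :=
  ∑ S ∈ (lastBlock n n₁).powersetCard j, MonoidAlgebra.single (subsetExp ϖ S) 1

/-- The element of the group algebra of the torus through which `opQ` acts. -/
def heckeElementQ (n n₁ n₂ : ℕ) (ϖ : Kˣ) (s : Multiset C) (α : C) :
    MonoidAlgebra C (Fin n → Kˣ) :=
  ((List.finRange n₂).map fun j : Fin n₂ => Polynomial.aeval (heckeElement C n n₁ ϖ (j + 1))
    (symmPolyCoprime s n₂ α (j + 1))).prod

/-- At a weight with α throughout the last block, each of the binomially many subsets S contributes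
α^j. -/
theorem weightEval_heckeElement {n₁ n₂ : ℕ} (hn₂ : n₁ + n₂ = n) {α : C} {χ : Fin n → Kˣ →* Cˣ}
    {w : Equiv.Perm (Fin n)} (hw : ∀ i, w i ∈ lastBlock n n₁ → (χ i ϖ : C) = α) (j : ℕ) :
    weightEval (twistedChar χ 1) w (heckeElement C n n₁ ϖ j) = (n₂.choose j : C) * α ^ j := by
  rw [heckeElement, map_sum, ← card_lastBlock hn₂, ← Finset.card_powersetCard, ← nsmul_eq_mul]
  refine Finset.sum_eq_card_nsmul fun S hS => ?_
  obtain ⟨hS1, hS2⟩ := Finset.mem_powersetCard.1 hS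
  rw [weightEval_single, twistedChar_apply, ← Equiv.prod_comp w.symm, ← hS2, ← Finset.prod_const,
    ← Finset.prod_subset (Finset.subset_univ S)]
  · refine Finset.prod_congr rfl fun i hi => ?_
    have := hw (w.symm i) (by simpa using hS1 hi)
    simpa [subsetExp, hi] using this
  · intro i _ hi
    simp [subsetExp, hi]

/-- The multiplicity of α allows a permutation to place it at all positions of the last block. There
the j-th Hecke element takes precisely the value that is not a root of Q_j. -/
theorem exists_weightEval_heckeElementQ_ne_zero {n₁ n₂ : ℕ} (hn₂ : n₁ + n₂ = n)
    {χ : Fin n → Kˣ →* Cˣ} {α : C} {s : Multiset C}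
    (hs : Finset.univ.val.map (fun i => (χ i ϖ : C)) = s) (hα : n₂ ≤ open Classical in s.count α) :
    ∃ w, weightEval (twistedChar χ 1) w (heckeElementQ n n₁ n₂ ϖ s α) ≠ 0 := by
  classical
  let Z : Finset (Fin n) := Finset.univ.filter fun i => (χ i ϖ : C) = α
  have hZ : n₂ ≤ Z.card := by
    refine (le_of_le_of_eq hα ?_)
    rw [← hs, Multiset.count_map, Finset.card_def, Finset.filter_val]
    simp only [eq_comm]
  obtain ⟨Z', hZ', hcard⟩ := Finset.exists_subset_card_eq hZ
  obtain ⟨σ, -, hσ⟩ := exists_perm_of_subset (Finset.subset_univ (lastBlock n n₁))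
    (Finset.subset_univ Z') ((card_lastBlock hn₂).trans hcard.symm)
  refine ⟨σ.symm, ?_⟩
  have hw : ∀ i, σ.symm i ∈ lastBlock n n₁ → (χ i ϖ : C) = α := by
    intro i hi
    rw [← hσ, Equiv.apply_symm_apply] at hi
    simpa [Z] using hZ' hi
  rw [heckeElementQ, map_list_prod, List.map_map]
  refine List.prod_ne_zero fun h => ?_
  obtain ⟨j, -, hj⟩ := List.mem_map.1 h
  rw [Function.comp_apply, ← Polynomial.aeval_algHom_apply, weightEval_heckeElement hn₂ hw] at hj
  exact eval_symmPolyCoprime_ne_zero s n₂ α (j + 1) (by simpa using hj)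

variable {p : ℕ} [Fact p.Prime] [CharP C p] [Finite 𝓀[K]]
  (hϖ : Valued.v (ϖ : K) = WithZero.exp (-1 : ℤ)) (hq : Nat.card 𝓀[K] ≡ 1 [MOD p]) (hn : n ≤ p)
  {V : Type*} [AddCommGroup V] [Module C V] {π : Representation C (GL (Fin n) K) V}
  (hπ : IsSmooth π) (hT : (iwahoriDatum n hϖ hq hn).TorusTrivial π)

/-- The projected value of a class at a torus element. -/
abbrev parahoricEval (n₁ : ℕ) (y : (iwahoriDatum n hϖ hq hn).T) :
    H1 (parahoricRep n₁ π) →ₗ[C] (iwahoriDatum n hϖ hq hn).fixedVectors π :=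
  (iwahoriDatum n hϖ hq hn).torusEval hπ hT (integralTorus_le_parahoric hϖ n₁) y

/-- The double coset is the union of the U-orbits of the diagonal matrices attached to the j-element
subsets S, so the operator becomes the sum of their actions. -/
theorem parahoricEval_opV {n₁ j : ℕ} (hj : n₁ + j ≤ n) (y : (iwahoriDatum n hϖ hq hn).T)
    (c : H1 (parahoricRep n₁ π)) :
    parahoricEval hϖ hq hn hπ hT n₁ y (opV π n₁ ϖ j c) =
      (iwahoriDatum n hϖ hq hn).torusAction (diagTorusN hϖ hq hn) hπ hT
        (heckeElement C n n₁ ϖ j) (parahoricEval hϖ hq hn hπ hT n₁ y c) := by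
  unfold opV
  rw [heckeDiag_eq]
  have h := (iwahoriDatum n hϖ hq hn).torusEval_hecke hπ hT (parahoric_isOpen K n n₁)
    (proIwahori_le_parahoric hϖ n₁) (integralTorus_le_parahoric hϖ n₁)
    (diagTorus K n (subsetExp ϖ (heckePositions n n₁ j))) ((lastBlock n n₁).powersetCard j)
    (fun S => diagTorus K n (subsetExp ϖ S))
    (fun S => by
      rintro _ ⟨d, _, rfl⟩
      exact diagTorus_comm _ d)
    (fun S _ m u hu h => fixed_coset_eq hϖ hq hn _ m hu h)
    (fun S _ S' _ h => injOn_subsetExp_coset hϖ h)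
    (by
      have := doubleCosetCosets_eq hϖ hq hn (heckePositions_subset (n := n) n₁ j)
      rwa [card_heckePositions hj] at this) c y
  refine h.trans ?_
  rw [heckeElement, map_sum, LinearMap.sum_apply]
  refine Finset.sum_congr rfl fun S _ => ?_
  rw [IwahoriDatum.torusAction_single]
  rfl

theorem parahoricEval_opQ_pow {n₁ n₂ : ℕ} (hn₂ : n₁ + n₂ = n) (s : Multiset C) (α : C) (m : ℕ)
    (y : (iwahoriDatum n hϖ hq hn).T) (c : H1 (parahoricRep n₁ π)) :
    parahoricEval hϖ hq hn hπ hT n₁ y ((opQ π n₁ n₂ ϖ s α ^ m) c) =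
      (iwahoriDatum n hϖ hq hn).torusAction (diagTorusN hϖ hq hn) hπ hT
        (heckeElementQ n n₁ n₂ ϖ s α ^ m) (parahoricEval hϖ hq hn hπ hT n₁ y c) := by
  rw [map_pow]
  refine intertwines_pow (fun c => ?_) m c
  rw [heckeElementQ, map_list_prod, List.map_map, opQ, List.ofFn_eq_map]
  refine intertwines_prod _ (fun j c => ?_) c
  rw [Function.comp_apply, ← Polynomial.aeval_algHom_apply]
  exact intertwines_aeval (parahoricEval_opV hϖ hq hn hπ hT (by omega) y) _ c

end HeckeAlgebra

/-! ### Eventual constancy of factorial powers -/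

section Powers

theorem pow_eq_of_modEq {M : Type*} [Monoid M] {T : M} {a d : ℕ} (h : T ^ (a + d) = T ^ a) {m m' : ℕ}
    (hm : a ≤ m) (hm' : a ≤ m') (hmm : m ≡ m' [MOD d]) : T ^ m = T ^ m' := by
  have key : ∀ k m, a ≤ m → T ^ (m + k * d) = T ^ m := by
    intro k
    induction k with
    | zero => simp
    | succ k ih =>
      intro m hm
      obtain ⟨r, rfl⟩ := Nat.exists_eq_add_of_le hm
      have : a + r + (k + 1) * d = r + (a + d) + k * d := by ring
      rw [this, ih _ (by omega), pow_add, h, ← pow_add, add_comm]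
  wlog hle : m ≤ m' generalizing m m'
  · exact (this hm' hm hmm.symm (le_of_not_ge hle)).symm
  obtain ⟨k, hk⟩ := (Nat.modEq_iff_dvd' hle).1 hmm
  have : m' = m + k * d := by rw [mul_comm]; omega
  rw [this, key k m hm]

/-- Powers with exponents the factorials of an element with finitely many powers are eventually
constant. -/
theorem exists_pow_factorial_eq {M : Type*} [Monoid M] {T : M}
    (h : (Set.range fun m : ℕ => T ^ m).Finite) :
    ∃ N : ℕ, ∀ m, N ≤ m → T ^ m.factorial = T ^ N.factorial := by
  have hinj : ¬ Function.Injective fun m : ℕ => T ^ m := fun hi => Set.infinite_range_of_injective hi h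
  obtain ⟨a, b, hab, hne⟩ := Function.not_injective_iff.1 hinj
  wlog hlt : a < b generalizing a b
  · exact this b a hab.symm hne.symm (lt_of_le_of_ne (not_lt.1 hlt) hne.symm)
  obtain ⟨d, rfl⟩ := Nat.exists_eq_add_of_lt hlt
  -- Powers repeat from exponent a on with period d + 1, and m! is at least a and divisible by d + 1
  -- once m ≥ a + d + 1.
  refine ⟨a + d + 1, fun m hm => ?_⟩
  have hfac : ∀ m, a + d + 1 ≤ m → a ≤ m.factorial ∧ m.factorial ≡ 0 [MOD (d + 1)] := fun m hm =>
    ⟨by have := Nat.self_le_factorial m; omega,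
      (Nat.modEq_zero_iff_dvd).2 (Nat.dvd_factorial (Nat.succ_pos d) (by omega))⟩
  exact pow_eq_of_modEq (d := d + 1) hab.symm (hfac m hm).1 (hfac _ le_rfl).1
    ((hfac m hm).2.trans (hfac _ le_rfl).2.symm)

/-- An endomorphism of a finite-dimensional space over an algebraic extension of a finite field has
finitely many powers. -/
theorem finite_range_pow (k : Type*) {C H : Type*} [Field k] [Finite k] [Field C] [Algebra k C]
    [Algebra.IsAlgebraic k C] [AddCommGroup H] [Module C H] [Module.Finite C H]
    (T : Module.End C H) : (Set.range fun m : ℕ => T ^ m).Finite := by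
  let : Algebra k (Module.End C H) := Algebra.compHom _ (algebraMap k C)
  have : IsScalarTower k C (Module.End C H) := IsScalarTower.of_algebraMap_eq fun _ => rfl
  -- T is integral over C by finite dimension and C is algebraic over k, so T generates a finite
  -- algebra over the finite field k.
  have hT : IsIntegral k T := isIntegral_trans (A := C) T (Algebra.IsIntegral.isIntegral T)
  have := Algebra.finite_adjoin_simple_of_isIntegral hT
  have : Finite (Algebra.adjoin k {T}) := Module.finite_of_finite k
  refine (Set.toFinite (Algebra.adjoin k {T} : Set (Module.End C H))).subset ?_
  rintro _ ⟨m, rfl⟩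
  exact pow_mem (Algebra.self_mem_adjoin_singleton k T) m

end Powers

/-! ### Inflation from the finite parabolic subgroup, and existence of the limit -/

section Inflation

variable {K : Type*} [Field K] [Valued K ℤᵐ⁰] {n n₁ : ℕ} {ϖ : Kˣ}
  {C V : Type*} [Field C] [AddCommGroup V] [Module C V]
  {π : Representation C (GL (Fin n) K) V}

variable (K n) in
/-- The full congruence subgroup as a subgroup of `GL_n(K)`. -/
abbrev fullCongruence : Subgroup (GL (Fin n) K) := (reductionGL K n).ker.map (integralGL K n)

theorem isOpen_fullCongruence (hϖ : Valued.v (ϖ : K) = WithZero.exp (-1 : ℤ)) :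
    IsOpen (fullCongruence K n : Set (GL (Fin n) K)) := by
  refine Subgroup.isOpen_mono (H₁ := congruenceSubgroup K n 1) ?_
    (isOpen_congruenceSubgroup hϖ one_ne_zero)
  rintro _ ⟨a, ha, rfl⟩
  refine ⟨a, reductionGL_eq_one K n a fun i j => ?_, rfl⟩
  exact ((mem_ker_map_iff hϖ).1 ha i j).trans_lt
    (pow_lt_one₀ zero_le (uniformizer_lt_one hϖ) one_ne_zero)

theorem fullCongruence_le_proIwahori : fullCongruence K n ≤ proIwahori K n := by
  rintro _ ⟨a, ha, rfl⟩
  refine ⟨a, ?_, rfl⟩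
  rw [SetLike.mem_coe, Subgroup.mem_comap, MonoidHom.mem_ker.1 ha]
  exact one_mem _

theorem mem_congruenceInvariants {v : V} :
    v ∈ congruenceInvariants π ↔ ∀ g ∈ fullCongruence K n, π g v = v := by
  constructor
  · rintro h _ ⟨a, ha, rfl⟩
    exact h ⟨a, ha⟩
  · intro h a
    exact h _ ⟨a, a.2, rfl⟩

theorem residualRep_of_lift {a : GL (Fin n) 𝒪[K]} {g : GL (Fin n) 𝓀[K]} (h : reductionGL K n a = g)
    (v : congruenceInvariants π) : (residualRep π g v : V) = π (integralGL K n a) v := by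
  rw [← h, residualRep_reductionGL]

theorem mem_parahoric_of_lift {a : GL (Fin n) 𝒪[K]}
    (h : reductionGL K n a ∈ blockParabolic n n₁ 𝓀[K]) :
    integralGL K n a ∈ parahoric K n n₁ := ⟨a, h, rfl⟩

theorem parahoricReduction_lift {a : GL (Fin n) 𝒪[K]}
    (h : reductionGL K n a ∈ blockParabolic n n₁ 𝓀[K]) :
    parahoricReduction K n n₁ ⟨integralGL K n a, mem_parahoric_of_lift h⟩ =
      ⟨reductionGL K n a, h⟩ := by
  obtain ⟨b, hb, hb'⟩ := exists_parahoric_lift K n n₁ ⟨integralGL K n a, mem_parahoric_of_lift h⟩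
  apply Subtype.ext
  rw [← hb', integralGL_injective K n hb]

theorem parahoricReduction_surjective :
    Function.Surjective (parahoricReduction K n n₁) := by
  rintro ⟨g, hg⟩
  obtain ⟨a, rfl⟩ := reductionGL_surjective K n g
  exact ⟨_, parahoricReduction_lift hg⟩

theorem coe_parahoricReduction_rep (g : parahoric K n n₁) (v : congruenceInvariants π) :
    (residualRep π (parahoricReduction K n n₁ g) v : V) = π g v := by
  obtain ⟨a, ha, ha'⟩ := exists_parahoric_lift K n n₁ g
  rw [residualRep_of_lift ha', ha]

theorem inflationH1_mk (f : contCocycles (residualParabolicRep n₁ π)) :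
    ∃ F : contCocycles (parahoricRep n₁ π), inflationH1 n₁ π (Submodule.Quotient.mk f) =
      Submodule.Quotient.mk F ∧ ∀ g, (F : parahoric K n n₁ → V) g =
        ((f : blockParabolic n n₁ 𝓀[K] → congruenceInvariants π) (parahoricReduction K n n₁ g) : V) :=
  ⟨_, rfl, fun _ => rfl⟩

/-- The inflated cocycle vanishes on K¹, so any vector trivialising it is K¹-fixed and already
trivialises the original cocycle. -/
theorem inflationH1_injective : Function.Injective (inflationH1 n₁ π) := by
  rw [injective_iff_map_eq_zero]
  intro c hc
  obtain ⟨f, rfl⟩ := Submodule.Quotient.mk_surjective _ c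
  obtain ⟨F, hF, hFf⟩ := inflationH1_mk f
  rw [hF, Submodule.Quotient.mk_eq_zero] at hc
  obtain ⟨v, hv⟩ := hc
  have hf1 : (f : blockParabolic n n₁ 𝓀[K] → congruenceInvariants π) 1 = 0 := by
    simpa using f.2.2 1 1
  have hvmem : v ∈ congruenceInvariants π := by
    rintro ⟨a, ha⟩
    have h1 : reductionGL K n a ∈ blockParabolic n n₁ 𝓀[K] := by
      rw [MonoidHom.mem_ker.1 ha]; exact one_mem _
    have h2 := hv ⟨integralGL K n a, mem_parahoric_of_lift h1⟩
    have h3 : (⟨reductionGL K n a, h1⟩ : blockParabolic n n₁ 𝓀[K]) = 1 := Subtype.ext ha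
    rw [hFf, parahoricReduction_lift h1, h3, hf1, Submodule.coe_zero] at h2
    exact (sub_eq_zero.1 h2.symm)
  rw [Submodule.Quotient.mk_eq_zero]
  refine ⟨⟨v, hvmem⟩, fun g => ?_⟩
  obtain ⟨g, rfl⟩ := parahoricReduction_surjective g
  apply Subtype.ext
  rw [← hFf, hv, Submodule.coe_sub]
  congr 1
  exact (coe_parahoricReduction_rep g ⟨v, hvmem⟩).symm

/-- K¹ lies in U, so the cocycle can be corrected to vanish on K¹. It is then constant on the fibres
of reduction and takes K¹-invariant values. -/
theorem inflationH1_surjective {p : ℕ} [Fact p.Prime] [CharP C p] [Finite 𝓀[K]]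
    (hϖ : Valued.v (ϖ : K) = WithZero.exp (-1 : ℤ)) (hq : Nat.card 𝓀[K] ≡ 1 [MOD p]) (hn : n ≤ p) :
    Function.Surjective (inflationH1 n₁ π) := by
  intro c
  obtain ⟨F, rfl⟩ := Submodule.Quotient.mk_surjective _ c
  have hprime : (iwahoriDatum n hϖ hq hn).IsPrimeTo (fullCongruence K n) :=
    (iwahoriDatum n hϖ hq hn).isPrimeTo_U.mono (isOpen_fullCongruence hϖ)
      fullCongruence_le_proIwahori
  have hle : fullCongruence K n ≤ parahoric K n n₁ := by
    rintro _ ⟨a, ha, rfl⟩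
    refine mem_parahoric_of_lift ?_
    rw [MonoidHom.mem_ker.1 ha]
    exact one_mem _
  obtain ⟨v, hv⟩ := hprime.exists_coboundary (parahoric_isOpen K n n₁) hle F
  let F' : parahoric K n n₁ → V := fun g => (F : parahoric K n n₁ → V) g - (π g v - v)
  have hF' : ∀ g h : parahoric K n n₁, F' (g * h) = F' g + π g (F' h) := by
    intro g h
    have := F.2.2 g h
    simp only [F', this, Subgroup.coe_mul, map_mul, Module.End.mul_apply, map_sub,
      MonoidHom.comp_apply, Subgroup.subtype_apply]
    abel
  have hker : ∀ (g : GL (Fin n) K) (hg : g ∈ fullCongruence K n), F' ⟨g, hle hg⟩ = 0 := fun g hg => by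
    simp only [F', hv g hg, sub_self]
  have hcongr : ∀ g h : parahoric K n n₁,
      parahoricReduction K n n₁ g = parahoricReduction K n n₁ h →
      ∃ k, ∃ hk : k ∈ fullCongruence K n, h = g * ⟨k, hle hk⟩ := by
    intro g h hgh
    obtain ⟨a, ha, ha'⟩ := exists_parahoric_lift K n n₁ g
    obtain ⟨b, hb, hb'⟩ := exists_parahoric_lift K n n₁ h
    refine ⟨_, ⟨a⁻¹ * b, ?_, rfl⟩, ?_⟩
    · rw [SetLike.mem_coe, MonoidHom.mem_ker, map_mul, map_inv, ha', hb', hgh, inv_mul_cancel]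
    · apply Subtype.ext
      simp [ha, hb]
  have hconst : ∀ g h : parahoric K n n₁,
      parahoricReduction K n n₁ g = parahoricReduction K n n₁ h → F' g = F' h := by
    intro g h hgh
    obtain ⟨k, hk, rfl⟩ := hcongr g h hgh
    rw [hF', hker k hk, map_zero, add_zero]
  have hmem : ∀ g, F' g ∈ congruenceInvariants π := by
    intro g
    rw [mem_congruenceInvariants]
    intro k hk
    -- For k in K¹ the corrected cocycle gives F'(kg) = k F'(g), while kg and g have the same
    -- reduction; so k fixes F'(g).
    have h1 := hF' ⟨k, hle hk⟩ g
    rw [hker k hk, zero_add] at h1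
    rw [← h1]
    refine hconst _ _ ?_
    obtain ⟨a, ha, rfl⟩ := hk
    have h2 : reductionGL K n a ∈ blockParabolic n n₁ 𝓀[K] := by
      rw [MonoidHom.mem_ker.1 ha]; exact one_mem _
    have h3 : (⟨reductionGL K n a, h2⟩ : blockParabolic n n₁ 𝓀[K]) = 1 := Subtype.ext ha
    rw [map_mul, parahoricReduction_lift h2, h3, one_mul]
  let sec := Function.surjInv (parahoricReduction_surjective (K := K) (n := n) (n₁ := n₁))
  have hsec : ∀ g, parahoricReduction K n n₁ (sec g) = g := Function.surjInv_eq _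
  let f : contCocycles (residualParabolicRep n₁ π) :=
    ⟨fun g => ⟨F' (sec g), hmem _⟩, IsLocallyConstant.of_discrete _, fun g h => by
      apply Subtype.ext
      have h1 := coe_parahoricReduction_rep (sec g) ⟨F' (sec h), hmem _⟩
      rw [hsec] at h1
      refine Eq.trans ?_ (congrArg (F' (sec g) + ·) h1.symm)
      rw [← hF']
      refine hconst _ _ ?_
      rw [hsec, map_mul, hsec, hsec]⟩
  refine ⟨Submodule.Quotient.mk f, ?_⟩
  obtain ⟨F₁, hF₁, hF₁f⟩ := inflationH1_mk f
  rw [hF₁, eq_comm, Submodule.Quotient.eq]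
  refine ⟨v, fun g => ?_⟩
  have h1 : (F₁ : parahoric K n n₁ → V) g = F' g := by
    rw [hF₁f]
    exact hconst _ _ (hsec _)
  rw [Submodule.coe_sub, Pi.sub_apply, h1]
  simp only [F', MonoidHom.comp_apply, Subgroup.subtype_apply]
  abel

/-- Cocycles are functions from a finite group to the K¹-invariants, which are finite-dimensional by
admissibility. -/
theorem finite_H1_residualParabolicRep [Finite 𝓀[K]]
    (hϖ : Valued.v (ϖ : K) = WithZero.exp (-1 : ℤ)) (hπ : IsAdmissible π) :
    Module.Finite C (H1 (residualParabolicRep n₁ π)) := by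
  have h1 := hπ.finite (fullCongruence K n) (isOpen_fullCongruence hϖ)
  have h2 : Representation.invariants (π.comp (fullCongruence K n).subtype) =
      congruenceInvariants π := by
    ext v
    rw [mem_congruenceInvariants]
    exact ⟨fun h g hg => h ⟨g, hg⟩, fun h g => h g g.2⟩
  rw [h2] at h1
  have : Finite (blockParabolic n n₁ 𝓀[K]) := inferInstance
  infer_instance

/-- The limit of the powers of an operator on `H¹(𝔭, π)` with exponents the factorials. -/
theorem exists_isProjectorE (k : Type*) [Field k] [Finite k] [Algebra k C] [Algebra.IsAlgebraic k C]
    [Finite 𝓀[K]] (hϖ : Valued.v (ϖ : K) = WithZero.exp (-1 : ℤ)) (hπ : IsAdmissible π)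
    (hbij : Function.Bijective (inflationH1 n₁ π)) (n₂ : ℕ) (s : Multiset C) (α : C) :
    ∃ e, IsProjectorE π n₁ n₂ ϖ s α e := by
  have := finite_H1_residualParabolicRep (n₁ := n₁) hϖ hπ
  let I := LinearEquiv.ofBijective (inflationH1 n₁ π) hbij
  let T : Module.End C (H1 (residualParabolicRep n₁ π)) :=
    I.symm.toLinearMap ∘ₗ opQ π n₁ n₂ ϖ s α ∘ₗ I.toLinearMap
  have hT : ∀ c, inflationH1 n₁ π (T c) = opQ π n₁ n₂ ϖ s α (inflationH1 n₁ π c) := fun c =>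
    I.apply_symm_apply _
  obtain ⟨N, hN⟩ := exists_pow_factorial_eq (finite_range_pow k T)
  refine ⟨T ^ N.factorial, fun c => Filter.eventually_atTop.2 ⟨N, fun m hm => ?_⟩⟩
  rw [← intertwines_pow hT, hN m hm]

end Inflation

/-! ### The index of the torus over the residue field -/

section TorusIndex

variable (n : ℕ) (k : Type*) [Field k]

theorem diagTorus_injective : Function.Injective (diagTorus k n) := by
  intro d d' h
  funext i
  have := congrArg (fun g : GL (Fin n) k => (g : Matrix (Fin n) (Fin n) k) i i) h
  simpa [coe_diagTorus, Units.ext_iff] using this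

/-- The index of the diagonal torus in `GL_n` of a finite field with `q ≡ 1` elements is
`n!` modulo `p`. -/
theorem index_diagTorus_ne_zero {p : ℕ} [Fact p.Prime] [Finite k] {C : Type*} [Field C]
    [CharP C p] (hq : Nat.card k ≡ 1 [MOD p]) (hn : n < p) :
    ((diagTorus k n).range.index : C) ≠ 0 := by
  have := Fintype.ofFinite k
  classical
  set q := Fintype.card k with hqdef
  have hqC : (q : C) = 1 := by
    have := (CharP.natCast_eq_natCast C p).2 hq
    rwa [Nat.card_eq_fintype_card, Nat.cast_one] at this
  have hq1 : 1 < q := Fintype.one_lt_card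
  have hcardT : Nat.card (diagTorus k n).range = (q - 1) ^ n := by
    rw [← Nat.card_congr (MonoidHom.ofInjective (diagTorus_injective n k)).toEquiv, Nat.card_fun,
      Nat.card_fin, Nat.card_eq_fintype_card, Fintype.card_units]
  -- Each factor q^n - q^i of the order of the group, divided by q - 1, becomes q^i(1 + ⋯ +
  -- q^{n-i-1}), which is n - i modulo p.
  have hfac : ∀ i : Fin n, q ^ n - q ^ (i : ℕ) =
      (q ^ (i : ℕ) * ∑ j ∈ Finset.range (n - i), q ^ j) * (q - 1) := by
    intro i
    have h1 : (∑ j ∈ Finset.range (n - i), q ^ j) * (q - 1) = q ^ (n - (i : ℕ)) - 1 := by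
      have := Nat.geomSum_eq (m := q) hq1 (n - i)
      rw [this]
      exact Nat.div_mul_cancel (by simpa using Nat.sub_dvd_pow_sub_pow q 1 (n - i))
    rw [mul_assoc, h1, Nat.mul_sub, mul_one, ← pow_add, Nat.add_sub_cancel' i.2.le]
  have hindex : (diagTorus k n).range.index =
      ∏ i : Fin n, (q ^ (i : ℕ) * ∑ j ∈ Finset.range (n - i), q ^ j) := by
    have h1 := (diagTorus k n).range.card_mul_index
    rw [hcardT, Matrix.card_GL_field, ← hqdef, Finset.prod_congr rfl fun i _ => hfac i,
      Finset.prod_mul_distrib, Finset.prod_const, Finset.card_univ, Fintype.card_fin,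
      mul_comm] at h1
    exact Nat.eq_of_mul_eq_mul_right (pow_pos (by omega) n) h1
  rw [hindex, Nat.cast_prod, Finset.prod_ne_zero_iff]
  intro i _
  have hi := i.2
  simp only [Nat.cast_mul, Nat.cast_pow, Nat.cast_sum, hqC, one_pow, one_mul, Finset.sum_const,
    Finset.card_range, nsmul_eq_mul, mul_one]
  rw [Ne, CharP.cast_eq_zero_iff C p]
  exact fun h => absurd (Nat.le_of_dvd (by omega) h) (by omega)

end TorusIndex

/-! ### Weyl symmetry of restricted classes, and injectivity -/

section Injectivity

variable {K : Type*} [Field K] [Valued K ℤᵐ⁰] {n n₁ : ℕ} {ϖ : Kˣ} {C : Type*} [Field C]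
  {p : ℕ} [Fact p.Prime] [CharP C p] [Finite 𝓀[K]]
  (hϖ : Valued.v (ϖ : K) = WithZero.exp (-1 : ℤ)) (hq : Nat.card 𝓀[K] ≡ 1 [MOD p]) (hn : n ≤ p)
  {V : Type*} [AddCommGroup V] [Module C V] {π : Representation C (GL (Fin n) K) V}

theorem weyl_conj_diagTorus (w : Equiv.Perm (Fin n)) (d : Fin n → Kˣ) :
    weyl K w * diagTorus K n d * (weyl K w)⁻¹ = diagTorus K n (d ∘ w) := by
  rw [weyl_mul_diagTorus, mul_inv_cancel_right]

theorem weyl_mem_normalizer (w : Equiv.Perm (Fin n)) :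
    weyl K w ∈ (iwahoriDatum n hϖ hq hn).N := by
  rw [Subgroup.mem_normalizer_iff]
  intro g
  constructor
  · rintro ⟨d, hd, rfl⟩
    rw [weyl_conj_diagTorus]
    exact ⟨_, fun i => hd (w i), rfl⟩
  · rintro ⟨d, hd, hdg⟩
    refine ⟨d ∘ w.symm, fun i => hd _, ?_⟩
    have h1 : weyl K w * diagTorus K n (d ∘ w.symm) * (weyl K w)⁻¹ = weyl K w * g * (weyl K w)⁻¹ := by
      rw [weyl_conj_diagTorus, ← hdg]
      congr 1
      funext i
      simp
    exact mul_left_cancel (mul_right_cancel h1)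

variable (hπ : IsSmooth π) (hT : (iwahoriDatum n hϖ hq hn).TorusTrivial π)

/-- The action of a permutation matrix on the vectors fixed by the pro-`ℓ` Iwahori subgroup. -/
def weylAction (w : Equiv.Perm (Fin n)) :
    Module.End C ((iwahoriDatum n hϖ hq hn).fixedVectors π) :=
  (iwahoriDatum n hϖ hq hn).weylRep hπ hT ⟨weyl K w, weyl_mem_normalizer hϖ hq hn w⟩

theorem weylAction_torusAction (w : Equiv.Perm (Fin n)) (t : Fin n → Kˣ)
    (v : (iwahoriDatum n hϖ hq hn).fixedVectors π) :
    weylAction hϖ hq hn hπ hT w ((iwahoriDatum n hϖ hq hn).torusAction (diagTorusN hϖ hq hn) hπ hT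
        (MonoidAlgebra.single t 1) v) =
      (iwahoriDatum n hϖ hq hn).torusAction (diagTorusN hϖ hq hn) hπ hT
        (MonoidAlgebra.single (t ∘ w) 1) (weylAction hϖ hq hn hπ hT w v) := by
  rw [IwahoriDatum.torusAction_single, IwahoriDatum.torusAction_single, weylAction,
    ← Module.End.mul_apply, ← Module.End.mul_apply, ← map_mul, ← map_mul]
  congr 2
  exact Subtype.ext (weyl_mul_diagTorus w t)

theorem cocycle_lift_mul (f : contCocycles (residualRep π)) (a b : GL (Fin n) 𝒪[K]) :
    ((f : GL (Fin n) 𝓀[K] → congruenceInvariants π) (reductionGL K n (a * b)) : V) =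
      (f : GL (Fin n) 𝓀[K] → congruenceInvariants π) (reductionGL K n a) +
        π (integralGL K n a) ((f : GL (Fin n) 𝓀[K] → congruenceInvariants π)
          (reductionGL K n b)) := by
  rw [map_mul, f.2.2, Submodule.coe_add, residualRep_reductionGL]

theorem exists_integral_lift (y : (iwahoriDatum n hϖ hq hn).T) : ∃ a, integralGL K n a = y :=
  integralTorus_le_range y.2

theorem restriction_inflation_mk (f : contCocycles (residualRep π)) :
    ∃ F : contCocycles (parahoricRep n₁ π),
      inflationH1 n₁ π (restrictionH1 n₁ π (Submodule.Quotient.mk f)) = Submodule.Quotient.mk F ∧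
      ∀ (a : GL (Fin n) 𝒪[K]) (h : integralGL K n a ∈ parahoric K n n₁),
        (F : parahoric K n n₁ → V) ⟨integralGL K n a, h⟩ =
          (f : GL (Fin n) 𝓀[K] → congruenceInvariants π) (reductionGL K n a) := by
  refine ⟨_, rfl, fun a h => ?_⟩
  obtain ⟨b, hb, hb'⟩ := exists_parahoric_lift K n n₁ ⟨integralGL K n a, h⟩
  obtain rfl := integralGL_injective K n hb
  change ((f : GL (Fin n) 𝓀[K] → congruenceInvariants π)
    (parahoricReduction K n n₁ ⟨integralGL K n b, h⟩ : GL (Fin n) 𝓀[K]) : V) = _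
  rw [← hb']

/-- The values on the torus of the restriction of a class of `GL_n(k)` are permuted by the Weyl
group. -/
theorem exists_weylAction_eq (c : H1 (residualRep π)) (w : Equiv.Perm (Fin n))
    (y : (iwahoriDatum n hϖ hq hn).T) : ∃ y' : (iwahoriDatum n hϖ hq hn).T,
      parahoricEval hϖ hq hn hπ hT n₁ y (inflationH1 n₁ π (restrictionH1 n₁ π c)) =
        weylAction hϖ hq hn hπ hT w
          (parahoricEval hϖ hq hn hπ hT n₁ y' (inflationH1 n₁ π (restrictionH1 n₁ π c))) := by
  obtain ⟨f, rfl⟩ := Submodule.Quotient.mk_surjective _ c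
  obtain ⟨F, hF, hFf⟩ := restriction_inflation_mk (n₁ := n₁) f
  let D := iwahoriDatum n hϖ hq hn
  have hwN := weyl_mem_normalizer (K := K) hϖ hq hn w
  have hy' : (weyl K w)⁻¹ * y * weyl K w ∈ D.T := (Subgroup.mem_normalizer_iff''.1 hwN y).1 y.2
  refine ⟨⟨_, hy'⟩, ?_⟩
  obtain ⟨a, ha⟩ := weyl_mem_range (K := K) w
  obtain ⟨b, hb⟩ := exists_integral_lift hϖ hq hn y
  obtain ⟨b', hb'⟩ := exists_integral_lift hϖ hq hn ⟨_, hy'⟩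
  have hTp := integralTorus_le_parahoric (n := n) hϖ n₁
  have e1 : ∀ (y : D.T) b, integralGL K n b = y → (F : parahoric K n n₁ → V) ⟨y, hTp y.2⟩ =
      (f : GL (Fin n) 𝓀[K] → congruenceInvariants π) (reductionGL K n b) := by
    rintro ⟨_, hy⟩ b rfl
    exact hFf b _
  have hcomm : a * b' = b * a := integralGL_injective K n (by
    rw [map_mul, map_mul, ha, hb, hb']
    group)
  -- Expanding f(w y') = f(y w) in both ways gives f(w) + w f(y') = f(y) + y f(w). The projection
  -- absorbs y in the last term, so the two terms in f(w) cancel.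
  have h1 := cocycle_lift_mul f a b'
  rw [hcomm, cocycle_lift_mul f b a, ha, hb, ← e1 _ b hb, ← e1 _ b' hb'] at h1
  rw [hF]
  apply Subtype.ext
  rw [weylAction, IwahoriDatum.weylRep_apply]
  change D.proj hπ _ = D.proj hπ (π (weyl K w) (D.proj hπ _))
  have h2 := D.proj_translate hπ hT (parahoric_isOpen K n n₁) (proIwahori_le_parahoric hϖ n₁) hTp
    hwN ⟨_, hy'⟩ F
  rw [← h2]
  have h3 := congrArg (D.proj hπ) h1
  rw [map_add, map_add, D.proj_apply_T hπ hT y.2, add_comm] at h3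
  exact add_left_cancel h3

/-- A class of `GL_n(k)` vanishing on the torus vanishes. -/
theorem eq_zero_of_parahoricEval (hnp : n < p) {c : H1 (residualRep π)}
    (hc : ∀ y, parahoricEval hϖ hq hn hπ hT n₁ y
      (inflationH1 n₁ π (restrictionH1 n₁ π c)) = 0) : c = 0 := by
  obtain ⟨f, rfl⟩ := Submodule.Quotient.mk_surjective _ c
  obtain ⟨F, hF, hFf⟩ := restriction_inflation_mk (n₁ := n₁) f
  set D := iwahoriDatum n hϖ hq hn with hD
  have hTp := integralTorus_le_parahoric (n := n) hϖ n₁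
  have hUp := proIwahori_le_parahoric (n := n) hϖ n₁
  obtain ⟨v, hvU, hvT⟩ := D.cocycle_decomp (parahoric_isOpen K n n₁) hUp hTp F
  have hv : v ∈ congruenceInvariants π := by
    rw [mem_congruenceInvariants]
    rintro _ ⟨a, ha, rfl⟩
    have h1 := hvU (integralGL K n a) (fullCongruence_le_proIwahori ⟨a, ha, rfl⟩)
    have hf1 : (f : GL (Fin n) 𝓀[K] → congruenceInvariants π) 1 = 0 := by
      simpa using f.2.2 1 1
    rw [hFf, MonoidHom.mem_ker.1 ha, hf1, Submodule.coe_zero] at h1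
    exact sub_eq_zero.1 h1.symm
  -- The corrected value at y is U-fixed, hence equal to its own projection, which is zero by
  -- hypothesis.
  have hFT : ∀ y (hy : y ∈ D.T), (F : parahoric K n n₁ → V) ⟨y, hTp hy⟩ = π y v - v := by
    intro y hy
    have h1 := D.proj_of_mem hπ (hvT y hy)
    have h2 := congrArg Subtype.val (hc ⟨y, hy⟩)
    rw [hF] at h2
    change D.proj hπ ((F : parahoric K n n₁ → V) ⟨y, hTp hy⟩) = 0 at h2
    have h3 := D.proj_torus_coboundary hπ hT (one_mem _) hy v
    rw [map_one, Module.End.one_apply] at h3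
    rw [map_sub, h2, h3, sub_zero] at h1
    exact sub_eq_zero.1 h1.symm
  let v' : congruenceInvariants π := ⟨v, hv⟩
  -- The corrected class vanishes on the torus over the residue field, because diagonal matrices
  -- lift to T; it is then a coboundary, since the index of that torus is invertible.
  let g : GL (Fin n) 𝓀[K] → congruenceInvariants π := fun x => (f : _ → _) x - (residualRep π x v' - v')
  have hg : ∀ x y, g (x * y) = g x + residualRep π x (g y) := by
    intro x y
    have := f.2.2 x y
    simp only [g, this, map_mul, Module.End.mul_apply, map_sub]
    abel
  obtain ⟨u, hu⟩ := coboundary_of_vanishing (C := C) (residualRep π) g hg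
    (diagTorus 𝓀[K] n).range (by
      rintro _ ⟨d, rfl⟩
      choose e he using fun i => IsLocalRing.surjective_units_map_of_local_ringHom
        (IsLocalRing.residue 𝒪[K]) IsLocalRing.residue_surjective inferInstance (d i)
      let t : Fin n → Kˣ := fun i => Units.map (algebraMap 𝒪[K] K).toMonoidHom (e i)
      have ht : diagTorus K n t ∈ D.T := ⟨t, fun i => integer_isUnit_iff.1 (e i).isUnit, rfl⟩
      obtain ⟨a, ha⟩ := exists_integral_lift hϖ hq hn ⟨_, ht⟩
      have hred : reductionGL K n a = diagTorus 𝓀[K] n d := by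
        ext i j
        have h1 := congrArg (fun g : GL (Fin n) K => (g : Matrix (Fin n) (Fin n) K) i j) ha
        have h2 : (a : Matrix (Fin n) (Fin n) 𝒪[K]) i j =
            Matrix.diagonal (fun i => (e i : 𝒪[K])) i j := by
          apply Subtype.ext
          rw [← integralGL_apply]
          refine h1.trans ?_
          rw [coe_diagTorus, Matrix.diagonal_apply, Matrix.diagonal_apply]
          split_ifs <;> rfl
        rw [reductionGL_apply, h2, coe_diagTorus, Matrix.diagonal_apply, Matrix.diagonal_apply]
        split_ifs
        · rw [← he]; rfl
        · simp
      apply Subtype.ext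
      have h3 := hFT _ ht
      have h4 : (F : parahoric K n n₁ → V) ⟨diagTorus K n t, hTp ht⟩ =
          (f : GL (Fin n) 𝓀[K] → congruenceInvariants π) (reductionGL K n a) := by
        have : (⟨diagTorus K n t, hTp ht⟩ : parahoric K n n₁) =
          ⟨integralGL K n a, ha ▸ hTp ht⟩ := Subtype.ext ha.symm
        rw [this, hFf]
      rw [h4] at h3
      simp only [g, Submodule.coe_sub, Submodule.coe_zero]
      rw [← hred, residualRep_reductionGL, h3, ha]
      exact sub_self _)
    (index_diagTorus_ne_zero n 𝓀[K] (p := p) hq hnp)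
  rw [Submodule.Quotient.mk_eq_zero]
  refine ⟨u + v', fun x => ?_⟩
  have := hu x
  simp only [g] at this
  rw [sub_eq_iff_eq_add] at this
  rw [this, map_add]
  abel

theorem twistedChar_eq_comp (χ : Fin n → Kˣ →* Cˣ) (w : Equiv.Perm (Fin n)) :
    twistedChar χ w = (twistedChar χ 1).comp (permCoord Kˣ w) := by
  refine MonoidHom.ext fun t => ?_
  rw [MonoidHom.comp_apply, twistedChar_apply, twistedChar_apply]
  rfl

/-- A class killed by e_α after restriction has torus values annihilated by one power of the Hecke
element. This element is nonzero at some weight, and the torus values are permuted by the Weyl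
group, so the averaging argument over the orbit makes them all vanish. -/
theorem injective_projectorE [CompactSpace 𝒪[K]]
    (hϖ : Valued.v (ϖ : K) = WithZero.exp (-1 : ℤ)) (hq : Nat.card 𝓀[K] ≡ 1 [MOD p])
    (hπ : IsSmooth π) (hnp : n < p) {n₂ : ℕ} (hn₂ : n₁ + n₂ = n)
    {α : C} {s : Multiset C} (hα : n₂ ≤ open Classical in s.count α) (hassoc : IsAssociated π ϖ s)
    {e : Module.End C (H1 (residualParabolicRep n₁ π))} (he : IsProjectorE π n₁ n₂ ϖ s α e) :
    Function.Injective (e.rangeRestrict ∘ₗ restrictionH1 n₁ π) := by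
  have hn : n ≤ p := hnp.le
  obtain ⟨χ, hχ, hs, hsub⟩ := hassoc
  obtain ⟨hT, h0⟩ := torusAction_eq_zero hϖ hq hn hπ hχ hsub
  rw [injective_iff_map_eq_zero]
  intro c hc
  have hec : e (restrictionH1 n₁ π c) = 0 := congrArg Subtype.val hc
  -- The limit is attained on the given class, so a single exponent m! suffices.
  obtain ⟨m, hm⟩ := (he (restrictionH1 n₁ π c)).exists
  rw [hec, map_zero] at hm
  obtain ⟨w₀, hw₀⟩ := exists_weightEval_heckeElementQ_ne_zero (C := C) (ϖ := ϖ) hn₂ hs hα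
  refine eq_zero_of_parahoricEval (n₁ := n₁) hϖ hq hn hπ hT hnp fun y => ?_
  have hQ : weightEval (twistedChar χ 1) w₀ (heckeElementQ n n₁ n₂ ϖ s α ^ m.factorial) ≠ 0 := by
    rw [map_pow]
    exact pow_ne_zero _ hw₀
  have hfac : (n.factorial : C) ≠ 0 := by
    rw [Ne, CharP.cast_eq_zero_iff C p, (Fact.out : p.Prime).dvd_factorial]
    omega
  have h0' : ∀ a, (∀ w, weightEval (twistedChar χ 1) w a = 0) →
      (iwahoriDatum n hϖ hq hn).torusAction (diagTorusN hϖ hq hn) hπ hT a = 0 := by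
    intro a ha
    refine h0 a fun w => ?_
    rw [twistedChar_eq_comp]
    exact ha w
  refine eq_zero_of_weights (weylAction_torusAction hϖ hq hn hπ hT) h0' hQ hfac fun w => ?_
  obtain ⟨y', hy'⟩ := exists_weylAction_eq (n₁ := n₁) hϖ hq hn hπ hT c w y
  refine ⟨_, hy', ?_⟩
  rw [← parahoricEval_opQ_pow hϖ hq hn hπ hT hn₂, hm, map_zero]

/-- The inflation is bijective, `e_α` exists, and `e_α ∘ res` is injective. -/
theorem bijective_inflationH1_and_exists_projectorE (k : Type*) [Field k] [Finite k] [Algebra k C]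
    [Algebra.IsAlgebraic k C] [CompactSpace 𝒪[K]]
    (hϖ : Valued.v (ϖ : K) = WithZero.exp (-1 : ℤ)) (hq : Nat.card 𝓀[K] ≡ 1 [MOD p])
    (hπ : IsAdmissible π) (hnp : n < p) {n₂ : ℕ} (hn₂ : n₁ + n₂ = n)
    {α : C} {s : Multiset C} (hα : n₂ ≤ open Classical in s.count α)
    (hassoc : IsAssociated π ϖ s) :
    Function.Bijective (inflationH1 n₁ π) ∧
    ∃ e : Module.End C (H1 (residualParabolicRep n₁ π)), IsProjectorE π n₁ n₂ ϖ s α e ∧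
      Function.Injective (e.rangeRestrict ∘ₗ restrictionH1 n₁ π) := by
  have hbij : Function.Bijective (inflationH1 n₁ π) :=
    ⟨inflationH1_injective, inflationH1_surjective hϖ hq hnp.le⟩
  obtain ⟨e, he⟩ := exists_isProjectorE k hϖ hπ hbij n₂ s α
  exact ⟨hbij, e, he, injective_projectorE hϖ hq hπ.smooth hnp hn₂ hα hassoc he⟩

end Injectivity

end ModPLocal

end

theorem mainTheorem8 {p : ℕ} [Fact p.Prime]
    {k : Type*} [Field k] [Finite k] [TopologicalSpace k] [DiscreteTopology k]
    [Algebra k (AlgebraicClosure (ZMod p))]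
    {F : Type*} [Field F] [NumberField F]
    (x : IsDedekindDomain.HeightOneSpectrum (NumberField.RingOfIntegers F))
    (hq : Nat.card 𝓀[x.adicCompletion F] ≡ 1 [MOD p])
    {n n₁ n₂ : ℕ} (hn : n₁ + n₂ = n) (hp : n < p)
    (ρ : AbsGal (x.adicCompletion F) →* GL (Fin n) k) (hcont : Continuous ρ)
    (hunr : ∀ σ, IsInertial σ → ρ σ = 1)
    (hss : (standardRep ρ).IsSemisimpleRepresentation)
    (φ : AbsGal (x.adicCompletion F)) (hφ : IsGeometricFrobenius φ)
    (ϖ : (x.adicCompletion F)ˣ) (hϖ : Valued.v (ϖ : x.adicCompletion F) = WithZero.exp (-1 : ℤ))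
    (α : AlgebraicClosure (ZMod p))
    (hα : n₂ ≤ Polynomial.rootMultiplicity α
      ((ρ φ : Matrix (Fin n) (Fin n) k).charpoly.map (algebraMap k (AlgebraicClosure (ZMod p)))))
    {V : Type*} [AddCommGroup V] [Module (AlgebraicClosure (ZMod p)) V]
    (π : Representation (AlgebraicClosure (ZMod p)) (GL (Fin n) (x.adicCompletion F)) V)
    (hirr : π.IsIrreducible) (hadm : IsAdmissible π)
    (hassoc : IsAssociated π ϖ (eigenvaluesIn (AlgebraicClosure (ZMod p)) (ρ φ))) :
    Function.Bijective (inflationH1 n₁ π) ∧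
    ∃ e : Module.End (AlgebraicClosure (ZMod p)) (H1 (residualParabolicRep n₁ π)),
      IsProjectorE π n₁ n₂ ϖ (eigenvaluesIn (AlgebraicClosure (ZMod p)) (ρ φ)) α e ∧
      Function.Injective (e.rangeRestrict ∘ₗ restrictionH1 n₁ π) := by
  classical
  -- An infinite set has `Nat.card` equal to 0, which is not 1 modulo p.
  have hfin : Finite 𝓀[x.adicCompletion F] := by
    refine Nat.finite_of_card_ne_zero fun h => ?_
    rw [h] at hq
    exact (Fact.out : p.Prime).one_lt.ne' (Nat.dvd_one.1 ((Nat.modEq_zero_iff_dvd).1 hq.symm))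
  have hcompact := compactSpace_integer x
  have hα' : n₂ ≤ (eigenvaluesIn (AlgebraicClosure (ZMod p)) (ρ φ)).count α := by
    rw [eigenvaluesIn, Polynomial.count_roots]
    exact hα
  -- The prime field serves as the finite field over which the coefficients are algebraic.
  exact bijective_inflationH1_and_exists_projectorE (ZMod p) hϖ hq hadm hp hn hα' hassoc
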